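/- Consider $m$ bosonic modes with Hilbert space $\mathcal H=L^2(\mathbb R^m)$, canonical variables $[x_j,p_k]=i\delta_{jk}$, number states $|n\rangle$ ($n\in\mathbb N^m$), number operators $N_j$, and displacement operators $D(\underline\alpha)$, $\alpha_j=(x_j+ip_j)/\sqrt2$. A trace class operator $\sigma$ has the Wigner function $W_\sigma(x,p)=\pi^{-m}\operatorname{tr}\,\sigma D(\underline\alpha)(-1)^{N_1+\dots+N_m}D(\underline\alpha)^\dagger$, and a bounded operator $M$ has the Wigner function $W_M$ if $\operatorname{tr} M\sigma=(2\pi)^m\int W_M W_\sigma\,d^mx\,d^mp$ for all $\sigma=|k\rangle\langle j|$ (with an integrable integrand). A W+ POVM is a pair $(M,\mathbf 1-M)$ with $0\le M\le\mathbf 1$ such that $M$ and $\mathbf 1-M$ both have non-negative Wigner functions. For states $\rho_0,\rho_1$ the quantity $\|\rho_0-\rho_1\|_{W+}$ is defined by $$\inf_{(M,\mathbf 1-M)\ \text{W+ POVM}}\Bigl(\tfrac12\operatorname{tr}\rho_0(\mathbf 1-M)+\tfrac12\operatorname{tr}\rho_1M\Bigr)=\tfrac12\Bigl(1-\tfrac12\|\rho_0-\rho_1\|_{W+}\Bigr).$$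 Let $\rho_0,\rho_1$ be two $m$-mode states whose average photon number per mode is bounded by $\overline E\ge0$, i.e. $\operatorname{tr}\rho_i(N_1+\dots+N_m)\le m\overline E$ for $i=0,1$, and suppose $\|\rho_0-\rho_1\|_1\ge t=4c+r$ with $c>0$ and $r\ge0$. Then $$\|\rho_0-\rho_1\|_{W+}\ \ge\ r^2\,2^{-m-1}\Bigl(1+\frac{\overline E}{c^2}\Bigr)^{-m}.$$ Consequently, W+ data hiding with bounded energy per mode requires many modes (or a very large energy per mode): if $r>0$ and $\|\rho_0-\rho_1\|_{W+}\le\delta$ with $\delta>0$, then $$m\,\ln\Bigl(2\Bigl(1+\frac{\overline E}{c^2}\Bigr)\Bigr)\ \ge\ \ln\frac{r^2}{2\delta}.$$ -/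

import Mathlib

open MeasureTheory
open scoped ENNReal InnerProductSpace

noncomputable section

namespace Bosonic

/-! ### The Hilbert space of `m` modes, in the Schrödinger representation -/

/-- The Hilbert space `L²(ℝᵐ)` of `m` bosonic modes; the canonical variables `x_j` and `p_j` act as
multiplication by the `j`-th coordinate and as `-i ∂/∂q_j`. -/
abbrev ModeSpace (m : ℕ) : Type := Lp ℂ 2 (volume : Measure (Fin m → ℝ))

/-- Bounded operators on the `m`-mode Hilbert space. -/
abbrev Op (m : ℕ) : Type := ModeSpace m →L[ℂ] ModeSpace m

/-- Phase space: pairs `(x, p)` of position and momentum vectors. -/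
abbrev PhaseSpace (m : ℕ) : Type := (Fin m → ℝ) × (Fin m → ℝ)

/-! ### Number (Fock) states -/

/-- The `n`-th Hermite function
`π^{-1/4} (n!)^{-1/2} He_n(√2 x) e^{-x²/2} = π^{-1/4} (2ⁿ n!)^{-1/2} H_n(x) e^{-x²/2}`:
the wave function of the one-mode number state with `n` photons. -/
def hermiteFun (n : ℕ) (x : ℝ) : ℝ :=
  (Real.pi ^ (1 / 4 : ℝ))⁻¹ * (Real.sqrt (n.factorial : ℝ))⁻¹ *
    Polynomial.aeval (Real.sqrt 2 * x) (Polynomial.hermite n) * Real.exp (-(x ^ 2 / 2))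

/-- The wave function of the `m`-mode number state with `n j` photons in mode `j`. -/
def fockFun {m : ℕ} (n : Fin m → ℕ) (q : Fin m → ℝ) : ℂ :=
  ∏ j, (hermiteFun (n j) (q j) : ℂ)

theorem continuous_hermiteFun (n : ℕ) : Continuous (hermiteFun n) := by
  unfold hermiteFun
  have h : Continuous fun x : ℝ =>
      Polynomial.aeval (Real.sqrt 2 * x) (Polynomial.hermite n) :=
    (Polynomial.continuous_aeval _).comp (by fun_prop)
  fun_prop

theorem integrable_poly_mul_gaussian (P : Polynomial ℝ) :
    Integrable fun x : ℝ => P.eval x * Real.exp (-(x ^ 2)) := by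
  induction P using Polynomial.induction_on' with
  | add p q hp hq =>
    refine (hp.add hq).congr (Filter.Eventually.of_forall fun x => ?_)
    simp only [Pi.add_apply, Polynomial.eval_add]
    ring
  | monomial k a =>
    have h := integrable_rpow_mul_exp_neg_mul_sq (b := 1) one_pos (s := (k : ℝ))
      (by have : (0 : ℝ) ≤ k := Nat.cast_nonneg k
          linarith)
    refine (h.const_mul a).congr (Filter.Eventually.of_forall fun x => ?_)
    simp [Polynomial.eval_monomial, Real.rpow_natCast]
    ring

theorem integrable_hermiteFun_sq (n : ℕ) : Integrable fun x : ℝ => (hermiteFun n x) ^ 2 := by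
  set P : Polynomial ℝ := ((Polynomial.hermite n).map (algebraMap ℤ ℝ)).comp
    (Polynomial.C (Real.sqrt 2) * Polynomial.X) with hP
  have h := (integrable_poly_mul_gaussian (P * P)).const_mul
    (((Real.pi ^ (1 / 4 : ℝ))⁻¹ * (Real.sqrt (n.factorial : ℝ))⁻¹) ^ 2)
  refine h.congr (Filter.Eventually.of_forall fun x => ?_)
  have hx : P.eval x = Polynomial.aeval (Real.sqrt 2 * x) (Polynomial.hermite n) := by
    simp [hP, Polynomial.eval_comp, Polynomial.aeval_def, Polynomial.eval_map]
  have he : Real.exp (-(x ^ 2)) = Real.exp (-(x ^ 2 / 2)) * Real.exp (-(x ^ 2 / 2)) := by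
    rw [← Real.exp_add]
    ring_nf
  simp only [Polynomial.eval_mul, hx, he, hermiteFun]
  ring

theorem memLp_fockFun {m : ℕ} (n : Fin m → ℕ) :
    MemLp (fockFun n) 2 (volume : Measure (Fin m → ℝ)) := by
  have hc : Continuous (fockFun n) := by
    unfold fockFun
    exact continuous_finsetProd _ fun j _ =>
      Complex.continuous_ofReal.comp ((continuous_hermiteFun (n j)).comp (continuous_apply j))
  refine (memLp_two_iff_integrable_sq_norm hc.aestronglyMeasurable).2 ?_
  have h := Integrable.fintype_prod (𝕜 := ℝ) (ι := Fin m) (E := ℝ)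
    (μ := fun _ => (volume : Measure ℝ))
    (f := fun j x => (hermiteFun (n j) x) ^ 2) fun j => integrable_hermiteFun_sq (n j)
  refine h.congr (Filter.Eventually.of_forall fun q => ?_)
  simp only [fockFun, norm_prod, Complex.norm_real, Real.norm_eq_abs, ← Finset.abs_prod, sq_abs,
    Finset.prod_pow]

/-- The number state `|n⟩ = |n₁⟩ ⊗ ⋯ ⊗ |n_m⟩`. -/
def fock {m : ℕ} (n : Fin m → ℕ) : ModeSpace m := (memLp_fockFun n).toLp (fockFun n)

/-! ### Trace, trace norm, states, photon number -/

/-- The trace of a (trace class) operator, evaluated in the number basis. -/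
def trace {m : ℕ} (T : Op m) : ℂ := ∑' n : Fin m → ℕ, ⟪fock n, T (fock n)⟫_ℂ

/-- The absolute value `|T| = (T† T)^{1/2}` of a bounded operator on a Hilbert space. -/
def absOp {H : Type*} [NormedAddCommGroup H] [InnerProductSpace ℂ H] [CompleteSpace H]
    (T : H →L[ℂ] H) : H →L[ℂ] H := CFC.abs T

/-- The trace norm `‖T‖₁ = tr |T|`. -/
def traceNorm {m : ℕ} (T : Op m) : ℝ := (trace (absOp T)).re

/-- Density operators: `ρ ≥ 0` and `tr ρ = 1`. -/
def IsState {m : ℕ} (ρ : Op m) : Prop :=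
  ρ.IsPositive ∧ HasSum (fun n : Fin m → ℕ => ⟪fock n, ρ (fock n)⟫_ℂ) 1

/-- The mean total photon number `tr ρ (N₁ + ⋯ + N_m)` of a state, possibly `∞`. -/
def meanPhotonNumber {m : ℕ} (ρ : Op m) : ℝ≥0∞ :=
  ∑' n : Fin m → ℕ, ((∑ j, n j : ℕ) : ℝ≥0∞) * ENNReal.ofReal (⟪fock n, ρ (fock n)⟫_ℂ).re

/-! ### Displacement operators, parity, Wigner functions -/

theorem memLp_phase {m : ℕ} (z : PhaseSpace m) :
    MemLp (fun q : Fin m → ℝ =>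
      Complex.exp (Complex.I * ((∑ j, z.2 j * (q j - z.1 j / 2) : ℝ) : ℂ))) ∞
      (volume : Measure (Fin m → ℝ)) := by
  refine memLp_top_of_bound (Continuous.aestronglyMeasurable (by fun_prop)) 1
    (Filter.Eventually.of_forall fun q => ?_)
  rw [mul_comm, Complex.norm_exp_ofReal_mul_I]

/-- The displacement operator `D(α)` with `α_j = (x_j + i p_j) / √2` for `z = (x, p)`:
`(D(α) ψ)(q) = e^{i p·(q - x/2)} ψ(q - x)`. -/
def displacement {m : ℕ} (z : PhaseSpace m) : Op m :=
  ((ContinuousLinearMap.mul ℂ ℂ).holderL (volume : Measure (Fin m → ℝ)) ∞ 2 2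
      ((memLp_phase z).toLp _)) ∘L
    (Lp.compMeasurePreservingₗᵢ ℂ (fun q : Fin m → ℝ => q - z.1)
      (measurePreserving_sub_right volume z.1)).toContinuousLinearMap

/-- The parity operator `(-1)^{N₁ + ⋯ + N_m}`: `ψ(q) ↦ ψ(-q)`. -/
def parity (m : ℕ) : Op m :=
  (Lp.compMeasurePreservingₗᵢ ℂ (fun q : Fin m → ℝ => -q)
    (Measure.measurePreserving_neg volume)).toContinuousLinearMap

/-- The Wigner function of a trace class operator,
`W_T(x, p) = π^{-m} tr (T D(α) (-1)^{N₁ + ⋯ + N_m} D(α)†)`. -/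
def wigner {m : ℕ} (T : Op m) (z : PhaseSpace m) : ℂ :=
  ((Real.pi ^ m)⁻¹ : ℝ) *
    trace (T ∘L displacement z ∘L parity m ∘L ContinuousLinearMap.adjoint (displacement z))

/-- `W` is the Wigner function of the bounded operator `M`, in the sense of
`tr (M σ) = (2π)^m ∫ W(x, p) W_σ(x, p) dx dp`, for all matrix units `σ = |k⟩⟨j|` of the number
basis. -/
def IsWignerFunction {m : ℕ} (M : Op m) (W : PhaseSpace m → ℝ) : Prop :=
  ∀ j k : Fin m → ℕ,
    Integrable (fun z => (W z : ℂ) * wigner (InnerProductSpace.rankOne ℂ (fock k) (fock j)) z) ∧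
    trace (M ∘L InnerProductSpace.rankOne ℂ (fock k) (fock j)) =
      ((2 * Real.pi) ^ m : ℝ) *
        ∫ z, (W z : ℂ) * wigner (InnerProductSpace.rankOne ℂ (fock k) (fock j)) z

/-! ### Measurements with non-negative Wigner functions -/

/-- `(M, 1 - M)` is a W+ POVM: a binary POVM both of whose elements have a non-negative Wigner
function. -/
def IsWPlusPOVM {m : ℕ} (M : Op m) : Prop :=
  M.IsPositive ∧ (1 - M).IsPositive ∧
    (∃ W : PhaseSpace m → ℝ, IsWignerFunction M W ∧ ∀ z, 0 ≤ W z) ∧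
    (∃ W : PhaseSpace m → ℝ, IsWignerFunction (1 - M) W ∧ ∀ z, 0 ≤ W z)

/-- The error probability `½ tr ρ₀ (1 - M) + ½ tr ρ₁ M` of the measurement `(M, 1 - M)` when
`ρ₀` and `ρ₁` are equiprobable. -/
def errorProb {m : ℕ} (ρ₀ ρ₁ M : Op m) : ℝ :=
  1 / 2 * (trace (ρ₀ ∘L (1 - M))).re + 1 / 2 * (trace (ρ₁ ∘L M)).re

/-- The distinguishability norm `‖ρ₀ - ρ₁‖_{W+}` of two states, defined by
`inf P_e = ½ (1 - ½ ‖ρ₀ - ρ₁‖_{W+})`, the infimum over all W+ POVMs. -/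
def wPlusDist {m : ℕ} (ρ₀ ρ₁ : Op m) : ℝ :=
  2 * (1 - 2 * sInf {e : ℝ | ∃ M : Op m, IsWPlusPOVM M ∧ e = errorProb ρ₀ ρ₁ M})

end Bosonic

end

noncomputable section

namespace Bosonic

/-! ### Integrability of polynomials against a Gaussian -/

section

/-! The trace norm and the W+ norm are compared through the operator norm. Write `lam` for the
operator norm of ρ₀ - ρ₁, w for the W+ distance, A_z for the displaced parity operators, y = E /
(2c), and D = (1 + E / c²)^m.

Operator norm against W+ norm. If X is self-adjoint with Weyl symbol g (its Wigner function times
(2π)^m), and both ‖X‖ and |g| are at most T, then (1 ± X/T)/2 is a W+ POVM, so |tr (ρ₀ - ρ₁) X| ≤ T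
w (`abs_mul_le_wPlusDist`). This is applied to X = |v⟩⟨v| for unit vectors v that are finite
superpositions of number states; these are dense, so they determine `lam`. The symbol 2^m ⟨v, A_z v⟩
is at most 2^m because A_z is a contraction, which gives lam ≤ 2^m w (`norm_sub_le_two_pow_mul`). A
better bound for small w comes from cutting the symbol off at a level T < 2^m. The L⁴ estimate ∫
|⟨v, A_z v⟩|⁴ ≤ (π/4)^m shows that the discarded part quantizes to an operator of norm at most 4^m /
T³, and balancing T gives lam⁴ ≤ 32 · 4^m w³ (`norm_sub_pow_four_le`).

Trace norm against operator norm. Keep the number states with at most N = ⌊y m⌋ photons and let d be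
their number. By Markov's inequality each state has weight at most 2c outside, which uses up the 4c
in the hypothesis and leaves r ≤ 2 d lam (`le_two_mul_card_mul_norm`). A generating function
argument bounds d.

Comparison of d with D. As a trace distance is at most 2, c ≤ (2 - r)/4, and D exceeds (1 + 4y)^m by
a factor that absorbs r (`mul_le_one_add_pow`). For y ≥ 1/10 one has d ≤ (1 + 4y)^m and the linear
bound on `lam` suffices. For small y and large m the entropy term y log (1/y) makes d larger than (1
+ 4y)^m. There the fourth power bound is used: it sets four powers of d against three powers of D
and a spare factor 2^m. When N = 0 only the vacuum is kept, d = 1, and the one delicate range m E ≤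
c² is excluded by a sharper estimate around the vacuum (`traceNorm_sub_le_of_vacuum`).

The analytic groundwork is that the number states are a Hilbert basis, that their cross Wigner
functions are integrable, and that Moyal's identity holds, so that 1 and |v⟩⟨v| have the expected
symbols. -/

open Polynomial in
theorem integrable_polynomial_mul_exp_neg_mul_sq (P : ℝ[X]) {b : ℝ} (hb : 0 < b) :
    Integrable fun x : ℝ => P.eval x * Real.exp (-(b * x ^ 2)) := by
  induction P using Polynomial.induction_on' with
  | add p q hp hq =>
    refine (hp.add hq).congr (Filter.Eventually.of_forall fun x => ?_)
    simp only [Pi.add_apply, Polynomial.eval_add]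
    ring
  | monomial k a =>
    have h := integrable_rpow_mul_exp_neg_mul_sq (b := b) hb (s := (k : ℝ))
      (by have : (0 : ℝ) ≤ k := Nat.cast_nonneg k
          linarith)
    refine (h.const_mul a).congr (Filter.Eventually.of_forall fun x => ?_)
    simp [Polynomial.eval_monomial, Real.rpow_natCast]
    ring

/-! ### Orthonormality of the number states -/

/-- The probabilists' Hermite polynomial with real coefficients. -/
def realHermite (n : ℕ) : Polynomial ℝ := (Polynomial.hermite n).map (algebraMap ℤ ℝ)

theorem eval_realHermite (n : ℕ) (x : ℝ) :
    (realHermite n).eval x = Polynomial.aeval x (Polynomial.hermite n) := by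
  simp [realHermite, Polynomial.aeval_def, Polynomial.eval_map]

theorem realHermite_succ (n : ℕ) :
    realHermite (n + 1) =
      Polynomial.X * realHermite n - Polynomial.derivative (realHermite n) := by
  simp [realHermite, Polynomial.hermite_succ, Polynomial.derivative_map]

theorem realHermite_monic (n : ℕ) : (realHermite n).Monic :=
  (Polynomial.hermite_monic n).map _

theorem natDegree_realHermite (n : ℕ) : (realHermite n).natDegree = n := by
  rw [realHermite, (Polynomial.hermite_monic n).natDegree_map, Polynomial.natDegree_hermite]

theorem hasDerivAt_realHermite_mul_gaussian (n : ℕ) (y : ℝ) :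
    HasDerivAt (fun y => (realHermite n).eval y * Real.exp (-(1 / 2 * y ^ 2)))
      (-((realHermite (n + 1)).eval y * Real.exp (-(1 / 2 * y ^ 2)))) y := by
  have h1 := (realHermite n).hasDerivAt y
  have h2 : HasDerivAt (fun y : ℝ => Real.exp (-(1 / 2 * y ^ 2)))
      (Real.exp (-(1 / 2 * y ^ 2)) * (-y)) y := by
    have h3 : HasDerivAt (fun y : ℝ => -(1 / 2 * y ^ 2)) (-y) y := by
      have := ((hasDerivAt_pow 2 y).const_mul (1 / 2 : ℝ)).fun_neg
      convert! this using 1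
      ring
    exact h3.exp
  convert! h1.mul h2 using 1
  rw [realHermite_succ]
  simp only [Polynomial.eval_sub, Polynomial.eval_mul, Polynomial.eval_X]
  ring

/-- The Hermite polynomial times the Gaussian is, up to sign, a derivative of the previous one, so n
integrations by parts move all derivatives onto P. -/
theorem integral_realHermite_mul (n : ℕ) (P : Polynomial ℝ) :
    ∫ y, (realHermite n).eval y * P.eval y * Real.exp (-(1 / 2 * y ^ 2)) =
      ∫ y, (Polynomial.derivative^[n] P).eval y * Real.exp (-(1 / 2 * y ^ 2)) := by
  induction n generalizing P with
  | zero => simp [realHermite]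
  | succ n ih =>
    have key := integral_mul_deriv_eq_deriv_mul_of_integrable
      (u := fun y => P.eval y) (u' := fun y => (Polynomial.derivative P).eval y)
      (v := fun y => (realHermite n).eval y * Real.exp (-(1 / 2 * y ^ 2)))
      (v' := fun y => -((realHermite (n + 1)).eval y * Real.exp (-(1 / 2 * y ^ 2))))
      (fun y _ => P.hasDerivAt y) (fun y _ => hasDerivAt_realHermite_mul_gaussian n y)
      (by
        refine (integrable_polynomial_mul_exp_neg_mul_sq (-(P * realHermite (n + 1)))
          (b := 1 / 2) (by norm_num)).congr (Filter.Eventually.of_forall fun y => ?_)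
        simp only [Polynomial.eval_neg, Polynomial.eval_mul, Pi.mul_apply]
        ring)
      (by
        refine (integrable_polynomial_mul_exp_neg_mul_sq (Polynomial.derivative P * realHermite n)
          (b := 1 / 2) (by norm_num)).congr (Filter.Eventually.of_forall fun y => ?_)
        simp only [Polynomial.eval_mul, Pi.mul_apply]
        ring)
      (by
        refine (integrable_polynomial_mul_exp_neg_mul_sq (P * realHermite n)
          (b := 1 / 2) (by norm_num)).congr (Filter.Eventually.of_forall fun y => ?_)
        simp only [Polynomial.eval_mul, Pi.mul_apply]
        ring)
    have e1 : ∀ y : ℝ, (realHermite (n + 1)).eval y * P.eval y * Real.exp (-(1 / 2 * y ^ 2)) =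
        -(P.eval y * -((realHermite (n + 1)).eval y * Real.exp (-(1 / 2 * y ^ 2)))) := by
      intro y; ring
    rw [integral_congr_ae (Filter.Eventually.of_forall e1), integral_neg, key, neg_neg,
      Function.iterate_succ_apply, ← ih]
    congr 1
    ext y
    ring

/-- After exchanging the indices so that k ≤ n, the n-th derivative of the k-th polynomial vanishes
for k < n by degree and is the constant n! for k = n by monicity. -/
theorem integral_realHermite_mul_realHermite (n k : ℕ) :
    ∫ y, (realHermite n).eval y * (realHermite k).eval y * Real.exp (-(1 / 2 * y ^ 2)) =
      if n = k then (n.factorial : ℝ) * Real.sqrt (2 * Real.pi) else 0 := by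
  wlog h : k ≤ n generalizing n k
  · rw [integral_congr_ae (Filter.Eventually.of_forall fun y =>
      show _ = (realHermite k).eval y * (realHermite n).eval y * Real.exp (-(1 / 2 * y ^ 2)) by
        ring), this k n (by omega)]
    have : n ≠ k := by omega
    simp [this, this.symm]
  rw [integral_realHermite_mul]
  rcases h.lt_or_eq with h | h
  · have : n ≠ k := by omega
    rw [Polynomial.iterate_derivative_eq_zero (by rw [natDegree_realHermite]; exact h)]
    simp [this]
  · subst h
    have hd : Polynomial.derivative^[k] (realHermite k) = Polynomial.C (k.factorial : ℝ) := by
      have h0 : (Polynomial.derivative^[k] (realHermite k)).natDegree ≤ 0 := by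
        refine (Polynomial.natDegree_iterate_derivative _ _).trans ?_
        rw [natDegree_realHermite]; omega
      rw [Polynomial.eq_C_of_natDegree_le_zero h0, Polynomial.coeff_iterate_derivative]
      have : (realHermite k).coeff (0 + k) = 1 := by
        rw [zero_add]
        have := realHermite_monic k
        rwa [Polynomial.Monic, Polynomial.leadingCoeff, natDegree_realHermite] at this
      rw [this]
      simp [Nat.descFactorial_self]
    simp only [hd, Polynomial.eval_C, if_true]
    rw [integral_const_mul]
    have := integral_gaussian (1 / 2)
    simp only [neg_mul] at this
    rw [this]
    congr 2
    field_simp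

theorem hermiteFun_eq (n : ℕ) (x : ℝ) :
    hermiteFun n x = (Real.pi ^ (1 / 4 : ℝ))⁻¹ * (Real.sqrt (n.factorial : ℝ))⁻¹ *
      (realHermite n).eval (Real.sqrt 2 * x) * Real.exp (-(1 / 2 * x ^ 2)) := by
  rw [hermiteFun, eval_realHermite]
  congr 3
  ring

theorem integral_hermiteFun_mul (n k : ℕ) :
    ∫ x, hermiteFun n x * hermiteFun k x = if n = k then 1 else 0 := by
  set F : ℝ → ℝ := fun y =>
    (realHermite n).eval y * (realHermite k).eval y * Real.exp (-(1 / 2 * y ^ 2)) with hF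
  have hs : Real.sqrt 2 * Real.sqrt 2 = 2 := Real.mul_self_sqrt (by norm_num)
  have e : ∀ x, hermiteFun n x * hermiteFun k x =
      ((Real.pi ^ (1 / 4 : ℝ))⁻¹ * (Real.pi ^ (1 / 4 : ℝ))⁻¹ *
        ((Real.sqrt (n.factorial : ℝ))⁻¹ * (Real.sqrt (k.factorial : ℝ))⁻¹)) *
        F (Real.sqrt 2 * x) := by
    intro x
    have : Real.exp (-(1 / 2 * (Real.sqrt 2 * x) ^ 2)) =
        Real.exp (-(1 / 2 * x ^ 2)) * Real.exp (-(1 / 2 * x ^ 2)) := by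
      rw [← Real.exp_add]
      congr 1
      rw [mul_pow, sq (Real.sqrt 2), hs]
      ring
    simp only [hF, this, hermiteFun_eq]
    ring
  rw [integral_congr_ae (Filter.Eventually.of_forall e), integral_const_mul,
    Measure.integral_comp_mul_left, hF, integral_realHermite_mul_realHermite]
  split_ifs with h
  · subst h
    have h4 : Real.pi ^ (1 / 4 : ℝ) * Real.pi ^ (1 / 4 : ℝ) = Real.sqrt Real.pi := by
      rw [← Real.rpow_add Real.pi_pos, Real.sqrt_eq_rpow]; norm_num
    have h5 : Real.sqrt (n.factorial : ℝ) * Real.sqrt (n.factorial : ℝ) = n.factorial :=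
      Real.mul_self_sqrt (by positivity)
    rw [← mul_inv, ← mul_inv, h4, h5, Real.sqrt_mul (by norm_num), smul_eq_mul,
      abs_of_pos (by positivity)]
    have : (n.factorial : ℝ) ≠ 0 := by positivity
    field_simp
  · simp

theorem fock_coeFn {m : ℕ} (n : Fin m → ℕ) : fock n =ᵐ[volume] fockFun n :=
  (memLp_fockFun n).coeFn_toLp

theorem inner_toLp_toLp {m : ℕ} {u v : (Fin m → ℝ) → ℂ} (hu : MemLp u 2 volume)
    (hv : MemLp v 2 volume) :
    ⟪(hu.toLp u : ModeSpace m), hv.toLp v⟫_ℂ = ∫ q, starRingEnd ℂ (u q) * v q := by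
  rw [L2.inner_def]
  refine integral_congr_ae ?_
  filter_upwards [hu.coeFn_toLp, hv.coeFn_toLp] with q h1 h2
  rw [h1, h2, RCLike.inner_apply, mul_comm]

theorem conj_fockFun {m : ℕ} (n : Fin m → ℕ) (q : Fin m → ℝ) :
    starRingEnd ℂ (fockFun n q) = fockFun n q := by
  simp [fockFun, map_prod]

theorem inner_fock_fock {m : ℕ} (n k : Fin m → ℕ) :
    ⟪fock n, fock k⟫_ℂ = if n = k then 1 else 0 := by
  rw [fock, fock, inner_toLp_toLp]
  have e : ∀ q : Fin m → ℝ, starRingEnd ℂ (fockFun n q) * fockFun k q =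
      ∏ j, ((hermiteFun (n j) (q j) * hermiteFun (k j) (q j) : ℝ) : ℂ) := by
    intro q
    rw [conj_fockFun, fockFun, fockFun, ← Finset.prod_mul_distrib]
    simp
  rw [integral_congr_ae (Filter.Eventually.of_forall e),
    integral_fintype_prod_volume_eq_prod (fun j x =>
      ((hermiteFun (n j) x * hermiteFun (k j) x : ℝ) : ℂ))]
  simp only [integral_complex_ofReal, integral_hermiteFun_mul]
  split_ifs with h
  · subst h; simp
  · obtain ⟨j, hj⟩ := Function.ne_iff.mp h
    exact Finset.prod_eq_zero (Finset.mem_univ j) (by simp [hj])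

theorem orthonormal_fock (m : ℕ) : Orthonormal ℂ (fock : (Fin m → ℕ) → ModeSpace m) :=
  orthonormal_iff_ite.2 inner_fock_fock

end

section

/-! ### The oscillatory integral `G ↦ ∫ e^{2i p·s} G(s) ds` on `ℝᵐ` -/

section Osc

open scoped FourierTransform

variable {m : ℕ}

/-- The character `s ↦ e^{2i p·s}`. -/
def osc (p s : Fin m → ℝ) : ℂ :=
  Complex.exp (((2 * ∑ j, p j * s j : ℝ) : ℂ) * Complex.I)

theorem norm_osc (p s : Fin m → ℝ) : ‖osc p s‖ = 1 :=
  Complex.norm_exp_ofReal_mul_I _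

theorem continuous_osc : Continuous fun z : (Fin m → ℝ) × (Fin m → ℝ) => osc z.1 z.2 := by
  unfold osc
  fun_prop

theorem osc_comm (p s : Fin m → ℝ) : osc p s = osc s p := by
  simp [osc, mul_comm]

theorem osc_add (p s t : Fin m → ℝ) : osc p (s + t) = osc p s * osc p t := by
  rw [osc, osc, osc, ← Complex.exp_add, ← add_mul, ← Complex.ofReal_add, ← mul_add,
    ← Finset.sum_add_distrib]
  simp [mul_add]

theorem conj_osc (p s : Fin m → ℝ) : starRingEnd ℂ (osc p s) = osc p (-s) := by
  rw [osc, osc, ← Complex.exp_conj, map_mul, Complex.conj_ofReal, Complex.conj_I]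
  simp

/-- The oscillatory integral `∫ e^{2i p·s} G(s) ds`. -/
def oscFT (G : (Fin m → ℝ) → ℂ) (p : Fin m → ℝ) : ℂ := ∫ s, osc p s * G s

theorem continuous_osc_right (p : Fin m → ℝ) : Continuous fun s => osc p s :=
  continuous_osc.comp (by fun_prop : Continuous fun s : Fin m → ℝ => (p, s))

theorem integrable_osc_mul {G : (Fin m → ℝ) → ℂ} (hG : Integrable G) (p : Fin m → ℝ) :
    Integrable fun s => osc p s * G s :=
  hG.bdd_mul (c := 1) (continuous_osc_right p).aestronglyMeasurable
    (Filter.Eventually.of_forall fun s => (norm_osc p s).le)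

theorem integral_ofLp (G : (Fin m → ℝ) → ℂ) :
    ∫ s : EuclideanSpace ℝ (Fin m), G s.ofLp = ∫ s, G s :=
  (PiLp.volume_preserving_ofLp (Fin m)).integral_comp
    (MeasurableEquiv.toLp 2 (Fin m → ℝ)).symm.measurableEmbedding G

theorem integrable_ofLp {G : (Fin m → ℝ) → ℂ} :
    Integrable (fun s : EuclideanSpace ℝ (Fin m) => G s.ofLp) ↔ Integrable G :=
  (PiLp.volume_preserving_ofLp (Fin m)).integrable_comp_emb
    (MeasurableEquiv.toLp 2 (Fin m → ℝ)).symm.measurableEmbedding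

/-- The Fourier kernel e^{-2πi⟨s,w⟩} is the character e^{2ip·s} at p = -πw. `EuclideanSpace`
supplies the inner product, and the coordinate map preserves volume. -/
theorem fourier_ofLp (G : (Fin m → ℝ) → ℂ) (w : EuclideanSpace ℝ (Fin m)) :
    𝓕 (fun s : EuclideanSpace ℝ (Fin m) => G s.ofLp) w = oscFT G (-Real.pi • w.ofLp) := by
  rw [Real.fourier_eq', oscFT, ← integral_ofLp]
  refine integral_congr_ae (Filter.Eventually.of_forall fun s => ?_)
  simp only [smul_eq_mul, osc]
  congr 4
  simp only [PiLp.inner_apply, Pi.smul_apply, smul_eq_mul, Finset.mul_sum]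
  refine Finset.sum_congr rfl fun j _ => ?_
  simp
  ring

/-- Fourier inversion at the origin. -/
theorem integral_oscFT {G : (Fin m → ℝ) → ℂ} (hc : Continuous G) (hi : Integrable G)
    (hf : Integrable (oscFT G)) : ∫ p, oscFT G p = (Real.pi ^ m : ℝ) * G 0 := by
  set g : EuclideanSpace ℝ (Fin m) → ℂ := fun s => G s.ofLp with hg
  have hgc : Continuous g := hc.comp (PiLp.continuous_ofLp 2 _)
  have hgi : Integrable g := integrable_ofLp.2 hi
  have hgf : 𝓕 g = fun w : EuclideanSpace ℝ (Fin m) =>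
      (fun p : Fin m → ℝ => oscFT G (-Real.pi • p)) w.ofLp := by
    ext w; exact fourier_ofLp G w
  have hgfi : Integrable (𝓕 g) := by
    rw [hgf]
    refine (integrable_ofLp (G := fun p : Fin m → ℝ => oscFT G (-Real.pi • p))).2 ?_
    exact (integrable_comp_smul_iff volume (oscFT G) (neg_ne_zero.2 Real.pi_ne_zero)).2 hf
  have inv := congrFun (hgc.fourierInv_fourier_eq hgi hgfi) 0
  rw [Real.fourierInv_eq'] at inv
  simp only [inner_zero_right, mul_zero, Complex.ofReal_zero, zero_mul, Complex.exp_zero,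
    one_smul] at inv
  rw [hgf, integral_ofLp (fun p : Fin m → ℝ => oscFT G (-Real.pi • p)),
    Measure.integral_comp_smul] at inv
  have h0 : g 0 = G 0 := by simp [hg]
  rw [← h0, ← inv]
  have : |((-Real.pi) ^ Module.finrank ℝ (Fin m → ℝ))⁻¹| = (Real.pi ^ m)⁻¹ := by
    rw [Module.finrank_fin_fun, abs_inv, abs_pow, abs_neg, abs_of_pos Real.pi_pos]
  rw [this, Complex.real_smul, ← mul_assoc, ← Complex.ofReal_mul, mul_inv_cancel₀ (by positivity)]
  simp

/-- Inversion at the origin for the translate of G by s, whose transform only acquires a character.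
-/
theorem integral_osc_neg_mul_oscFT {G : (Fin m → ℝ) → ℂ} (hc : Continuous G) (hi : Integrable G)
    (hf : Integrable (oscFT G)) (s : Fin m → ℝ) :
    ∫ p, osc p (-s) * oscFT G p = (Real.pi ^ m : ℝ) * G s := by
  have e : ∀ p, oscFT (fun t => G (t + s)) p = osc p (-s) * oscFT G p := by
    intro p
    rw [oscFT, oscFT, ← integral_const_mul, 
      ← integral_add_right_eq_self (fun t => osc p (-s) * (osc p t * G t)) s]
    refine integral_congr_ae (Filter.Eventually.of_forall fun t => ?_)
    simp only
    rw [← mul_assoc, ← osc_add, neg_add_cancel_comm_assoc]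
  have := integral_oscFT (G := fun t => G (t + s)) (by fun_prop) (hi.comp_add_right s) (by
    refine (integrable_osc_mul hf (-s)).congr (Filter.Eventually.of_forall fun p => ?_)
    rw [e, osc_comm])
  rw [zero_add] at this
  rw [← this]
  exact integral_congr_ae (Filter.Eventually.of_forall fun p => (e p).symm)

/-- Parseval's identity. -/
theorem integral_conj_oscFT_mul_oscFT {F G : (Fin m → ℝ) → ℂ} (hF : Integrable F)
    -- Only G is required to be regular. In Moyal's identity F comes from arbitrary L² vectors and
    -- is merely integrable.
    (hc : Continuous G) (hi : Integrable G) (hf : Integrable (oscFT G)) :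
    ∫ p, starRingEnd ℂ (oscFT F p) * oscFT G p =
      (Real.pi ^ m : ℝ) * ∫ s, starRingEnd ℂ (F s) * G s := by
  have e1 : ∀ p, starRingEnd ℂ (oscFT F p) * oscFT G p =
      ∫ s, osc p (-s) * starRingEnd ℂ (F s) * oscFT G p := by
    intro p
    rw [oscFT, ← integral_conj, ← integral_mul_const]
    simp only [map_mul, conj_osc]
  rw [integral_congr_ae (Filter.Eventually.of_forall e1), integral_integral_swap,
    ← integral_const_mul]
  · refine integral_congr_ae (Filter.Eventually.of_forall fun s => ?_)
    simp only
    rw [show (fun p => osc p (-s) * starRingEnd ℂ (F s) * oscFT G p) =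
      fun p => starRingEnd ℂ (F s) * (osc p (-s) * oscFT G p) by ext p; ring,
      integral_const_mul, integral_osc_neg_mul_oscFT hc hi hf]
    ring
  · have hFc : Integrable fun s => starRingEnd ℂ (F s) :=
      (Complex.conjLIE.toContinuousLinearEquiv.toContinuousLinearMap.integrable_comp hF)
    have h := (hf.mul_prod hFc).bdd_mul (c := 1)
      (f := fun z : (Fin m → ℝ) × (Fin m → ℝ) => osc z.1 (-z.2))
      (Continuous.aestronglyMeasurable (continuous_osc.comp
        (by fun_prop : Continuous fun z : (Fin m → ℝ) × (Fin m → ℝ) => (z.1, -z.2))))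
      (Filter.Eventually.of_forall fun z => (norm_osc _ _).le)
    refine h.congr (Filter.Eventually.of_forall fun z => ?_)
    simp only [Function.uncurry]
    ring

/-- Injectivity of the oscillatory integral transform. -/
theorem ae_eq_zero_of_oscFT_eq_zero {G : (Fin m → ℝ) → ℂ} (hi : Integrable G)
    (h : ∀ p, oscFT G p = 0) : G =ᵐ[volume] 0 := by
  set g : EuclideanSpace ℝ (Fin m) → ℂ := fun s => G s.ofLp with hg
  have hgi : Integrable g := integrable_ofLp.2 hi
  have hgf : ∀ w, 𝓕 g w = 0 := fun w => by rw [hg, fourier_ofLp, h]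
  have hz : ∀ᵐ s, g s = 0 := by
    refine ae_eq_zero_of_integral_contDiff_smul_eq_zero hgi.locallyIntegrable fun ψ hψ hψc => ?_
    have hψc' : HasCompactSupport fun s => (ψ s : ℂ) :=
      hψc.comp_left (g := Complex.ofReal) Complex.ofReal_zero
    have hψ' : ContDiff ℝ ((⊤ : ℕ∞) : WithTop ℕ∞) fun s => (ψ s : ℂ) :=
      Complex.ofRealCLM.contDiff.comp hψ
    set Ψ := hψc'.toSchwartzMap hψ' with hΨ
    -- Every test function is the Fourier transform of a Schwartz function χ, so in ∫ ψ g the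
    -- transform can be moved onto g, where it vanishes.
    set χ := 𝓕⁻ Ψ with hχ
    have h1 : 𝓕 χ = Ψ := FourierTransform.fourier_fourierInv_eq Ψ
    have h2 : ∀ s, (ψ s : ℂ) = 𝓕 (χ : EuclideanSpace ℝ (Fin m) → ℂ) s := by
      intro s
      rw [← SchwartzMap.fourier_coe, h1]
      rfl
    have key := VectorFourier.integral_fourierIntegral_smul_eq_flip
      (f := (χ : EuclideanSpace ℝ (Fin m) → ℂ)) (g := g) (μ := volume) (ν := volume)
      (L := innerₗ (EuclideanSpace ℝ (Fin m)))
      Real.continuous_fourierChar continuous_inner χ.integrable hgi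
    rw [flip_innerₗ] at key
    calc ∫ s, ψ s • g s = ∫ s, 𝓕 (χ : EuclideanSpace ℝ (Fin m) → ℂ) s • g s := by
          refine integral_congr_ae (Filter.Eventually.of_forall fun s => ?_)
          simp only [← h2, Complex.real_smul, smul_eq_mul]
      _ = ∫ s, χ s • 𝓕 g s := key
      _ = 0 := by simp [hgf]
  have := (PiLp.volume_preserving_toLp (Fin m)).quasiMeasurePreserving.ae hz
  filter_upwards [this] with s hs
  simpa [hg] using hs

end Osc

end

section

/-! ### Completeness of the number states -/

section Completeness

variable {m : ℕ}

theorem memLp_prod {f : Fin m → ℝ → ℝ} (hc : ∀ j, Continuous (f j))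
    (hi : ∀ j, Integrable fun x => (f j x) ^ 2) :
    MemLp (fun q : Fin m → ℝ => ((∏ j, f j (q j) : ℝ) : ℂ)) 2 volume := by
  have hc' : Continuous fun q : Fin m → ℝ => ((∏ j, f j (q j) : ℝ) : ℂ) :=
    Complex.continuous_ofReal.comp
      (continuous_finsetProd _ fun j _ => (hc j).comp (continuous_apply j))
  refine (memLp_two_iff_integrable_sq_norm hc'.aestronglyMeasurable).2 ?_
  have h := Integrable.fintype_prod (𝕜 := ℝ) (ι := Fin m) (E := ℝ)
    (μ := fun _ => (volume : Measure ℝ)) (f := fun j x => (f j x) ^ 2) hi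
  refine h.congr (Filter.Eventually.of_forall fun q => ?_)
  simp only [Complex.norm_real, Real.norm_eq_abs, sq_abs, Finset.prod_pow]

theorem exists_hermite_expansion (P : Polynomial ℝ) :
    ∃ a : ℕ →₀ ℝ, P = ∑ k ∈ a.support, a k • realHermite k := by
  let S : Polynomial.Sequence ℝ := ⟨realHermite, fun i => by
    rw [Polynomial.degree_eq_natDegree (realHermite_monic i).ne_zero, natDegree_realHermite]⟩
  have hS : Submodule.span ℝ (Set.range S) = ⊤ :=
    S.span fun i => by
      have : (S i).leadingCoeff = 1 := realHermite_monic i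
      rw [this]; exact isUnit_one
  have hP : P ∈ Submodule.span ℝ (Set.range S) := by rw [hS]; trivial
  obtain ⟨a, ha⟩ := Finsupp.mem_span_range_iff_exists_finsupp.1 hP
  exact ⟨a, ha.symm⟩

/-- The Gaussian `e^{-|q|²/2}`. -/
def gaussFun (q : Fin m → ℝ) : ℝ := ∏ j, Real.exp (-(1 / 2 * q j ^ 2))

theorem continuous_gaussFun : Continuous (gaussFun : (Fin m → ℝ) → ℝ) := by
  unfold gaussFun
  fun_prop

theorem gaussFun_pos (q : Fin m → ℝ) : 0 < gaussFun q :=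
  Finset.prod_pos fun _ _ => Real.exp_pos _

theorem inner_toLp_right (φ : ModeSpace m) {u : (Fin m → ℝ) → ℂ} (hu : MemLp u 2 volume) :
    ⟪φ, hu.toLp u⟫_ℂ = ∫ q, starRingEnd ℂ (φ q) * u q := by
  rw [L2.inner_def]
  refine integral_congr_ae ?_
  filter_upwards [hu.coeFn_toLp] with q h1
  rw [h1, RCLike.inner_apply, mul_comm]

theorem integrable_conj_mul (φ : ModeSpace m) {u : (Fin m → ℝ) → ℂ} (hu : MemLp u 2 volume) :
    Integrable fun q => starRingEnd ℂ (φ q) * u q := by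
  refine (L2.integrable_inner (𝕜 := ℂ) φ (hu.toLp u)).congr ?_
  filter_upwards [hu.coeFn_toLp] with q h1
  rw [h1, RCLike.inner_apply, mul_comm]

/-- The normalization constant of the number state wave function. -/
def fockConst (n : Fin m → ℕ) : ℝ :=
  ∏ j, ((Real.pi ^ (1 / 4 : ℝ))⁻¹ * (Real.sqrt ((n j).factorial : ℝ))⁻¹)

theorem fockConst_pos (n : Fin m → ℕ) : 0 < fockConst n :=
  Finset.prod_pos fun j _ => by positivity

theorem fockFun_eq (n : Fin m → ℕ) (q : Fin m → ℝ) :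
    fockFun n q = ((fockConst n * ((∏ j, (realHermite (n j)).eval (Real.sqrt 2 * q j)) *
      gaussFun q) : ℝ) : ℂ) := by
  rw [fockFun, ← Complex.ofReal_prod, fockConst, gaussFun, ← Finset.prod_mul_distrib,
    ← Finset.prod_mul_distrib]
  congr 1
  exact Finset.prod_congr rfl fun j _ => by rw [hermiteFun_eq]; ring

/-- Expanding each factor in Hermite polynomials writes the product of polynomials times the
Gaussian as a finite combination of number states, all orthogonal to φ. -/
theorem integral_mul_eq_zero_of_inner_fock (φ : ModeSpace m)
    (h : ∀ n, ⟪φ, fock n⟫_ℂ = 0) (P : Fin m → Polynomial ℝ) :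
    ∫ q, starRingEnd ℂ (φ q) *
      (((∏ j, (P j).eval (Real.sqrt 2 * q j)) * gaussFun q : ℝ) : ℂ) = 0 := by
  choose a ha using fun j => exists_hermite_expansion (P j)
  have e : ∀ q : Fin m → ℝ, starRingEnd ℂ (φ q) *
      (((∏ j, (P j).eval (Real.sqrt 2 * q j)) * gaussFun q : ℝ) : ℂ) =
      ∑ n ∈ Fintype.piFinset fun j => (a j).support,
        (((∏ j, a j (n j)) * (fockConst n)⁻¹ : ℝ) : ℂ) *
          (starRingEnd ℂ (φ q) * fockFun n q) := by
    intro q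
    have e1 : ∏ j, (P j).eval (Real.sqrt 2 * q j) =
        ∑ n ∈ Fintype.piFinset fun j => (a j).support,
          ∏ j, (a j (n j) * (realHermite (n j)).eval (Real.sqrt 2 * q j)) := by
      rw [← Finset.prod_univ_sum (fun j => (a j).support)
        (fun j k => a j k * (realHermite k).eval (Real.sqrt 2 * q j))]
      refine Finset.prod_congr rfl fun j _ => ?_
      conv_lhs => rw [ha j]
      simp [Polynomial.eval_finsetSum]
    rw [e1, Finset.sum_mul, Complex.ofReal_sum, Finset.mul_sum]
    refine Finset.sum_congr rfl fun n _ => ?_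
    rw [fockFun_eq, Finset.prod_mul_distrib]
    have := (fockConst_pos n).ne'
    rw [mul_left_comm]
    congr 1
    rw [← Complex.ofReal_mul]
    congr 1
    field_simp
  rw [integral_congr_ae (Filter.Eventually.of_forall e), integral_finsetSum]
  · refine Finset.sum_eq_zero fun n _ => ?_
    rw [integral_const_mul, ← inner_toLp_right φ (memLp_fockFun n)]
    rw [show (memLp_fockFun n).toLp (fockFun n) = fock n from rfl, h n, mul_zero]
  · exact fun n _ => (integrable_conj_mul φ (memLp_fockFun n)).const_mul _

/-- The multinomial theorem reduces (t·q)^n to monomials. Up to i^n / n! these moments are the terms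
of the power series of the oscillatory integral. -/
theorem integral_moment_eq_zero (φ : ModeSpace m)
    (h : ∀ n, ⟪φ, fock n⟫_ℂ = 0) (t : Fin m → ℝ) (n : ℕ)
    (hi : ∀ k : Fin m → ℕ, Integrable fun q =>
      starRingEnd ℂ (φ q) * (((∏ j, q j ^ k j) * gaussFun q : ℝ) : ℂ)) :
    ∫ q, starRingEnd ℂ (φ q) * (((∑ j, t j * q j) ^ n * gaussFun q : ℝ) : ℂ) = 0 := by
  have hz : ∀ k : Fin m → ℕ,
      ∫ q, starRingEnd ℂ (φ q) * (((∏ j, q j ^ k j) * gaussFun q : ℝ) : ℂ) = 0 := by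
    intro k
    have := integral_mul_eq_zero_of_inner_fock φ h
      fun j => Polynomial.C ((Real.sqrt 2)⁻¹ ^ k j) * Polynomial.X ^ k j
    convert this using 7 with q q
    simp only [Polynomial.eval_mul, Polynomial.eval_C, Polynomial.eval_pow, Polynomial.eval_X]
    rw [← mul_pow, inv_mul_cancel_left₀ (by positivity)]
  have e : ∀ q : Fin m → ℝ,
      starRingEnd ℂ (φ q) * (((∑ j, t j * q j) ^ n * gaussFun q : ℝ) : ℂ) =
      ∑ k ∈ Finset.piAntidiag Finset.univ n,
        ((Nat.multinomial Finset.univ k * ∏ j, t j ^ k j : ℝ) : ℂ) *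
          (starRingEnd ℂ (φ q) * (((∏ j, q j ^ k j) * gaussFun q : ℝ) : ℂ)) := by
    intro q
    rw [Finset.sum_pow_eq_sum_piAntidiag, Finset.sum_mul, Complex.ofReal_sum, Finset.mul_sum]
    refine Finset.sum_congr rfl fun k _ => ?_
    simp only [mul_pow, Finset.prod_mul_distrib]
    push_cast
    ring
  rw [integral_congr_ae (Filter.Eventually.of_forall e), integral_finsetSum]
  · exact Finset.sum_eq_zero fun k _ => by rw [integral_const_mul, hz, mul_zero]
  · exact fun k _ => (hi k).const_mul _

/-- This function dominates the exponential series of e^{it·q} against the Gaussian; being in L², it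
remains integrable after multiplication by any φ. -/
theorem memLp_exp_abs_mul_gaussFun (t : Fin m → ℝ) :
    MemLp (fun q : Fin m → ℝ => ((Real.exp (∑ j, |t j| * |q j|) * gaussFun q : ℝ) : ℂ)) 2 volume := by
  have hi : ∀ j, Integrable fun x : ℝ =>
      (Real.exp (|t j| * |x|) * Real.exp (-(1 / 2 * x ^ 2))) ^ 2 := by
    intro j
    have hg : Integrable fun x : ℝ => Real.exp (2 * |t j| ^ 2) * Real.exp (-(1 / 2) * x ^ 2) :=
      (integrable_exp_neg_mul_sq (by norm_num : (0:ℝ) < 1 / 2)).const_mul _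
    refine hg.mono' (Continuous.aestronglyMeasurable (by fun_prop))
      (Filter.Eventually.of_forall fun x => ?_)
    rw [Real.norm_eq_abs, abs_of_nonneg (by positivity), ← Real.exp_add, ← Real.exp_nat_mul,
      ← Real.exp_add, Real.exp_le_exp]
    -- Halved, this square says 2|t||x| ≤ 2t² + x²/2, which is the comparison of the two exponents.
    have := sq_nonneg (|x| - 2 * |t j|)
    push_cast
    nlinarith [sq_abs x]
  have := memLp_prod (f := fun j x => Real.exp (|t j| * |x|) * Real.exp (-(1 / 2 * x ^ 2)))
    (fun j => by fun_prop) hi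
  convert! this using 3 with q
  rw [Finset.prod_mul_distrib, ← Real.exp_sum, gaussFun]

theorem integrable_conj_mul_exp_abs_mul_gaussFun (φ : ModeSpace m) (t : Fin m → ℝ) :
    Integrable fun q => ‖φ q‖ * (Real.exp (∑ j, |t j| * |q j|) * gaussFun q) := by
  refine (integrable_conj_mul φ (memLp_exp_abs_mul_gaussFun t)).norm.congr
    (Filter.Eventually.of_forall fun q => ?_)
  simp only [norm_mul, RCLike.norm_conj, Complex.norm_real, Real.norm_eq_abs]
  rw [abs_of_pos (Real.exp_pos _), abs_of_pos (gaussFun_pos q)]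

theorem integrable_conj_mul_monomial (φ : ModeSpace m) (k : Fin m → ℕ) :
    Integrable fun q => starRingEnd ℂ (φ q) * (((∏ j, q j ^ k j) * gaussFun q : ℝ) : ℂ) := by
  have h := (integrable_conj_mul_exp_abs_mul_gaussFun φ fun _ => 1).const_mul
    (∏ j, ((k j).factorial : ℝ))
  refine h.mono' ?_ (Filter.Eventually.of_forall fun q => ?_)
  · refine AEStronglyMeasurable.mul
      (Complex.continuous_conj.comp_aestronglyMeasurable (Lp.aestronglyMeasurable φ))
      (Continuous.aestronglyMeasurable ?_)
    have := continuous_gaussFun (m := m)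
    fun_prop
  · simp only [norm_mul, RCLike.norm_conj, Complex.norm_real, Real.norm_eq_abs, one_mul, abs_one]
    rw [abs_of_pos (gaussFun_pos q), mul_left_comm (∏ j, ((k j).factorial : ℝ))]
    refine mul_le_mul_of_nonneg_left ?_ (norm_nonneg _)
    rw [← mul_assoc]
    refine mul_le_mul_of_nonneg_right ?_ (gaussFun_pos q).le
    rw [Finset.abs_prod, Real.exp_sum, ← Finset.prod_mul_distrib]
    refine Finset.prod_le_prod (fun _ _ => abs_nonneg _) fun j _ => ?_
    rw [abs_pow]
    have h1 := Real.pow_div_factorial_le_exp |q j| (abs_nonneg _) (k j)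
    rwa [div_le_iff₀' (by positivity)] at h1

/-- The character is expanded in its exponential series and integrated term by term under the bound
B; every term is a vanishing moment. -/
theorem oscFT_conj_mul_gaussFun_eq_zero (φ : ModeSpace m)
    (h : ∀ n, ⟪φ, fock n⟫_ℂ = 0) (p : Fin m → ℝ) :
    oscFT (fun q => starRingEnd ℂ (φ q) * (gaussFun q : ℂ)) p = 0 := by
  set t : Fin m → ℝ := fun j => 2 * p j with ht
  have hm := integral_moment_eq_zero φ h t
  have hbound := integrable_conj_mul_exp_abs_mul_gaussFun φ t
  set F : ℕ → (Fin m → ℝ) → ℂ := fun n q => (Complex.I ^ n / (n.factorial : ℂ)) *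
    (starRingEnd ℂ (φ q) * (((∑ j, t j * q j) ^ n * gaussFun q : ℝ) : ℂ)) with hF
  set B : ℕ → (Fin m → ℝ) → ℝ := fun n q =>
    (∑ j, |t j| * |q j|) ^ n / (n.factorial : ℝ) * (‖φ q‖ * gaussFun q) with hB
  have hBs : ∀ q, HasSum (fun n => B n q) (‖φ q‖ * (Real.exp (∑ j, |t j| * |q j|) * gaussFun q)) := by
    intro q
    have := (NormedSpace.expSeries_div_hasSum_exp (∑ j, |t j| * |q j|)).mul_right
      (‖φ q‖ * gaussFun q)
    rw [← Real.exp_eq_exp_ℝ] at this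
    convert! this using 1
    ring
  have key : HasSum (fun n => ∫ q, F n q)
      (∫ q, osc p q * (starRingEnd ℂ (φ q) * (gaussFun q : ℂ))) := by
    refine hasSum_integral_of_dominated_convergence B ?_ ?_ ?_ ?_ ?_
    · intro n
      refine AEStronglyMeasurable.const_mul (AEStronglyMeasurable.mul
        (Complex.continuous_conj.comp_aestronglyMeasurable (Lp.aestronglyMeasurable φ))
        (Continuous.aestronglyMeasurable ?_)) _
      have := continuous_gaussFun (m := m)
      fun_prop
    · intro n
      refine Filter.Eventually.of_forall fun q => ?_
      simp only [hF, hB, norm_mul, norm_div, norm_pow, Complex.norm_I, one_pow, RCLike.norm_conj,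
        Complex.norm_real, Real.norm_eq_abs, Complex.norm_natCast,
        abs_of_pos (gaussFun_pos q)]
      have h1 : |∑ j, t j * q j| ≤ ∑ j, |t j| * |q j| :=
        (Finset.abs_sum_le_sum_abs _ _).trans (by simp [abs_mul])
      have h2 : |∑ j, t j * q j| ^ n ≤ (∑ j, |t j| * |q j|) ^ n :=
        pow_le_pow_left₀ (abs_nonneg _) h1 n
      have h3 : 0 ≤ ‖φ q‖ * gaussFun q := mul_nonneg (norm_nonneg _) (gaussFun_pos q).le
      have h4 : 0 < (n.factorial : ℝ) := by positivity
      rw [show 1 / (n.factorial : ℝ) * (‖φ q‖ * (|∑ j, t j * q j| ^ n * gaussFun q)) =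
        |∑ j, t j * q j| ^ n / (n.factorial : ℝ) * (‖φ q‖ * gaussFun q) by ring]
      gcongr
    · exact Filter.Eventually.of_forall fun q => (hBs q).summable
    · exact hbound.congr (Filter.Eventually.of_forall fun q => ((hBs q).tsum_eq).symm)
    · refine Filter.Eventually.of_forall fun q => ?_
      have := (NormedSpace.expSeries_div_hasSum_exp
        (((∑ j, t j * q j : ℝ) : ℂ) * Complex.I)).mul_right (starRingEnd ℂ (φ q) * (gaussFun q : ℂ))
      rw [← Complex.exp_eq_exp_ℂ] at this
      convert! this using 1
      · ext n
        simp only [hF, mul_pow]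
        push_cast
        ring
      · rw [osc, Finset.mul_sum]
        simp only [ht, mul_assoc]
  have hz : ∀ n, ∫ q, F n q = 0 := by
    intro n
    rw [hF]
    simp only
    rw [integral_const_mul, hm n (integrable_conj_mul_monomial φ), mul_zero]
  simp only [hz] at key
  exact key.unique hasSum_zero

/-- The transform is injective and the Gaussian has no zeros, so nothing of φ survives. -/
theorem eq_zero_of_inner_fock (φ : ModeSpace m) (h : ∀ n, ⟪φ, fock n⟫_ℂ = 0) : φ = 0 := by
  have hi : Integrable fun q => starRingEnd ℂ (φ q) * (gaussFun q : ℂ) := by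
    have := integrable_conj_mul_monomial φ 0
    simpa using this
  have hz := ae_eq_zero_of_oscFT_eq_zero hi (oscFT_conj_mul_gaussFun_eq_zero φ h)
  rw [Lp.eq_zero_iff_ae_eq_zero]
  filter_upwards [hz] with q hq
  have := (gaussFun_pos q).ne'
  simpa [this] using hq

/-- The number states form a Hilbert basis. -/
def fockBasis (m : ℕ) : HilbertBasis (Fin m → ℕ) ℂ (ModeSpace m) :=
  HilbertBasis.mkOfOrthogonalEqBot (orthonormal_fock m) (by
    rw [Submodule.eq_bot_iff]
    intro φ hφ
    refine eq_zero_of_inner_fock φ fun n => ?_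
    rw [Submodule.mem_orthogonal'] at hφ
    exact hφ _ (Submodule.subset_span ⟨n, rfl⟩))

@[simp]
theorem fockBasis_apply (n : Fin m → ℕ) : fockBasis m n = fock n := by
  rw [fockBasis, HilbertBasis.coe_mkOfOrthogonalEqBot]

end Completeness

end

section

/-! ### Hilbert–Schmidt operators and expectation values -/

section HilbertSchmidt

set_option linter.unusedSectionVars false

open ContinuousLinearMap InnerProductSpace

variable {ι H : Type*} [NormedAddCommGroup H] [InnerProductSpace ℂ H] [CompleteSpace H]
  (b : HilbertBasis ι ℂ H)

theorem hasSum_norm_inner_sq (x : H) : HasSum (fun i => ‖⟪b i, x⟫_ℂ‖ ^ 2) (‖x‖ ^ 2) := by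
  have h := b.hasSum_inner_mul_inner x x
  rw [inner_self_eq_norm_sq_to_K] at h
  have e : ∀ i, ⟪x, b i⟫_ℂ * ⟪b i, x⟫_ℂ = ((‖⟪b i, x⟫_ℂ‖ ^ 2 : ℝ) : ℂ) := by
    intro i
    rw [← inner_conj_symm x (b i), Complex.conj_mul']
    push_cast
    rfl
  simp only [e] at h
  exact Complex.hasSum_ofReal.1 (by simpa using h)

theorem summable_norm_inner_sq_prod {A : H →L[ℂ] H} (hA : Summable fun i => ‖A (b i)‖ ^ 2) :
    Summable fun p : ι × ι => ‖⟪b p.2, A (b p.1)⟫_ℂ‖ ^ 2 := by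
  have h0 : (0 : ι × ι → ℝ) ≤ fun p => ‖⟪b p.2, A (b p.1)⟫_ℂ‖ ^ 2 := fun p => sq_nonneg _
  refine (summable_prod_of_nonneg h0).2 ⟨fun i => ?_, ?_⟩
  · exact (hasSum_norm_inner_sq b (A (b i))).summable
  · have e : ∀ i, ∑' j, ‖⟪b j, A (b i)⟫_ℂ‖ ^ 2 = ‖A (b i)‖ ^ 2 := fun i =>
      (hasSum_norm_inner_sq b (A (b i))).tsum_eq
    simpa only [e] using hA

/-- Both series are iterated sums, by rows and by columns, of the squared moduli of one matrix. -/
theorem hasSum_norm_adjoint_sq {A : H →L[ℂ] H} {s : ℝ}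
    (hA : HasSum (fun i => ‖A (b i)‖ ^ 2) s) : HasSum (fun i => ‖(adjoint A) (b i)‖ ^ 2) s := by
  have hs := summable_norm_inner_sq_prod b hA.summable
  have e : ∀ i j, ‖⟪b i, adjoint A (b j)⟫_ℂ‖ ^ 2 = ‖⟪b j, A (b i)⟫_ℂ‖ ^ 2 := by
    intro i j
    rw [adjoint_inner_right, ← inner_conj_symm, RCLike.norm_conj]
  have h1 : ∀ j, HasSum (fun i => ‖⟪b j, A (b i)⟫_ℂ‖ ^ 2) (‖(adjoint A) (b j)‖ ^ 2) := by
    intro j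
    have := hasSum_norm_inner_sq b (adjoint A (b j))
    simpa only [e] using this
  have h2 : HasSum (fun p : ι × ι => ‖⟪b p.2, A (b p.1)⟫_ℂ‖ ^ 2) s := by
    have h3 := hs.hasSum.prod_fiberwise fun i => hasSum_norm_inner_sq b (A (b i))
    rw [hA.unique h3]
    exact hs.hasSum
  have h4 : HasSum (fun p : ι × ι => ‖⟪b p.1, A (b p.2)⟫_ℂ‖ ^ 2) s :=
    (Equiv.prodComm ι ι).hasSum_iff.2 h2
  exact h4.prod_fiberwise h1

theorem _root_.Summable.hasSum_swap {α β : Type*} {f : α × β → ℂ} (hs : Summable f)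
    {g : α → ℂ} {h : β → ℂ}
    (hg : ∀ i, HasSum (fun j => f (i, j)) (g i)) (hh : ∀ j, HasSum (fun i => f (i, j)) (h j)) :
    HasSum g (∑' j, h j) := by
  have h4 : HasSum (fun p : β × α => f (p.2, p.1)) (∑' p, f p) :=
    (Equiv.prodComm β α).hasSum_iff.2 hs.hasSum
  rw [(h4.prod_fiberwise hh).tsum_eq]
  exact hs.hasSum.prod_fiberwise hg

/-- This is tr A†C = tr CA† for Hilbert–Schmidt operators. The double series over matrix entries
converges absolutely, so it may be summed in the other order. -/
theorem hasSum_inner_apply_apply {A C : H →L[ℂ] H} (hA : Summable fun i => ‖A (b i)‖ ^ 2)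
    (hC : Summable fun i => ‖C (b i)‖ ^ 2) :
    HasSum (fun i => ⟪A (b i), C (b i)⟫_ℂ) (∑' j, ⟪adjoint C (b j), adjoint A (b j)⟫_ℂ) := by
  have hs : Summable fun p : ι × ι => ⟪A (b p.1), b p.2⟫_ℂ * ⟪b p.2, C (b p.1)⟫_ℂ := by
    refine Summable.of_norm_bounded
      ((summable_norm_inner_sq_prod b hA).add (summable_norm_inner_sq_prod b hC)) fun p => ?_
    rw [norm_mul, ← inner_conj_symm, RCLike.norm_conj]
    generalize ‖⟪b p.2, A (b p.1)⟫_ℂ‖ = x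
    generalize ‖⟪b p.2, C (b p.1)⟫_ℂ‖ = y
    nlinarith [sq_nonneg (x - y), sq_nonneg (x + y)]
  have h1 : ∀ i, HasSum (fun j => ⟪A (b i), b j⟫_ℂ * ⟪b j, C (b i)⟫_ℂ) ⟪A (b i), C (b i)⟫_ℂ :=
    fun i => b.hasSum_inner_mul_inner _ _
  have h2 : ∀ j, HasSum (fun i => ⟪A (b i), b j⟫_ℂ * ⟪b j, C (b i)⟫_ℂ)
      ⟪adjoint C (b j), adjoint A (b j)⟫_ℂ := by
    intro j
    have h := b.hasSum_inner_mul_inner (adjoint C (b j)) (adjoint A (b j))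
    have e : ∀ i, ⟪adjoint C (b j), b i⟫_ℂ * ⟪b i, adjoint A (b j)⟫_ℂ =
        ⟪A (b i), b j⟫_ℂ * ⟪b j, C (b i)⟫_ℂ := by
      intro i
      rw [adjoint_inner_left, adjoint_inner_right, mul_comm]
    simpa only [e] using h
  exact Summable.hasSum_swap hs h1 h2

/-- The expectation value `tr (R† B R)`. -/
def expect (R B : H →L[ℂ] H) : ℂ := ∑' j, ⟪R (b j), B (R (b j))⟫_ℂ

variable {b} {R : H →L[ℂ] H}

theorem norm_inner_apply_le (B : H →L[ℂ] H) (x : H) : ‖⟪x, B x⟫_ℂ‖ ≤ ‖B‖ * ‖x‖ ^ 2 := by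
  refine (norm_inner_le_norm _ _).trans ?_
  have := B.le_opNorm x
  nlinarith [norm_nonneg x]

theorem summable_expect (hR : Summable fun i => ‖R (b i)‖ ^ 2) (B : H →L[ℂ] H) :
    Summable fun j => ⟪R (b j), B (R (b j))⟫_ℂ :=
  Summable.of_norm_bounded (hR.mul_left ‖B‖) fun _ => norm_inner_apply_le B _

theorem expect_add (hR : Summable fun i => ‖R (b i)‖ ^ 2) (B C : H →L[ℂ] H) :
    expect b R (B + C) = expect b R B + expect b R C := by
  rw [expect, expect, expect, ← (summable_expect hR B).tsum_add (summable_expect hR C)]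
  simp

theorem expect_sub (hR : Summable fun i => ‖R (b i)‖ ^ 2) (B C : H →L[ℂ] H) :
    expect b R (B - C) = expect b R B - expect b R C := by
  rw [expect, expect, expect, ← (summable_expect hR B).tsum_sub (summable_expect hR C)]
  simp

theorem expect_smul (B : H →L[ℂ] H) (c : ℂ) : expect b R (c • B) = c * expect b R B := by
  rw [expect, expect, ← tsum_mul_left]
  simp

theorem expect_sum (hR : Summable fun i => ‖R (b i)‖ ^ 2) {κ : Type*} (F : Finset κ)
    (B : κ → H →L[ℂ] H) : expect b R (∑ k ∈ F, B k) = ∑ k ∈ F, expect b R (B k) := by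
  classical
  induction F using Finset.induction_on with
  | empty => simp [expect]
  | insert a F ha ih => rw [Finset.sum_insert ha, Finset.sum_insert ha, expect_add hR, ih]

theorem norm_expect_le {s : ℝ} (hR : HasSum (fun i => ‖R (b i)‖ ^ 2) s) (B : H →L[ℂ] H) :
    ‖expect b R B‖ ≤ ‖B‖ * s :=
  tsum_of_norm_bounded (hR.mul_left ‖B‖) fun _ => norm_inner_apply_le B _

theorem expect_one {s : ℝ} (hR : HasSum (fun i => ‖R (b i)‖ ^ 2) s) : expect b R 1 = s := by
  rw [expect, ← (Complex.hasSum_ofReal.2 hR).tsum_eq]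
  simp [inner_self_eq_norm_sq_to_K]

theorem expect_rankOne (hR : IsSelfAdjoint R) (x y : H) :
    expect b R (rankOne ℂ x y) = ⟪y, R (R x)⟫_ℂ := by
  have hadj : ∀ u v, ⟪R u, v⟫_ℂ = ⟪u, R v⟫_ℂ := fun u v => hR.isSymmetric u v
  have := b.hasSum_inner_mul_inner (R y) (R x)
  rw [hadj] at this
  rw [expect, ← this.tsum_eq]
  refine tsum_congr fun j => ?_
  rw [rankOne_apply, inner_smul_right, hadj, hadj]

/-- Cyclicity of the trace: BR and RC are Hilbert–Schmidt, so they can be exchanged. With ρ = R² it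
turns tr ρB and tr Bρ into the same expectation sum, in which linearity and norm bounds are
immediate. -/
theorem hasSum_trace_mul_mul (hs : IsSelfAdjoint R) (hR : Summable fun i => ‖R (b i)‖ ^ 2)
    (B C : H →L[ℂ] H) :
    HasSum (fun i => ⟪b i, B (R (R (C (b i))))⟫_ℂ) (expect b R (C * B)) := by
  have hadj : adjoint R = R := hs
  have hBR : Summable fun i => ‖(B * R) (b i)‖ ^ 2 := by
    refine Summable.of_nonneg_of_le (fun _ => by positivity) (fun i => ?_)
      (hR.mul_left (‖B‖ ^ 2))
    rw [← mul_pow]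
    exact pow_le_pow_left₀ (norm_nonneg _) (B.le_opNorm _) 2
  have hCR : Summable fun i => ‖(adjoint C * R) (b i)‖ ^ 2 := by
    refine Summable.of_nonneg_of_le (fun _ => by positivity) (fun i => ?_)
      (hR.mul_left (‖adjoint C‖ ^ 2))
    rw [← mul_pow]
    exact pow_le_pow_left₀ (norm_nonneg _) ((adjoint C).le_opNorm _) 2
  have e1 : adjoint (B * R) = R * adjoint B := by
    rw [mul_def, adjoint_comp, hadj]; rfl
  have e2 : adjoint (adjoint C * R) = R * C := by
    rw [mul_def, adjoint_comp, hadj, adjoint_adjoint]; rfl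
  have h1 := (hasSum_norm_adjoint_sq b hBR.hasSum).summable
  have h2 := (hasSum_norm_adjoint_sq b hCR.hasSum).summable
  have h3 := hasSum_inner_apply_apply b h1 h2
  rw [adjoint_adjoint, adjoint_adjoint, e1, e2] at h3
  have e3 : expect b R (C * B) = ∑' j, ⟪(adjoint C * R) (b j), (B * R) (b j)⟫_ℂ := by
    rw [expect]
    refine tsum_congr fun j => ?_
    rw [mul_apply_eq_comp, mul_apply_eq_comp, mul_apply_eq_comp, adjoint_inner_left]
  rw [e3]
  have e4 : ∀ i, ⟪(R * adjoint B) (b i), (R * C) (b i)⟫_ℂ = ⟪b i, B (R (R (C (b i))))⟫_ℂ := by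
    intro i
    rw [mul_apply_eq_comp, mul_apply_eq_comp, ← adjoint_inner_left B, ← adjoint_inner_right R, hadj]
  simpa only [e4] using h3

end HilbertSchmidt

end

section

/-! ### Expectation values of states -/

section Abstract

open ContinuousLinearMap

variable {H : Type*} [NormedAddCommGroup H] [InnerProductSpace ℂ H] [CompleteSpace H]

theorem exists_isSelfAdjoint_mul_self {ρ : H →L[ℂ] H} (h : ρ.IsPositive) :
    ∃ R : H →L[ℂ] H, IsSelfAdjoint R ∧ R * R = ρ :=
  ⟨CFC.sqrt ρ, (CFC.sqrt_nonneg ρ).isSelfAdjoint,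
    CFC.sqrt_mul_sqrt_self ρ ((nonneg_iff_isPositive ρ).2 h)⟩

/-- The polar decomposition would take S to be the sign of T, which is not a continuous function of
T. The continuous substitute x / (|x| + ε) differs from it, after multiplication by x, by at most ε.
-/
theorem exists_norm_absOp_sub_mul_le {T : H →L[ℂ] H} (hT : IsSelfAdjoint T) {ε : ℝ} (hε : 0 < ε) :
    ∃ S : H →L[ℂ] H, ‖S‖ ≤ 1 ∧ (S * T).IsPositive ∧ ‖absOp T - S * T‖ ≤ ε := by
  have hpos : ∀ x : ℝ, 0 < |x| + ε := fun x => by positivity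
  have hcont : Continuous fun x : ℝ => x / (|x| + ε) :=
    continuous_id.div (by fun_prop) fun x => (hpos x).ne'
  have hmul : cfc (fun x : ℝ => x / (|x| + ε)) T * T = cfc (fun x : ℝ => x / (|x| + ε) * x) T := by
    rw [cfc_mul (fun x : ℝ => x / (|x| + ε)) (fun x => x) T hcont.continuousOn continuousOn_id,
      cfc_id' ℝ T]
  refine ⟨cfc (fun x : ℝ => x / (|x| + ε)) T, ?_, ?_, ?_⟩
  · refine norm_cfc_le zero_le_one fun x _ => ?_
    rw [norm_div, Real.norm_eq_abs, Real.norm_eq_abs, abs_of_pos (hpos x), div_le_one (hpos x)]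
    linarith
  · rw [hmul, ← nonneg_iff_isPositive]
    refine cfc_nonneg fun x _ => ?_
    rw [div_mul_eq_mul_div]
    exact div_nonneg (mul_self_nonneg x) (hpos x).le
  · rw [hmul, absOp, CFC.abs_eq_cfc_norm T hT, ← cfc_sub (fun x : ℝ => ‖x‖)
      (fun x => x / (|x| + ε) * x) T continuous_norm.continuousOn
      (hcont.mul continuous_id).continuousOn]
    refine norm_cfc_le hε.le fun x _ => ?_
    have e : ‖x‖ - x / (|x| + ε) * x = ε * (|x| / (|x| + ε)) := by
      have := (hpos x).ne'
      rw [Real.norm_eq_abs]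
      field_simp
      nlinarith [sq_abs x]
    rw [e, Real.norm_eq_abs, abs_of_nonneg (by positivity)]
    refine mul_le_of_le_one_right hε.le ((div_le_one (hpos x)).2 (by linarith))

theorem absOp_isPositive (T : H →L[ℂ] H) : (absOp T).IsPositive :=
  (nonneg_iff_isPositive _).1 (CFC.abs_nonneg T)

/-- Cauchy–Schwarz for ⟨Qx, S P x⟩ followed by Young's inequality. The free weight a later balances
a projection of large probability against one of small probability. -/
theorem norm_inner_mul_mul_le {P Q S : H →L[ℂ] H} (hP : IsSelfAdjoint P) (hP2 : P * P = P)
    (hQ : IsSelfAdjoint Q) (hQ2 : Q * Q = Q) (hS : ‖S‖ ≤ 1) {a : ℝ} (ha : 0 < a) (x : H) :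
    ‖⟪x, (Q * S * P) x⟫_ℂ‖ ≤ a / 2 * (⟪x, P x⟫_ℂ).re + 1 / (2 * a) * (⟪x, Q x⟫_ℂ).re := by
  have key : ∀ {P : H →L[ℂ] H}, IsSelfAdjoint P → P * P = P → (⟪x, P x⟫_ℂ).re = ‖P x‖ ^ 2 := by
    intro P hP hP2
    have h : ⟪P x, P x⟫_ℂ = ⟪x, P x⟫_ℂ := by
      rw [show ⟪P x, P x⟫_ℂ = ⟪x, P (P x)⟫_ℂ from hP.isSymmetric x (P x),
        ← mul_apply_eq_comp, hP2]
    rw [← h, inner_self_eq_norm_sq_to_K]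
    norm_cast
  rw [key hP hP2, key hQ hQ2, mul_apply_eq_comp, mul_apply_eq_comp,
    ← show ⟪Q x, S (P x)⟫_ℂ = ⟪x, Q (S (P x))⟫_ℂ from hQ.isSymmetric x (S (P x))]
  have h1 : ‖⟪Q x, S (P x)⟫_ℂ‖ ≤ ‖Q x‖ * ‖P x‖ := by
    refine (norm_inner_le_norm _ _).trans (mul_le_mul_of_nonneg_left ?_ (norm_nonneg _))
    exact (S.le_opNorm _).trans (mul_le_of_le_one_left (norm_nonneg _) hS)
  refine h1.trans ?_
  generalize ‖Q x‖ = u, ‖P x‖ = v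
  have : a / 2 * v ^ 2 + 1 / (2 * a) * u ^ 2 - u * v = (a * v - u) ^ 2 / (2 * a) := by
    field_simp
    ring
  have : 0 ≤ (a * v - u) ^ 2 / (2 * a) := by positivity
  linarith

theorem norm_le_one_of_mul_self {P : H →L[ℂ] H} (hP : IsSelfAdjoint P) (hP2 : P * P = P) :
    ‖P‖ ≤ 1 := by
  refine opNorm_le_bound _ zero_le_one fun x => ?_
  have h : ⟪P x, P x⟫_ℂ = ⟪x, P x⟫_ℂ := by
    rw [show ⟪P x, P x⟫_ℂ = ⟪x, P (P x)⟫_ℂ from hP.isSymmetric x (P x), ← mul_apply_eq_comp, hP2]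
  have h2 : ‖P x‖ * ‖P x‖ ≤ ‖x‖ * ‖P x‖ := by
    rw [← sq, ← Complex.ofReal_re (‖P x‖ ^ 2), Complex.ofReal_pow]
    have := inner_self_eq_norm_sq_to_K (𝕜 := ℂ) (P x)
    rw [h] at this
    have h3 := (Complex.re_le_norm _).trans (norm_inner_le_norm (𝕜 := ℂ) x (P x))
    rw [this] at h3
    exact h3
  rw [one_mul]
  rcases (norm_nonneg (P x)).eq_or_lt with h0 | h0
  · rw [← h0]; positivity
  · exact le_of_mul_le_mul_right h2 h0

end Abstract

open ContinuousLinearMap InnerProductSpace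

variable {m : ℕ} {ρ : Op m}

/-- The square root of a state is a Hilbert–Schmidt operator of norm one, which makes every trace
against ρ an absolutely convergent sum. -/
theorem IsState.exists_sqrt (h : IsState ρ) : ∃ R : Op m, IsSelfAdjoint R ∧ R * R = ρ ∧
    HasSum (fun n => ‖R (fockBasis m n)‖ ^ 2) 1 := by
  obtain ⟨R, hR, hR2⟩ := exists_isSelfAdjoint_mul_self h.1
  refine ⟨R, hR, hR2, ?_⟩
  have h2 := h.2
  have e : ∀ n : Fin m → ℕ, ⟪fock n, ρ (fock n)⟫_ℂ = ((‖R (fockBasis m n)‖ ^ 2 : ℝ) : ℂ) := by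
    intro n
    rw [← hR2, mul_apply_eq_comp, fockBasis_apply,
      ← show ⟪R (fock n), R (fock n)⟫_ℂ = ⟪fock n, R (R (fock n))⟫_ℂ from hR.isSymmetric _ _,
      inner_self_eq_norm_sq_to_K]
    norm_cast
  simp only [e] at h2
  exact Complex.hasSum_ofReal.1 (by simpa using h2)

/-- The expectation value `tr (ρ B)`. -/
def ev (ρ B : Op m) : ℂ := trace (ρ ∘L B)

theorem ev_eq_expect {R : Op m} (hR : IsSelfAdjoint R) (hR2 : R * R = ρ)
    (hs : HasSum (fun n => ‖R (fockBasis m n)‖ ^ 2) 1) (B : Op m) :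
    ev ρ B = expect (fockBasis m) R B := by
  have := hasSum_trace_mul_mul hR hs.summable 1 B
  rw [mul_one] at this
  rw [ev, trace, ← this.tsum_eq, ← hR2]
  simp [mul_apply_eq_comp]

theorem IsState.hasSum_ev_left (h : IsState ρ) (B : Op m) :
    HasSum (fun n : Fin m → ℕ => ⟪fock n, B (ρ (fock n))⟫_ℂ) (ev ρ B) := by
  obtain ⟨R, hR, hR2, hs⟩ := h.exists_sqrt
  have := hasSum_trace_mul_mul hR hs.summable B 1
  rw [one_mul] at this
  rw [ev_eq_expect hR hR2 hs]
  simpa [← hR2, mul_apply_eq_comp] using this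

theorem IsState.ev_add (h : IsState ρ) (B C : Op m) : ev ρ (B + C) = ev ρ B + ev ρ C := by
  obtain ⟨R, hR, hR2, hs⟩ := h.exists_sqrt
  simp only [ev_eq_expect hR hR2 hs, expect_add hs.summable]

theorem IsState.ev_sub (h : IsState ρ) (B C : Op m) : ev ρ (B - C) = ev ρ B - ev ρ C := by
  obtain ⟨R, hR, hR2, hs⟩ := h.exists_sqrt
  simp only [ev_eq_expect hR hR2 hs, expect_sub hs.summable]

theorem IsState.ev_smul (h : IsState ρ) (c : ℂ) (B : Op m) : ev ρ (c • B) = c * ev ρ B := by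
  obtain ⟨R, hR, hR2, hs⟩ := h.exists_sqrt
  simp only [ev_eq_expect hR hR2 hs, expect_smul]

theorem IsState.ev_sum (h : IsState ρ) {κ : Type*} (F : Finset κ) (B : κ → Op m) :
    ev ρ (∑ k ∈ F, B k) = ∑ k ∈ F, ev ρ (B k) := by
  obtain ⟨R, hR, hR2, hs⟩ := h.exists_sqrt
  simp only [ev_eq_expect hR hR2 hs, expect_sum hs.summable]

theorem IsState.ev_one (h : IsState ρ) : ev ρ 1 = 1 := by
  obtain ⟨R, hR, hR2, hs⟩ := h.exists_sqrt
  rw [ev_eq_expect hR hR2 hs, expect_one hs, Complex.ofReal_one]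

theorem IsState.norm_ev_le (h : IsState ρ) (B : Op m) : ‖ev ρ B‖ ≤ ‖B‖ := by
  obtain ⟨R, hR, hR2, hs⟩ := h.exists_sqrt
  rw [ev_eq_expect hR hR2 hs]
  simpa using norm_expect_le hs B

theorem IsState.ev_rankOne (h : IsState ρ) (x y : ModeSpace m) :
    ev ρ (rankOne ℂ x y) = ⟪y, ρ x⟫_ℂ := by
  obtain ⟨R, hR, hR2, hs⟩ := h.exists_sqrt
  rw [ev_eq_expect hR hR2 hs, expect_rankOne hR, ← hR2, mul_apply_eq_comp]

theorem IsState.norm_ev_mul_mul_le (h : IsState ρ) {P Q S : Op m} (hP : IsSelfAdjoint P)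
    (hP2 : P * P = P) (hQ : IsSelfAdjoint Q) (hQ2 : Q * Q = Q) (hS : ‖S‖ ≤ 1) {a : ℝ}
    (ha : 0 < a) :
    ‖ev ρ (Q * S * P)‖ ≤ a / 2 * (ev ρ P).re + 1 / (2 * a) * (ev ρ Q).re := by
  obtain ⟨R, hR, hR2, hs⟩ := h.exists_sqrt
  rw [ev_eq_expect hR hR2 hs, ev_eq_expect hR hR2 hs, ev_eq_expect hR hR2 hs]
  have hre : ∀ B : Op m, HasSum (fun n => (⟪R (fockBasis m n), B (R (fockBasis m n))⟫_ℂ).re)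
      (expect (fockBasis m) R B).re := fun B =>
    Complex.hasSum_re (summable_expect hs.summable B).hasSum
  exact tsum_of_norm_bounded (((hre P).mul_left _).add ((hre Q).mul_left _)) fun n =>
    norm_inner_mul_mul_le hP hP2 hQ hQ2 hS ha _

/-! ### Duality for the trace norm -/

theorem traceNorm_sub_le {ρ₀ ρ₁ : Op m} (h₀ : IsState ρ₀) (h₁ : IsState ρ₁) {K : ℝ}
    (hK : ∀ S : Op m, ‖S‖ ≤ 1 → ‖ev ρ₀ S - ev ρ₁ S‖ ≤ K) : traceNorm (ρ₀ - ρ₁) ≤ K := by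
  have hsa : IsSelfAdjoint (ρ₀ - ρ₁) :=
    IsSelfAdjoint.sub (IsPositive.isSelfAdjoint h₀.1) (IsPositive.isSelfAdjoint h₁.1)
  have hpos : ∀ n : Fin m → ℕ, 0 ≤ (⟪fock n, absOp (ρ₀ - ρ₁) (fock n)⟫_ℂ).re := fun n =>
    (absOp_isPositive _).re_inner_nonneg_right _
  have hreal : ∀ n : Fin m → ℕ, ⟪fock n, absOp (ρ₀ - ρ₁) (fock n)⟫_ℂ =
      ((⟪fock n, absOp (ρ₀ - ρ₁) (fock n)⟫_ℂ).re : ℂ) := fun n =>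
    Complex.ext rfl (Complex.nonneg_iff.1
      ((absOp_isPositive (ρ₀ - ρ₁)).inner_nonneg_right (fock n))).2.symm
  have hsum : ∀ F : Finset (Fin m → ℕ),
      ∑ n ∈ F, (⟪fock n, absOp (ρ₀ - ρ₁) (fock n)⟫_ℂ).re ≤ K := by
    intro F
    refine le_of_forall_pos_le_add fun δ hδ => ?_
    have hF : (0 : ℝ) < F.card + 1 := Nat.cast_add_one_pos _
    -- The operator norm error is spread over F, so that the partial trace changes by at most δ; the
    -- +1 covers the empty F. Positivity of S(ρ₀ - ρ₁) then bounds the partial trace by the full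
    -- one.
    obtain ⟨S, hS1, hS2, hS3⟩ := exists_norm_absOp_sub_mul_le hsa (div_pos hδ hF)
    have hs : HasSum (fun n : Fin m → ℕ => (⟪fock n, (S * (ρ₀ - ρ₁)) (fock n)⟫_ℂ).re)
        (ev ρ₀ S - ev ρ₁ S).re := by
      have := Complex.hasSum_re ((h₀.hasSum_ev_left S).sub (h₁.hasSum_ev_left S))
      have e : ∀ n : Fin m → ℕ, ⟪fock n, S (ρ₀ (fock n))⟫_ℂ - ⟪fock n, S (ρ₁ (fock n))⟫_ℂ =
          ⟪fock n, (S * (ρ₀ - ρ₁)) (fock n)⟫_ℂ := by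
        intro n
        rw [mul_apply_eq_comp, sub_apply, map_sub, inner_sub_right]
      simpa only [e] using this
    have h1 : ∑ n ∈ F, (⟪fock n, (S * (ρ₀ - ρ₁)) (fock n)⟫_ℂ).re ≤ K :=
      ((sum_le_hasSum F (fun n _ => hS2.re_inner_nonneg_right _) hs).trans
        (Complex.re_le_norm _)).trans (hK S hS1)
    have h2 : ∀ n ∈ F, (⟪fock n, absOp (ρ₀ - ρ₁) (fock n)⟫_ℂ).re ≤
        (⟪fock n, (S * (ρ₀ - ρ₁)) (fock n)⟫_ℂ).re + δ / (F.card + 1) := by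
      intro n _
      have h3 : (⟪fock n, (absOp (ρ₀ - ρ₁) - S * (ρ₀ - ρ₁)) (fock n)⟫_ℂ).re ≤
          δ / (F.card + 1) := by
        refine ((Complex.re_le_norm _).trans (norm_inner_apply_le _ _)).trans ?_
        rwa [(orthonormal_fock m).1 n, one_pow, mul_one]
      rw [sub_apply, inner_sub_right, Complex.sub_re] at h3
      linarith
    have h4 := Finset.sum_le_sum h2
    rw [Finset.sum_add_distrib, Finset.sum_const, nsmul_eq_mul] at h4
    have h5 : (F.card : ℝ) * (δ / (F.card + 1)) ≤ δ := by
      rw [mul_div_assoc', div_le_iff₀ hF]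
      nlinarith
    linarith
  rw [traceNorm, trace, tsum_congr hreal, ← Complex.ofReal_tsum, Complex.ofReal_re]
  exact Real.tsum_le_of_sum_le hpos hsum

end

section

/-! ### Trace norm and photon number -/

open ContinuousLinearMap InnerProductSpace

variable {m : ℕ} {ρ ρ₀ ρ₁ : Op m}

/-- The projection onto the span of the number states in `F`. -/
def fockProj (F : Finset (Fin m → ℕ)) : Op m := ∑ n ∈ F, rankOne ℂ (fock n) (fock n)

theorem fockProj_isSelfAdjoint (F : Finset (Fin m → ℕ)) : IsSelfAdjoint (fockProj F) := by
  unfold fockProj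
  induction F using Finset.induction_on with
  | empty => simp
  | insert a F ha ih =>
    rw [Finset.sum_insert ha]
    exact IsSelfAdjoint.add (IsPositive.isSelfAdjoint (isPositive_rankOne_self _)) ih

theorem fockProj_fock {F : Finset (Fin m → ℕ)} {n : Fin m → ℕ} (hn : n ∈ F) :
    fockProj F (fock n) = fock n := by
  classical
  simp only [fockProj, sum_apply, rankOne_apply,
    orthonormal_iff_ite.1 (orthonormal_fock m)]
  simp [hn]

theorem fockProj_mul_self (F : Finset (Fin m → ℕ)) : fockProj F * fockProj F = fockProj F := by
  have h : fockProj F * fockProj F = ∑ n ∈ F, fockProj F * rankOne ℂ (fock n) (fock n) := by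
    conv_lhs => rw [show fockProj F * fockProj F =
      fockProj F * ∑ n ∈ F, rankOne ℂ (fock n) (fock n) from rfl, Finset.mul_sum]
  rw [h]
  refine Finset.sum_congr rfl fun n hn => ?_
  rw [mul_def, comp_rankOne, fockProj_fock hn]

theorem fockCompl_isSelfAdjoint (F : Finset (Fin m → ℕ)) : IsSelfAdjoint (1 - fockProj F) :=
  IsSelfAdjoint.sub (IsSelfAdjoint.one _) (fockProj_isSelfAdjoint F)

theorem fockCompl_mul_self (F : Finset (Fin m → ℕ)) :
    (1 - fockProj F) * (1 - fockProj F) = 1 - fockProj F := by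
  rw [sub_mul, mul_sub, mul_sub, fockProj_mul_self]
  simp

theorem IsState.ev_fockProj (h : IsState ρ) (F : Finset (Fin m → ℕ)) :
    ev ρ (fockProj F) = ∑ n ∈ F, ⟪fock n, ρ (fock n)⟫_ℂ := by
  rw [fockProj, h.ev_sum]
  exact Finset.sum_congr rfl fun n _ => h.ev_rankOne _ _

theorem IsState.ev_sub_le (h₀ : IsState ρ₀) (h₁ : IsState ρ₁) (x y : ModeSpace m) :
    ‖ev ρ₀ (rankOne ℂ x y) - ev ρ₁ (rankOne ℂ x y)‖ ≤ ‖ρ₀ - ρ₁‖ * ‖x‖ * ‖y‖ := by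
  rw [h₀.ev_rankOne, h₁.ev_rankOne, ← inner_sub_right, ← sub_apply, mul_comm]
  refine (norm_inner_le_norm _ _).trans ?_
  exact mul_le_mul_of_nonneg_left ((ρ₀ - ρ₁).le_opNorm x) (norm_nonneg _)

/-- Markov's inequality for the photon number distribution. -/
theorem IsState.re_ev_fockCompl_le (h : IsState ρ) {e : ℝ} (he : 0 ≤ e)
    (hE : meanPhotonNumber ρ ≤ ENNReal.ofReal e) {F : Finset (Fin m → ℕ)} {N : ℝ} (hN : 0 < N)
    (hF : ∀ n ∉ F, N ≤ ((∑ j, n j : ℕ) : ℝ)) :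
    (ev ρ (1 - fockProj F)).re ≤ e / N := by
  classical
  set g : (Fin m → ℕ) → ℝ := fun n => (⟪fock n, ρ (fock n)⟫_ℂ).re with hg
  have hg0 : ∀ n, 0 ≤ g n := fun n => h.1.re_inner_nonneg_right _
  have hs : HasSum g 1 := by simpa using Complex.hasSum_re h.2
  have hb : ∀ G : Finset (Fin m → ℕ), ∑ n ∈ G, ((∑ j, n j : ℕ) : ℝ) * g n ≤ e := by
    intro G
    have h1 : ∑ n ∈ G, ((∑ j, n j : ℕ) : ℝ≥0∞) * ENNReal.ofReal (g n) ≤ ENNReal.ofReal e :=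
      (ENNReal.sum_le_tsum G).trans hE
    have h2 : ∀ n : Fin m → ℕ, ((∑ j, n j : ℕ) : ℝ≥0∞) * ENNReal.ofReal (g n) =
        ENNReal.ofReal (((∑ j, n j : ℕ) : ℝ) * g n) := by
      intro n
      rw [ENNReal.ofReal_mul (Nat.cast_nonneg _), ENNReal.ofReal_natCast]
    simp only [h2] at h1
    rw [← ENNReal.ofReal_sum_of_nonneg fun n _ => mul_nonneg (Nat.cast_nonneg _) (hg0 n)] at h1
    exact (ENNReal.ofReal_le_ofReal_iff he).1 h1
  have hre : (ev ρ (1 - fockProj F)).re = 1 - ∑ n ∈ F, g n := by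
    rw [h.ev_sub, h.ev_one, h.ev_fockProj, Complex.sub_re, Complex.re_sum, Complex.one_re]
  have hc : HasSum (fun n => if n ∈ F then 0 else g n) (1 - ∑ n ∈ F, g n) := by
    have h3 : HasSum (fun n => if n ∈ F then g n else 0) (∑ n ∈ F, g n) := by
      have e1 : ∑ n ∈ F, g n = ∑ n ∈ F, (if n ∈ F then g n else 0) :=
        Finset.sum_congr rfl fun n hn => (if_pos hn).symm
      rw [e1]
      exact hasSum_sum_of_ne_finset_zero fun n hn => if_neg hn
    have e2 : (fun n => if n ∈ F then 0 else g n) = fun n => g n - if n ∈ F then g n else 0 := by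
      ext n
      by_cases hn : n ∈ F <;> simp [hn]
    rw [e2]
    exact hs.sub h3
  rw [hre, ← hc.tsum_eq]
  refine Real.tsum_le_of_sum_le (fun n => by split_ifs <;> simp [hg0]) fun G => ?_
  rw [le_div_iff₀ hN, Finset.sum_mul]
  refine (Finset.sum_le_sum fun n _ => ?_).trans (hb G)
  split_ifs with hn
  · rw [zero_mul]
    exact mul_nonneg (Nat.cast_nonneg _) (hg0 n)
  · rw [mul_comm]
    exact mul_le_mul_of_nonneg_right (hF n hn) (hg0 n)

theorem norm_fockCompl_le (F : Finset (Fin m → ℕ)) : ‖1 - fockProj F‖ ≤ 1 :=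
  norm_le_one_of_mul_self (fockCompl_isSelfAdjoint F) (fockCompl_mul_self F)

/-- S times the projection is a sum of |F| rank-one operators of norm at most one, and each of them
sees at most the operator norm of the difference. -/
theorem IsState.norm_ev_sub_mul_fockProj_le (h₀ : IsState ρ₀) (h₁ : IsState ρ₁)
    (F : Finset (Fin m → ℕ)) {S : Op m} (hS : ‖S‖ ≤ 1) :
    ‖ev ρ₀ (S * fockProj F) - ev ρ₁ (S * fockProj F)‖ ≤ F.card * ‖ρ₀ - ρ₁‖ := by
  rw [fockProj, Finset.mul_sum, h₀.ev_sum, h₁.ev_sum, ← Finset.sum_sub_distrib, ← nsmul_eq_mul]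
  refine norm_sum_le_of_le _ (fun n _ => ?_) |>.trans (Finset.sum_const _).le
  rw [mul_def, comp_rankOne]
  refine (h₀.ev_sub_le h₁ _ _).trans ?_
  rw [(orthonormal_fock m).1 n, mul_one]
  refine mul_le_of_le_one_right (norm_nonneg _) ((S.le_opNorm _).trans ?_)
  rwa [(orthonormal_fock m).1 n, mul_one]

theorem IsState.norm_ev_sub_fockProj_mul_le (h₀ : IsState ρ₀) (h₁ : IsState ρ₁)
    (F : Finset (Fin m → ℕ)) {S : Op m} (hS : ‖S‖ ≤ 1) :
    ‖ev ρ₀ (fockProj F * S) - ev ρ₁ (fockProj F * S)‖ ≤ F.card * ‖ρ₀ - ρ₁‖ := by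
  rw [fockProj, Finset.sum_mul, h₀.ev_sum, h₁.ev_sum, ← Finset.sum_sub_distrib, ← nsmul_eq_mul]
  refine norm_sum_le_of_le _ (fun n _ => ?_) |>.trans (Finset.sum_const _).le
  rw [mul_def, rankOne_comp]
  refine (h₀.ev_sub_le h₁ _ _).trans ?_
  rw [(orthonormal_fock m).1 n, mul_one]
  refine mul_le_of_le_one_right (norm_nonneg _) (((adjoint S).le_opNorm _).trans ?_)
  rwa [(orthonormal_fock m).1 n, mul_one, LinearIsometryEquiv.norm_map]

theorem IsState.norm_ev_sub_le_two (h₀ : IsState ρ₀) (h₁ : IsState ρ₁) {S : Op m}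
    (hS : ‖S‖ ≤ 1) : ‖ev ρ₀ S - ev ρ₁ S‖ ≤ 2 := by
  have := norm_sub_le (ev ρ₀ S) (ev ρ₁ S)
  linarith [h₀.norm_ev_le S, h₁.norm_ev_le S]

theorem IsState.traceNorm_sub_le_two (h₀ : IsState ρ₀) (h₁ : IsState ρ₁) :
    traceNorm (ρ₀ - ρ₁) ≤ 2 :=
  traceNorm_sub_le h₀ h₁ fun _ hS => h₀.norm_ev_sub_le_two h₁ hS

/-- By duality it is enough to test against a contraction S, split into SP + PS(1-P) + (1-P)S(1-P).
The first two pieces have finite rank and cost |F| times the operator norm each. The third is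
bounded by the weights of the two states outside F. -/
theorem IsState.traceNorm_sub_le_card (h₀ : IsState ρ₀) (h₁ : IsState ρ₁)
    (F : Finset (Fin m → ℕ)) :
    traceNorm (ρ₀ - ρ₁) ≤ 2 * F.card * ‖ρ₀ - ρ₁‖ + (ev ρ₀ (1 - fockProj F)).re +
      (ev ρ₁ (1 - fockProj F)).re := by
  refine traceNorm_sub_le h₀ h₁ fun S hS => ?_
  set P := fockProj F
  have hdec : S = S * P + P * (S * (1 - P)) + (1 - P) * S * (1 - P) := by noncomm_ring
  have hSQ : ‖S * (1 - P)‖ ≤ 1 := (norm_mul_le _ _).trans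
    (mul_le_one₀ hS (norm_nonneg _) (norm_fockCompl_le F))
  have h1 := h₀.norm_ev_sub_mul_fockProj_le h₁ F hS
  have h2 := h₀.norm_ev_sub_fockProj_mul_le h₁ F hSQ
  have hb : ∀ {ρ : Op m}, IsState ρ → ‖ev ρ ((1 - P) * S * (1 - P))‖ ≤ (ev ρ (1 - P)).re := by
    intro ρ h
    have := h.norm_ev_mul_mul_le (fockCompl_isSelfAdjoint F) (fockCompl_mul_self F)
      (fockCompl_isSelfAdjoint F) (fockCompl_mul_self F) hS one_pos
    linarith
  have h3 := norm_sub_le (ev ρ₀ ((1 - P) * S * (1 - P))) (ev ρ₁ ((1 - P) * S * (1 - P)))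
  have e : ev ρ₀ S - ev ρ₁ S = (ev ρ₀ (S * P) - ev ρ₁ (S * P)) +
      (ev ρ₀ (P * (S * (1 - P))) - ev ρ₁ (P * (S * (1 - P)))) +
      (ev ρ₀ ((1 - P) * S * (1 - P)) - ev ρ₁ ((1 - P) * S * (1 - P))) := by
    conv_lhs => rw [hdec]
    rw [h₀.ev_add, h₀.ev_add, h₁.ev_add, h₁.ev_add]
    ring
  rw [e]
  refine (norm_add₃_le).trans ?_
  linarith [hb h₀, hb h₁]

theorem IsState.re_ev_nonneg (h : IsState ρ) {B : Op m} (hB : IsSelfAdjoint B) (hB2 : B * B = B) :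
    0 ≤ (ev ρ B).re := by
  have := h.norm_ev_mul_mul_le hB hB2 hB hB2 (S := 0) (by simp) one_pos
  have := (norm_nonneg _).trans this
  linarith

/-- Both states are close to the vacuum. The vacuum block of a contraction is a scalar multiple of
the vacuum projection and distinguishes them by at most e. The remaining blocks contribute at most
2c + e per state. -/
theorem IsState.traceNorm_sub_le_of_vacuum (h₀ : IsState ρ₀) (h₁ : IsState ρ₁) {e c : ℝ}
    (hc : 0 < c) (he : e ≤ c ^ 2) (hE₀ : (ev ρ₀ (1 - fockProj {0})).re ≤ e)
    (hE₁ : (ev ρ₁ (1 - fockProj {0})).re ≤ e) : traceNorm (ρ₀ - ρ₁) ≤ 4 * c + 3 * e := by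
  refine traceNorm_sub_le h₀ h₁ fun S hS => ?_
  have hP1 := fockProj_isSelfAdjoint ({0} : Finset (Fin m → ℕ))
  have hP2 := fockProj_mul_self ({0} : Finset (Fin m → ℕ))
  have hQ1 := fockCompl_isSelfAdjoint ({0} : Finset (Fin m → ℕ))
  have hQ2 := fockCompl_mul_self ({0} : Finset (Fin m → ℕ))
  have hPr : fockProj ({0} : Finset (Fin m → ℕ)) = rankOne ℂ (fock 0) (fock 0) := by
    simp [fockProj]
  have hPSP : fockProj ({0} : Finset (Fin m → ℕ)) * S * fockProj {0} =
      ⟪fock 0, S (fock 0)⟫_ℂ • fockProj {0} := by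
    rw [hPr]
    ext1 x
    simp only [mul_apply_eq_comp, rankOne_apply, smul_apply, map_smul]
    rw [smul_smul, mul_comm, smul_smul]
  set P := fockProj ({0} : Finset (Fin m → ℕ))
  have key : ∀ {ρ : Op m}, IsState ρ → (ev ρ (1 - P)).re ≤ e →
      ‖ev ρ ((1 - P) * S * P + P * S * (1 - P) + (1 - P) * S * (1 - P))‖ ≤ 2 * c + e := by
    intro ρ h hE
    have hsum : (ev ρ P).re ≤ 1 := by
      have h1 := h.re_ev_nonneg hQ1 hQ2
      rw [h.ev_sub, h.ev_one, Complex.sub_re, Complex.one_re] at h1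
      linarith
    -- With weight c (and 1/c for the transposed block) each off-diagonal block is at most c/2 +
    -- e/(2c), and e ≤ c² makes this at most c.
    have h1 := h.norm_ev_mul_mul_le hP1 hP2 hQ1 hQ2 hS hc
    have h2 := h.norm_ev_mul_mul_le hQ1 hQ2 hP1 hP2 hS (inv_pos.2 hc)
    have h3 := h.norm_ev_mul_mul_le hQ1 hQ2 hQ1 hQ2 hS one_pos
    have h4 : 1 / (2 * c) * (ev ρ (1 - P)).re ≤ c / 2 := by
      rw [div_mul_eq_mul_div, div_le_iff₀ (by positivity)]
      nlinarith
    have h5 : c⁻¹ / 2 * (ev ρ (1 - P)).re ≤ c / 2 := by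
      convert h4 using 2
      field_simp
    have h6 : 1 / (2 * c⁻¹) * (ev ρ P).re ≤ c / 2 := by
      have : 1 / (2 * c⁻¹) = c / 2 := by field_simp
      rw [this]
      exact mul_le_of_le_one_right (by positivity) hsum
    have h7 : c / 2 * (ev ρ P).re ≤ c / 2 := mul_le_of_le_one_right (by positivity) hsum
    rw [h.ev_add, h.ev_add]
    refine norm_add₃_le.trans ?_
    linarith
  have hvac : ‖ev ρ₀ (P * S * P) - ev ρ₁ (P * S * P)‖ ≤ e := by
    rw [hPSP, h₀.ev_smul, h₁.ev_smul, ← mul_sub, norm_mul]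
    have hs : ‖⟪fock 0, S (fock 0)⟫_ℂ‖ ≤ 1 := by
      refine (norm_inner_apply_le S (fock (0 : Fin m → ℕ))).trans ?_
      rw [(orthonormal_fock m).1 0]
      simpa using hS
    refine (mul_le_of_le_one_left (norm_nonneg _) hs).trans ?_
    have hre : ∀ {ρ : Op m}, IsState ρ → ev ρ P = ((1 - (ev ρ (1 - P)).re : ℝ) : ℂ) := by
      intro ρ h
      have : ((ev ρ P).re : ℂ) = ev ρ P := by
        refine Complex.ext rfl ?_
        rw [hPr, h.ev_rankOne]
        exact (Complex.nonneg_iff.1 (h.1.inner_nonneg_right (fock 0))).2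
      rw [← this, h.ev_sub, h.ev_one, Complex.sub_re, Complex.one_re, sub_sub_cancel]
    rw [hre h₀, hre h₁, ← Complex.ofReal_sub, Complex.norm_real, Real.norm_eq_abs, abs_le]
    have := h₀.re_ev_nonneg hQ1 hQ2
    have := h₁.re_ev_nonneg hQ1 hQ2
    constructor <;> linarith
  have e1 : ev ρ₀ S - ev ρ₁ S = (ev ρ₀ (P * S * P) - ev ρ₁ (P * S * P)) +
      (ev ρ₀ ((1 - P) * S * P + P * S * (1 - P) + (1 - P) * S * (1 - P)) -
        ev ρ₁ ((1 - P) * S * P + P * S * (1 - P) + (1 - P) * S * (1 - P))) := by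
    have hdec' : S = P * S * P +
        ((1 - P) * S * P + P * S * (1 - P) + (1 - P) * S * (1 - P)) := by noncomm_ring
    conv_lhs => rw [hdec']
    rw [h₀.ev_add, h₁.ev_add]
    ring
  rw [e1]
  refine (norm_add_le _ _).trans ?_
  have := norm_sub_le (ev ρ₀ ((1 - P) * S * P + P * S * (1 - P) + (1 - P) * S * (1 - P)))
    (ev ρ₁ ((1 - P) * S * P + P * S * (1 - P) + (1 - P) * S * (1 - P)))
  linarith [key h₀ hE₀, key h₁ hE₁]

end

section

/-! ### Displaced parity operators -/

open ContinuousLinearMap InnerProductSpace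

variable {m : ℕ}

/-- The phase factor `e^{i p·(q - x/2)}` of the displacement operator. -/
def phase (z : PhaseSpace m) (q : Fin m → ℝ) : ℂ :=
  Complex.exp (Complex.I * ((∑ j, z.2 j * (q j - z.1 j / 2) : ℝ) : ℂ))

theorem norm_phase (z : PhaseSpace m) (q : Fin m → ℝ) : ‖phase z q‖ = 1 := by
  rw [phase, mul_comm, Complex.norm_exp_ofReal_mul_I]

theorem displacement_coeFn (z : PhaseSpace m) (ψ : ModeSpace m) :
    displacement z ψ =ᵐ[volume] fun q => phase z q * ψ (q - z.1) := by
  have h1 := coeFn_holder (r := 2) (ContinuousLinearMap.mul ℂ ℂ)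
    ((memLp_phase z).toLp _) (Lp.compMeasurePreservingₗᵢ ℂ (fun q : Fin m → ℝ => q - z.1)
      (measurePreserving_sub_right volume z.1) ψ)
  have h2 := (memLp_phase z).coeFn_toLp
  have h3 := Lp.coeFn_compMeasurePreserving ψ (measurePreserving_sub_right volume z.1)
  filter_upwards [h1, h2, h3] with q h1 h2 h3
  refine h1.trans ?_
  rw [h2]
  exact congrArg _ h3

theorem parity_coeFn (ψ : ModeSpace m) : parity m ψ =ᵐ[volume] fun q => ψ (-q) :=
  Lp.coeFn_compMeasurePreserving ψ (Measure.measurePreserving_neg volume)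

theorem norm_displacement_le (z : PhaseSpace m) : ‖displacement z‖ ≤ 1 := by
  refine opNorm_le_bound _ zero_le_one fun ψ => ?_
  rw [one_mul, ← (Lp.compMeasurePreservingₗᵢ ℂ (fun q : Fin m → ℝ => q - z.1)
      (measurePreserving_sub_right volume z.1)).norm_map ψ]
  refine Lp.norm_le_norm_of_ae_le ?_
  filter_upwards [displacement_coeFn z ψ,
    Lp.coeFn_compMeasurePreserving ψ (measurePreserving_sub_right volume z.1)] with q h1 h2
  rw [h1, norm_mul, norm_phase, one_mul]
  exact (congrArg norm h2).ge

theorem phase_neg_add (z : PhaseSpace m) (q : Fin m → ℝ) :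
    starRingEnd ℂ (phase (-z) (q - z.1)) = phase z q := by
  rw [phase, phase, ← Complex.exp_conj, map_mul, Complex.conj_I, Complex.conj_ofReal]
  congr 1
  rw [neg_mul, ← mul_neg, ← Complex.ofReal_neg, ← Finset.sum_neg_distrib]
  congr 3
  ext j
  simp only [Prod.snd_neg, Prod.fst_neg, Pi.neg_apply, Pi.sub_apply]
  ring

theorem adjoint_displacement (z : PhaseSpace m) :
    adjoint (displacement z) = displacement (-z) := by
  symm
  rw [eq_adjoint_iff]
  intro u w
  rw [L2.inner_def, L2.inner_def]
  have h1 : ∫ q, ⟪displacement (-z) u q, w q⟫_ℂ =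
      ∫ q, w q * starRingEnd ℂ (phase (-z) q * u (q + z.1)) := by
    refine integral_congr_ae ?_
    filter_upwards [displacement_coeFn (-z) u] with q h
    rw [RCLike.inner_apply, h]
    simp
  have h2 : ∫ q, ⟪u q, displacement z w q⟫_ℂ =
      ∫ q, phase z q * w (q - z.1) * starRingEnd ℂ (u q) := by
    refine integral_congr_ae ?_
    filter_upwards [displacement_coeFn z w] with q h
    rw [RCLike.inner_apply, h]
  rw [h1, h2, ← integral_sub_right_eq_self _ z.1]
  refine integral_congr_ae (Filter.Eventually.of_forall fun q => ?_)
  simp only [map_mul, phase_neg_add, sub_add_cancel]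
  ring

/-- The displaced parity operator `D(α) (-1)^{N₁ + ⋯ + N_m} D(α)†`. -/
def dparity (z : PhaseSpace m) : Op m :=
  displacement z ∘L parity m ∘L adjoint (displacement z)

theorem norm_dparity_le (z : PhaseSpace m) : ‖dparity z‖ ≤ 1 := by
  have h1 := norm_displacement_le z
  have h2 : ‖parity m‖ ≤ 1 := LinearIsometry.norm_toContinuousLinearMap_le _
  have h3 : ‖adjoint (displacement z)‖ ≤ 1 := by rwa [LinearIsometryEquiv.norm_map]
  exact (opNorm_comp_le _ _).trans (mul_le_one₀ h1 (norm_nonneg _)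
    ((opNorm_comp_le _ _).trans (mul_le_one₀ h2 (norm_nonneg _) h3)))

theorem phase_mul_phase_neg (z : PhaseSpace m) (q : Fin m → ℝ) :
    phase z q * phase (-z) (z.1 - q) = osc z.2 (q - z.1) := by
  rw [phase, phase, osc, ← Complex.exp_add, ← mul_add, ← Complex.ofReal_add,
    ← Finset.sum_add_distrib, Finset.mul_sum, mul_comm]
  congr 4
  ext j
  simp
  ring

/-- Conjugating the parity by a displacement gives the reflection of position space in the point x,
with the two phases combined into one character. -/
theorem dparity_coeFn (z : PhaseSpace m) (ψ : ModeSpace m) :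
    dparity z ψ =ᵐ[volume] fun q => osc z.2 (q - z.1) * ψ (z.1 + z.1 - q) := by
  have h1 := displacement_coeFn z (parity m (displacement (-z) ψ))
  have h2 := (measurePreserving_sub_right volume z.1).quasiMeasurePreserving.ae
    (parity_coeFn (displacement (-z) ψ))
  have h3 := ((Measure.measurePreserving_neg volume).comp
    (measurePreserving_sub_right volume z.1)).quasiMeasurePreserving.ae
    (displacement_coeFn (-z) ψ)
  rw [dparity, adjoint_displacement]
  filter_upwards [h1, h2, h3] with q h1 h2 h3
  refine h1.trans ?_
  rw [h2]
  simp only [Function.comp_apply, neg_sub] at h3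
  rw [neg_sub, h3, ← mul_assoc, phase_mul_phase_neg]
  congr 2
  simp
  abel

/-- The integrand `s ↦ conj (u (x + s)) w (x - s)` of the cross Wigner function. -/
def corr (u w : (Fin m → ℝ) → ℂ) (x s : Fin m → ℝ) : ℂ :=
  starRingEnd ℂ (u (x + s)) * w (x - s)

/-- The substitution q = x + s exhibits the cross Wigner function, for each fixed x, as a Fourier
transform in p. Inversion and Parseval are applied in this form. -/
theorem inner_dparity (u w : ModeSpace m) (z : PhaseSpace m) :
    ⟪u, dparity z w⟫_ℂ = oscFT (corr u w z.1) z.2 := by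
  have h1 : ⟪u, dparity z w⟫_ℂ =
      ∫ q, osc z.2 (q - z.1) * w (z.1 + z.1 - q) * starRingEnd ℂ (u q) := by
    rw [L2.inner_def]
    refine integral_congr_ae ?_
    filter_upwards [dparity_coeFn z w] with q h
    rw [RCLike.inner_apply, h]
  rw [h1, ← integral_add_left_eq_self _ z.1, oscFT]
  refine integral_congr_ae (Filter.Eventually.of_forall fun q => ?_)
  simp only [corr, add_sub_cancel_left, add_sub_add_left_eq_sub]
  ring

theorem corr_congr {u u' w w' : (Fin m → ℝ) → ℂ} (hu : u =ᵐ[volume] u') (hw : w =ᵐ[volume] w')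
    (x : Fin m → ℝ) : corr u w x =ᵐ[volume] corr u' w' x := by
  have h1 := (measurePreserving_add_left volume x).quasiMeasurePreserving.ae hu
  have h2 := (Measure.measurePreserving_sub_left volume x).quasiMeasurePreserving.ae hw
  filter_upwards [h1, h2] with s h1 h2
  rw [corr, corr, h1, h2]

theorem oscFT_congr {F G : (Fin m → ℝ) → ℂ} (h : F =ᵐ[volume] G) (p : Fin m → ℝ) :
    oscFT F p = oscFT G p := by
  refine integral_congr_ae ?_
  filter_upwards [h] with s h
  rw [h]

theorem conj_inner_dparity (u w : ModeSpace m) (z : PhaseSpace m) :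
    starRingEnd ℂ ⟪u, dparity z w⟫_ℂ = ⟪w, dparity z u⟫_ℂ := by
  rw [inner_dparity, inner_dparity, oscFT, ← integral_conj, oscFT, ← integral_neg_eq_self]
  refine integral_congr_ae (Filter.Eventually.of_forall fun s => ?_)
  simp only [map_mul, conj_osc, corr, neg_neg, Complex.conj_conj, sub_neg_eq_add, ← sub_eq_add_neg]
  ring

theorem stronglyMeasurable_inner_dparity (u w : ModeSpace m) :
    StronglyMeasurable fun z => ⟪u, dparity z w⟫_ℂ := by
  simp only [inner_dparity, oscFT]
  refine StronglyMeasurable.integral_prod_right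
    (f := fun (z : PhaseSpace m) s => osc z.2 s * corr u w z.1 s) ?_
  have h1 : StronglyMeasurable fun y : PhaseSpace m × (Fin m → ℝ) => osc y.1.2 y.2 :=
    (continuous_osc.comp (by fun_prop : Continuous fun y : PhaseSpace m × (Fin m → ℝ) =>
      (y.1.2, y.2))).stronglyMeasurable
  have h2 : StronglyMeasurable fun y : PhaseSpace m × (Fin m → ℝ) => u (y.1.1 + y.2) :=
    (Lp.stronglyMeasurable u).comp_measurable (by fun_prop)
  have h3 : StronglyMeasurable fun y : PhaseSpace m × (Fin m → ℝ) => w (y.1.1 - y.2) :=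
    (Lp.stronglyMeasurable w).comp_measurable (by fun_prop)
  exact h1.mul ((Complex.continuous_conj.comp_stronglyMeasurable h2).mul h3)

theorem norm_inner_dparity_le (u w : ModeSpace m) (z : PhaseSpace m) :
    ‖⟪u, dparity z w⟫_ℂ‖ ≤ ‖u‖ * ‖w‖ := by
  refine (norm_inner_le_norm _ _).trans (mul_le_mul_of_nonneg_left ?_ (norm_nonneg _))
  exact ((dparity z).le_opNorm w).trans (mul_le_of_le_one_left (norm_nonneg _) (norm_dparity_le z))

theorem wigner_rankOne (j k : Fin m → ℕ) (z : PhaseSpace m) :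
    wigner (rankOne ℂ (fock k) (fock j)) z =
      ((Real.pi ^ m)⁻¹ : ℝ) * ⟪fock j, dparity z (fock k)⟫_ℂ := by
  rw [wigner, trace]
  congr 1
  have e : ∀ n : Fin m → ℕ, ⟪fock n, (rankOne ℂ (fock k) (fock j) ∘L displacement z ∘L parity m ∘L
      adjoint (displacement z)) (fock n)⟫_ℂ =
      if n = k then ⟪fock j, dparity z (fock k)⟫_ℂ else 0 := by
    intro n
    change ⟪fock n, rankOne ℂ (fock k) (fock j) (dparity z (fock n))⟫_ℂ = _
    rw [rankOne_apply, inner_smul_right, inner_fock_fock]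
    split_ifs with h
    · rw [h, mul_one]
    · rw [mul_zero]
  rw [tsum_congr e, tsum_ite_eq]

end

section

/-! ### Gaussian moments and cross Wigner functions of number states -/

/-- The one-dimensional kernel `e^{2ips}`. -/
def osc₁ (p s : ℝ) : ℂ := Complex.exp (((2 * (p * s) : ℝ) : ℂ) * Complex.I)

theorem norm_osc₁ (p s : ℝ) : ‖osc₁ p s‖ = 1 := Complex.norm_exp_ofReal_mul_I _

theorem integrable_pow_mul_exp_neg_sq (l : ℕ) :
    Integrable fun s : ℝ => s ^ l * Real.exp (-s ^ 2) := by
  simpa using integrable_polynomial_mul_exp_neg_mul_sq (Polynomial.X ^ l) one_pos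

theorem integrable_osc₁_mul (p : ℝ) {g : ℝ → ℂ} (hg : Integrable g) :
    Integrable fun s => osc₁ p s * g s :=
  hg.bdd_mul (c := 1)
    (by unfold osc₁; exact (by fun_prop : Continuous _).aestronglyMeasurable)
    (Filter.Eventually.of_forall fun s => (norm_osc₁ p s).le)

/-- The Fourier transform of `s ↦ s ^ l e^{-s²}`. -/
def gaussMoment (l : ℕ) (p : ℝ) : ℂ := ∫ s : ℝ, osc₁ p s * ((s ^ l * Real.exp (-s ^ 2) : ℝ) : ℂ)

theorem integrable_gaussMoment_integrand (l : ℕ) (p : ℝ) :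
    Integrable fun s : ℝ => osc₁ p s * ((s ^ l * Real.exp (-s ^ 2) : ℝ) : ℂ) :=
  integrable_osc₁_mul p (integrable_pow_mul_exp_neg_sq l).ofReal

theorem gaussMoment_zero (p : ℝ) :
    gaussMoment 0 p = (Real.sqrt Real.pi * Real.exp (-p ^ 2) : ℝ) := by
  have h := fourierIntegral_gaussian (b := 1) (by simp) (2 * p : ℂ)
  have e : ∀ s : ℝ, osc₁ p s * ((s ^ 0 * Real.exp (-s ^ 2) : ℝ) : ℂ) =
      Complex.exp (Complex.I * (2 * p) * s) * Complex.exp (-1 * (s : ℂ) ^ 2) := by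
    intro s
    rw [osc₁]
    push_cast
    congr 1
    · congr 1; ring
    · rw [pow_zero, one_mul]; congr 1; ring
  rw [gaussMoment, integral_congr_ae (Filter.Eventually.of_forall e), h]
  rw [Complex.ofReal_mul, Real.sqrt_eq_rpow, Complex.ofReal_cpow Real.pi_pos.le, Complex.ofReal_exp]
  congr 1
  · simp
  · congr 1
    push_cast
    ring

/-- The derivative of e^{2ips} s^l e^{-s²} integrates to zero. For l = 0 the truncated index l - 1
is harmless, as its coefficient vanishes. -/
theorem gaussMoment_succ (l : ℕ) (p : ℝ) :
    gaussMoment (l + 1) p =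
      (l : ℂ) / 2 * gaussMoment (l - 1) p + Complex.I * p * gaussMoment l p := by
  have hd : ∀ s : ℝ, HasDerivAt
      (fun s : ℝ => osc₁ p s * ((s ^ l * Real.exp (-s ^ 2) : ℝ) : ℂ))
      ((l : ℂ) * (osc₁ p s * ((s ^ (l - 1) * Real.exp (-s ^ 2) : ℝ) : ℂ)) +
        2 * Complex.I * p * (osc₁ p s * ((s ^ l * Real.exp (-s ^ 2) : ℝ) : ℂ)) -
        2 * (osc₁ p s * ((s ^ (l + 1) * Real.exp (-s ^ 2) : ℝ) : ℂ))) s := by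
    intro s
    have h1 : HasDerivAt (fun s : ℝ => osc₁ p s) (osc₁ p s * (2 * p * Complex.I)) s := by
      have h2 : HasDerivAt (fun s : ℝ => (2 * (p * s) : ℝ)) (2 * p) s := by
        simpa using ((hasDerivAt_id s).const_mul p).const_mul 2
      have h3 := (h2.ofReal_comp.mul_const Complex.I).cexp
      refine h3.congr_deriv ?_
      rw [osc₁]
      push_cast
      ring
    have h4 : HasDerivAt (fun s : ℝ => s ^ l * Real.exp (-s ^ 2))
        (l * s ^ (l - 1) * Real.exp (-s ^ 2) + s ^ l * (Real.exp (-s ^ 2) * (-(2 * s)))) s := by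
      have h5 : HasDerivAt (fun s : ℝ => -s ^ 2) (-(2 * s)) s := by
        simpa using (hasDerivAt_pow 2 s).fun_neg
      exact (hasDerivAt_pow l s).mul h5.exp
    refine (h1.mul h4.ofReal_comp).congr_deriv ?_
    push_cast
    ring
  have hi := fun l => integrable_gaussMoment_integrand l p
  have i1 := (hi (l - 1)).const_mul (l : ℂ)
  have i2 := (hi l).const_mul (2 * Complex.I * p)
  have i3 := (hi (l + 1)).const_mul (2 : ℂ)
  have i4 : Integrable fun s : ℝ =>
      (l : ℂ) * (osc₁ p s * ((s ^ (l - 1) * Real.exp (-s ^ 2) : ℝ) : ℂ)) +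
        2 * Complex.I * p * (osc₁ p s * ((s ^ l * Real.exp (-s ^ 2) : ℝ) : ℂ)) := i1.add i2
  have h := integral_eq_zero_of_hasDerivAt_of_integrable hd (i4.sub i3) (hi l)
  rw [integral_sub i4 i3, integral_add i1 i2, integral_const_mul, integral_const_mul,
    integral_const_mul] at h
  change (l : ℂ) * gaussMoment (l - 1) p + 2 * Complex.I * p * gaussMoment l p -
    2 * gaussMoment (l + 1) p = 0 at h
  linear_combination (-1 / 2) * h

/-- The recursion has two steps and multiplies by p, so the induction carries two consecutive l and
all powers k at once. -/
theorem integrable_pow_mul_gaussMoment (l k : ℕ) :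
    Integrable fun p : ℝ => (p : ℂ) ^ k * gaussMoment l p := by
  have h0 : ∀ k : ℕ, Integrable fun p : ℝ => (p : ℂ) ^ k * gaussMoment 0 p := by
    intro k
    refine ((integrable_pow_mul_exp_neg_sq k).const_mul (Real.sqrt Real.pi)).ofReal.congr
      (Filter.Eventually.of_forall fun p => ?_)
    simp only [gaussMoment_zero]
    exact (by push_cast; ring : ((Real.sqrt Real.pi * (p ^ k * Real.exp (-p ^ 2)) : ℝ) : ℂ) =
      (p : ℂ) ^ k * ((Real.sqrt Real.pi * Real.exp (-p ^ 2) : ℝ) : ℂ))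
  have h1 : ∀ k : ℕ, Integrable fun p : ℝ => (p : ℂ) ^ k * gaussMoment 1 p := by
    intro k
    refine ((h0 (k + 1)).const_mul Complex.I).congr (Filter.Eventually.of_forall fun p => ?_)
    simp only [gaussMoment_succ 0 p]
    push_cast
    ring
  suffices h : (∀ k : ℕ, Integrable fun p : ℝ => (p : ℂ) ^ k * gaussMoment l p) ∧
      ∀ k : ℕ, Integrable fun p : ℝ => (p : ℂ) ^ k * gaussMoment (l + 1) p from h.1 k
  induction l with
  | zero => exact ⟨h0, h1⟩
  | succ l ih =>
    refine ⟨ih.2, fun k => ?_⟩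
    refine (((ih.1 k).const_mul (((l + 1 : ℕ) : ℂ) / 2)).add
      ((ih.2 (k + 1)).const_mul Complex.I)).congr (Filter.Eventually.of_forall fun p => ?_)
    simp only [Pi.add_apply, gaussMoment_succ (l + 1) p, Nat.add_sub_cancel]
    ring

/-- The one-mode cross Wigner function of two number states, up to normalization. -/
def hermiteWigner (j k : ℕ) (x p : ℝ) : ℂ :=
  ∫ s : ℝ, osc₁ p s * ((hermiteFun j (x + s) * hermiteFun k (x - s) : ℝ) : ℂ)

/-- The Gaussians at x + s and x - s multiply to e^{-x²} e^{-s²}. The polynomial factor is then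
sorted by powers of s, which separates the dependence on x from that on p and makes integrability
visible. -/
theorem exists_hermiteWigner_eq (j k : ℕ) : ∃ (L : ℕ) (q : ℕ → Polynomial ℝ), ∀ x p,
    hermiteWigner j k x p = ∑ l ∈ Finset.range L,
      (((q l).eval x * Real.exp (-(1 * x ^ 2)) : ℝ) : ℂ) * gaussMoment l p := by
  -- A polynomial in s (outer variable) with coefficients in x (inner variable); ε = ±1 selects the
  -- argument x ± s.
  set P : ℕ → ℝ → Polynomial (Polynomial ℝ) := fun n ε =>
    (realHermite n).eval₂ (Polynomial.C.comp Polynomial.C)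
      (Polynomial.C (Polynomial.C (Real.sqrt 2)) *
        (Polynomial.C Polynomial.X + Polynomial.C (Polynomial.C ε) * Polynomial.X)) with hP
  have hev : ∀ n ε x s, (P n ε).evalEval x s = (realHermite n).eval (Real.sqrt 2 * (x + ε * s)) := by
    intro n ε x s
    rw [← Polynomial.coe_evalEvalRingHom, hP]
    simp only
    rw [Polynomial.hom_eval₂, Polynomial.eval]
    congr 1
    · ext y; simp
    · simp
  set Q : Polynomial (Polynomial ℝ) := P j 1 * P k (-1) with hQ
  set c : ℝ := (Real.pi ^ (1 / 4 : ℝ))⁻¹ * (Real.sqrt (j.factorial : ℝ))⁻¹ *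
    ((Real.pi ^ (1 / 4 : ℝ))⁻¹ * (Real.sqrt (k.factorial : ℝ))⁻¹) with hc
  have hprod : ∀ x s, hermiteFun j (x + s) * hermiteFun k (x - s) =
      ∑ l ∈ Finset.range (Q.natDegree + 1), (Polynomial.C c * Q.coeff l).eval x *
        Real.exp (-(1 * x ^ 2)) * (s ^ l * Real.exp (-s ^ 2)) := by
    intro x s
    have h1 : Q.evalEval x s = ∑ l ∈ Finset.range (Q.natDegree + 1), (Q.coeff l).eval x * s ^ l := by
      rw [Polynomial.evalEval, Polynomial.eval_eq_sum_range (p := Q), Polynomial.eval_finsetSum]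
      simp
    have h2 : Q.evalEval x s = (realHermite j).eval (Real.sqrt 2 * (x + s)) *
        (realHermite k).eval (Real.sqrt 2 * (x - s)) := by
      rw [hQ, Polynomial.evalEval_mul, hev, hev]
      congr 3 <;> ring
    have h3 : Real.exp (-(1 / 2 * (x + s) ^ 2)) * Real.exp (-(1 / 2 * (x - s) ^ 2)) =
        Real.exp (-(1 * x ^ 2)) * Real.exp (-s ^ 2) := by
      rw [← Real.exp_add, ← Real.exp_add]
      congr 1
      ring
    rw [hermiteFun_eq, hermiteFun_eq]
    calc _ = c * Q.evalEval x s * (Real.exp (-(1 * x ^ 2)) * Real.exp (-s ^ 2)) := by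
          rw [h2, ← h3, hc]; ring
      _ = _ := by
          rw [h1, Finset.mul_sum, Finset.sum_mul]
          refine Finset.sum_congr rfl fun l _ => ?_
          rw [Polynomial.eval_mul, Polynomial.eval_C]
          ring
  refine ⟨Q.natDegree + 1, fun l => Polynomial.C c * Q.coeff l, fun x p => ?_⟩
  have e : ∀ s, osc₁ p s * ((hermiteFun j (x + s) * hermiteFun k (x - s) : ℝ) : ℂ) =
      ∑ l ∈ Finset.range (Q.natDegree + 1),
        (((Polynomial.C c * Q.coeff l).eval x * Real.exp (-(1 * x ^ 2)) : ℝ) : ℂ) *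
          (osc₁ p s * ((s ^ l * Real.exp (-s ^ 2) : ℝ) : ℂ)) := by
    intro s
    rw [hprod, Complex.ofReal_sum, Finset.mul_sum]
    refine Finset.sum_congr rfl fun l _ => ?_
    rw [Complex.ofReal_mul _ (s ^ l * _)]
    ring
  rw [hermiteWigner, integral_congr_ae (Filter.Eventually.of_forall e), integral_finsetSum]
  · exact Finset.sum_congr rfl fun l _ => integral_const_mul _ _
  · exact fun l _ => (integrable_gaussMoment_integrand l p).const_mul _

theorem integrable_hermiteWigner (j k : ℕ) :
    Integrable fun z : ℝ × ℝ => hermiteWigner j k z.1 z.2 := by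
  obtain ⟨L, q, h⟩ := exists_hermiteWigner_eq j k
  simp only [h]
  refine integrable_finsetSum _ fun l _ => ?_
  have h1 := (integrable_polynomial_mul_exp_neg_mul_sq (q l) one_pos).ofReal (𝕜 := ℂ)
  have h2 : Integrable (gaussMoment l) := by simpa using integrable_pow_mul_gaussMoment l 0
  exact h1.mul_prod h2

theorem integrable_hermiteWigner_right (j k : ℕ) (x : ℝ) :
    Integrable fun p => hermiteWigner j k x p := by
  obtain ⟨L, q, h⟩ := exists_hermiteWigner_eq j k
  simp only [h]
  refine integrable_finsetSum _ fun l _ => ?_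
  have h2 : Integrable (gaussMoment l) := by simpa using integrable_pow_mul_gaussMoment l 0
  exact h2.const_mul _

variable {m : ℕ}

theorem inner_fock_dparity_fock (j k : Fin m → ℕ) (z : PhaseSpace m) :
    ⟪fock j, dparity z (fock k)⟫_ℂ = ∏ i, hermiteWigner (j i) (k i) (z.1 i) (z.2 i) := by
  rw [inner_dparity, oscFT_congr (corr_congr (fock_coeFn j) (fock_coeFn k) z.1), oscFT]
  simp only [hermiteWigner]
  rw [← integral_fintype_prod_volume_eq_prod]
  refine integral_congr_ae (Filter.Eventually.of_forall fun s => ?_)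
  have e : osc z.2 s = ∏ i, osc₁ (z.2 i) (s i) := by
    simp only [osc, osc₁]
    rw [← Complex.exp_sum, ← Finset.sum_mul, ← Complex.ofReal_sum, Finset.mul_sum]
  simp only [corr, conj_fockFun, e]
  rw [fockFun, fockFun, ← Finset.prod_mul_distrib, ← Finset.prod_mul_distrib]
  refine Finset.prod_congr rfl fun i _ => ?_
  simp

theorem integrable_inner_fock_dparity (j k : Fin m → ℕ) :
    Integrable fun z : PhaseSpace m => ⟪fock j, dparity z (fock k)⟫_ℂ := by
  simp only [inner_fock_dparity_fock]
  have h := Integrable.fintype_prod (𝕜 := ℂ) (E := ℝ × ℝ) (μ := fun _ : Fin m => volume)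
    (f := fun i z => hermiteWigner (j i) (k i) z.1 z.2)
    fun i => integrable_hermiteWigner (j i) (k i)
  exact ((volume_measurePreserving_arrowProdEquivProdArrow ℝ ℝ (Fin m)).integrable_comp_emb
    (MeasurableEquiv.arrowProdEquivProdArrow ℝ ℝ (Fin m)).measurableEmbedding).1 h

theorem integrable_inner_fock_dparity_right (j k : Fin m → ℕ) (x : Fin m → ℝ) :
    Integrable fun p => ⟪fock j, dparity (x, p) (fock k)⟫_ℂ := by
  simp only [inner_fock_dparity_fock]
  exact Integrable.fintype_prod (𝕜 := ℂ) (E := ℝ) (μ := fun _ : Fin m => volume)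
    (f := fun i p => hermiteWigner (j i) (k i) (x i) p)
    fun i => integrable_hermiteWigner_right (j i) (k i) (x i)

end

section

/-! ### Phase space integrals -/

variable {m : ℕ}

/-- A composition of shears and swaps, hence of Jacobian one. The second coordinate is (s - x)/2 for
z = (x, s); rescaling it by -2 gives x - s and accounts for the factor 2^{-m} in the change of
variables to x + s and x - s. -/
theorem measurePreserving_add_half_sub :
    MeasurePreserving (fun z : PhaseSpace m => (z.1 + z.2, z.2 - (1 / 2 : ℝ) • (z.1 + z.2)))
      volume volume := by
  have h1 : MeasurePreserving (fun z : PhaseSpace m => (z.1, z.2 + z.1)) volume volume :=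
    (MeasurePreserving.id volume).skew_product (g := fun s x => x + s) (by fun_prop)
      (Filter.Eventually.of_forall fun s => map_add_right_eq_self volume s)
  have h2 : MeasurePreserving (fun z : PhaseSpace m => (z.1, z.2 - (1 / 2 : ℝ) • z.1))
      volume volume :=
    (MeasurePreserving.id volume).skew_product (g := fun y s => s - (1 / 2 : ℝ) • y) (by fun_prop)
      (Filter.Eventually.of_forall fun y =>
        (measurePreserving_sub_right volume ((1 / 2 : ℝ) • y)).map_eq)
  have h3 : MeasurePreserving (Prod.swap : PhaseSpace m → PhaseSpace m) volume volume :=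
    Measure.measurePreserving_swap
  convert h2.comp (h3.comp (h1.comp h3)) using 2 with z
  simp [add_comm z.1]

section AddSub

variable {𝕜 : Type*} [RCLike 𝕜] {a b : (Fin m → ℝ) → 𝕜}

theorem integral_comp_two_smul {E : Type*} [NormedAddCommGroup E] [NormedSpace ℝ E]
    (f : (Fin m → ℝ) → E) : ∫ x, f ((2 : ℝ) • x) = ((2 : ℝ) ^ m)⁻¹ • ∫ x, f x := by
  rw [Measure.integral_comp_smul, abs_of_nonneg (by positivity)]
  simp

theorem integrable_mul_comp_add_sub (ha : Integrable a) (hb : Integrable b) :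
    Integrable fun z : PhaseSpace m => a (z.1 + z.2) * b (z.1 - z.2) := by
  have hd : Integrable fun w => b ((-2 : ℝ) • w) := hb.comp_smul (by norm_num)
  refine (measurePreserving_add_half_sub.integrable_comp_of_integrable
    (ha.mul_prod hd)).congr (Filter.Eventually.of_forall fun z => ?_)
  simp only [Function.comp_apply]
  congr 2
  module

theorem integral_mul_comp_add_sub (ha : Integrable a) (hb : Integrable b) :
    ∫ z : PhaseSpace m, a (z.1 + z.2) * b (z.1 - z.2) =
      (((2 : ℝ) ^ m)⁻¹ : ℝ) • ((∫ x, a x) * ∫ x, b x) := by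
  have hd : Integrable fun w => b ((-2 : ℝ) • w) := hb.comp_smul (by norm_num)
  have hT := measurePreserving_add_half_sub (m := m)
  have h := integral_map (f := fun z : PhaseSpace m => a z.1 * b ((-2 : ℝ) • z.2))
    hT.measurable.aemeasurable (by rw [hT.map_eq]; exact (ha.mul_prod hd).aestronglyMeasurable)
  have e : ∀ z : PhaseSpace m, a (z.1 + z.2) * b ((-2 : ℝ) • (z.2 - (1 / 2 : ℝ) • (z.1 + z.2))) =
      a (z.1 + z.2) * b (z.1 - z.2) := by
    intro z
    congr 2
    module
  simp only [e] at h
  rw [← h, hT.map_eq, Measure.volume_eq_prod,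
    integral_prod_mul (L := 𝕜) a fun w => b ((-2 : ℝ) • w), Measure.integral_comp_smul]
  simp

end AddSub

/-! ### Cross Wigner functions over phase space -/

theorem integrable_corr (u w : ModeSpace m) (x : Fin m → ℝ) : Integrable (corr u w x) := by
  have h1 := ((Lp.memLp u).comp_measurePreserving (measurePreserving_add_left volume x)).star
  have h2 := (Lp.memLp w).comp_measurePreserving (Measure.measurePreserving_sub_left volume x)
  exact h1.integrable_mul h2

theorem continuous_fockFun (n : Fin m → ℕ) : Continuous (fockFun n) := by
  unfold fockFun
  exact continuous_finsetProd _ fun j _ =>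
    Complex.continuous_ofReal.comp ((continuous_hermiteFun (n j)).comp (continuous_apply j))

theorem continuous_corr {u w : (Fin m → ℝ) → ℂ} (hu : Continuous u) (hw : Continuous w)
    (x : Fin m → ℝ) : Continuous (corr u w x) := by
  unfold corr
  exact (Complex.continuous_conj.comp (hu.comp (by fun_prop))).mul (hw.comp (by fun_prop))

theorem corr_fock_ae (j k : Fin m → ℕ) (x : Fin m → ℝ) :
    corr (fock j) (fock k) x =ᵐ[volume] corr (fockFun j) (fockFun k) x :=
  corr_congr (fock_coeFn j) (fock_coeFn k) x

theorem integrable_corr_fockFun (j k : Fin m → ℕ) (x : Fin m → ℝ) :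
    Integrable (corr (fockFun j) (fockFun k) x) :=
  (integrable_corr _ _ x).congr (corr_fock_ae j k x)

theorem inner_fock_dparity_eq (j k : Fin m → ℕ) (x p : Fin m → ℝ) :
    ⟪fock j, dparity (x, p) (fock k)⟫_ℂ = oscFT (corr (fockFun j) (fockFun k) x) p := by
  rw [inner_dparity, oscFT_congr (corr_fock_ae j k x)]

theorem integrable_oscFT_corr_fockFun (j k : Fin m → ℕ) (x : Fin m → ℝ) :
    Integrable (oscFT (corr (fockFun j) (fockFun k) x)) := by
  simpa only [inner_fock_dparity_eq] using integrable_inner_fock_dparity_right j k x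

/-- Integrating over p evaluates the correlation function at s = 0 by Fourier inversion, and
integrating over x leaves the inner product. This is what gives the identity the symbol 1. -/
theorem integral_inner_fock_dparity (j k : Fin m → ℕ) :
    ∫ z : PhaseSpace m, ⟪fock j, dparity z (fock k)⟫_ℂ =
      (Real.pi ^ m : ℝ) * if j = k then 1 else 0 := by
  rw [Measure.volume_eq_prod, integral_prod _ (integrable_inner_fock_dparity j k)]
  simp only [inner_fock_dparity_eq]
  have e : ∀ x : Fin m → ℝ, ∫ p, oscFT (corr (fockFun j) (fockFun k) x) p =
      (Real.pi ^ m : ℝ) * (starRingEnd ℂ (fockFun j x) * fockFun k x) := by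
    intro x
    rw [integral_oscFT (continuous_corr (continuous_fockFun j) (continuous_fockFun k) x)
      (integrable_corr_fockFun j k x) (integrable_oscFT_corr_fockFun j k x)]
    simp [corr]
  simp only [e]
  rw [integral_const_mul, ← inner_fock_fock, fock, fock, inner_toLp_toLp]

theorem integrable_mul_inner_fock_dparity {f : PhaseSpace m → ℂ} {C : ℝ}
    (hf : AEStronglyMeasurable f) (hC : ∀ z, ‖f z‖ ≤ C) (j k : Fin m → ℕ) :
    Integrable fun z : PhaseSpace m => f z * ⟪fock j, dparity z (fock k)⟫_ℂ :=
  (integrable_inner_fock_dparity j k).bdd_mul hf (Filter.Eventually.of_forall hC)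

/-- Moyal's identity. -/
theorem integral_conj_inner_dparity_mul (u w : ModeSpace m) (j k : Fin m → ℕ) :
    ∫ z : PhaseSpace m, starRingEnd ℂ ⟪u, dparity z w⟫_ℂ * ⟪fock j, dparity z (fock k)⟫_ℂ =
      ((Real.pi / 2) ^ m : ℝ) * (⟪fock j, u⟫_ℂ * ⟪w, fock k⟫_ℂ) := by
  have hi := integrable_mul_inner_fock_dparity (C := ‖u‖ * ‖w‖)
    (Complex.continuous_conj.comp_stronglyMeasurable
      (stronglyMeasurable_inner_dparity u w)).aestronglyMeasurable
    (fun z => by rw [RCLike.norm_conj]; exact norm_inner_dparity_le u w z) j k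
  have ha : Integrable fun q => starRingEnd ℂ (fockFun j q) * u q := by
    refine (L2.integrable_inner (𝕜 := ℂ) (fock j) u).congr ?_
    filter_upwards [fock_coeFn j] with q h
    rw [h, RCLike.inner_apply, mul_comm]
  have hb : Integrable fun q => starRingEnd ℂ (w q) * fockFun k q :=
    integrable_conj_mul w (memLp_fockFun k)
  rw [Measure.volume_eq_prod, integral_prod _ hi]
  -- Parseval in p for fixed x produces a product of a function of x + s and a function of x - s, so
  -- the integral over (x, s) splits into two inner products.
  have e : ∀ x : Fin m → ℝ, ∫ p, starRingEnd ℂ ⟪u, dparity (x, p) w⟫_ℂ *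
      ⟪fock j, dparity (x, p) (fock k)⟫_ℂ = (Real.pi ^ m : ℝ) * ∫ s,
        (starRingEnd ℂ (fockFun j (x + s)) * u (x + s)) *
          (starRingEnd ℂ (w (x - s)) * fockFun k (x - s)) := by
    intro x
    simp only [inner_dparity u w, inner_fock_dparity_eq]
    rw [integral_conj_oscFT_mul_oscFT (integrable_corr u w x)
      (continuous_corr (continuous_fockFun j) (continuous_fockFun k) x)
      (integrable_corr_fockFun j k x) (integrable_oscFT_corr_fockFun j k x)]
    congr 1
    refine integral_congr_ae (Filter.Eventually.of_forall fun s => ?_)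
    simp only [corr, map_mul, Complex.conj_conj]
    ring
  simp only [e]
  have h2 := integral_mul_comp_add_sub ha hb
  rw [Measure.volume_eq_prod, integral_prod _ (integrable_mul_comp_add_sub ha hb)] at h2
  rw [integral_const_mul, h2]
  have e1 : ⟪fock j, u⟫_ℂ = ∫ q, starRingEnd ℂ (fockFun j q) * u q := by
    rw [L2.inner_def]
    refine integral_congr_ae ?_
    filter_upwards [fock_coeFn j] with q h
    rw [h, RCLike.inner_apply, mul_comm]
  have e2 : ⟪w, fock k⟫_ℂ = ∫ q, starRingEnd ℂ (w q) * fockFun k q :=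
    inner_toLp_right w (memLp_fockFun k)
  rw [← e1, ← e2, Complex.real_smul, ← mul_assoc, ← Complex.ofReal_mul, div_pow, div_eq_mul_inv]

/-! ### The fourth moment of a Wigner function -/

theorem sq_integral_mul_le {α β : (Fin m → ℝ) → ℝ} (hα : Integrable fun t => α t ^ 2)
    (hβ : Integrable fun t => β t ^ 2) (hαβ : Integrable fun t => α t * β t) :
    (∫ t, α t * β t) ^ 2 ≤ (∫ t, α t ^ 2) * ∫ t, β t ^ 2 := by
  have h : ∀ r : ℝ, 0 ≤ (∫ t, β t ^ 2) * (r * r) + (2 * ∫ t, α t * β t) * r + ∫ t, α t ^ 2 := by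
    intro r
    have h1 : 0 ≤ ∫ t, (α t + r * β t) ^ 2 := integral_nonneg fun t => sq_nonneg _
    have h2 : ∫ t, (α t + r * β t) ^ 2 =
        ∫ t, ((r * r) * β t ^ 2 + (2 * r) * (α t * β t) + α t ^ 2) :=
      integral_congr_ae (Filter.Eventually.of_forall fun t => by ring)
    have i1 : Integrable fun t => (r * r) * β t ^ 2 := hβ.const_mul _
    have i2 : Integrable fun t => (2 * r) * (α t * β t) := hαβ.const_mul _
    have i3 : Integrable fun t => (r * r) * β t ^ 2 + (2 * r) * (α t * β t) := i1.add i2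
    rw [h2, integral_add i3 hα, integral_add i1 i2, integral_const_mul, integral_const_mul] at h1
    linarith
  have := discrim_le_zero h
  rw [discrim] at this
  nlinarith

local notation:67 f " ⋆ᵣ " g => convolution f g (ContinuousLinearMap.mul ℝ ℝ) volume
local notation:67 f " ⋆ᵪ " g => convolution f g (ContinuousLinearMap.mul ℂ ℂ) volume

theorem oscFT_convolution {f : (Fin m → ℝ) → ℂ} (hf : Integrable f) (p : Fin m → ℝ) :
    oscFT (f ⋆ᵪ f) p = oscFT f p ^ 2 := by
  have hg := integrable_osc_mul hf p
  have e : ∀ s, osc p s * (f ⋆ᵪ f) s = ((fun t => osc p t * f t) ⋆ᵪ fun t => osc p t * f t) s := by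
    intro s
    rw [convolution_def, convolution_def, ← integral_const_mul]
    refine integral_congr_ae (Filter.Eventually.of_forall fun t => ?_)
    have : osc p s = osc p t * osc p (s - t) := by rw [← osc_add, add_sub_cancel]
    simp only [ContinuousLinearMap.mul_apply', this]
    ring
  rw [oscFT]
  simp only [e]
  rw [integral_convolution _ hg hg, ContinuousLinearMap.mul_apply', sq, oscFT]

section FourthMoment

variable {v : (Fin m → ℝ) → ℂ} {B : ℝ}

theorem integrable_corr_of_bounded (hc : Continuous v) (hB : ∀ q, ‖v q‖ ≤ B) (hi : Integrable v)
    (x : Fin m → ℝ) : Integrable (corr v v x) :=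
  (hi.comp_sub_left x).bdd_mul (c := B)
    (Complex.continuous_conj.comp (hc.comp (by fun_prop))).aestronglyMeasurable
    (Filter.Eventually.of_forall fun s => (RCLike.norm_conj _).trans_le (hB _))

theorem norm_corr_le (hB : ∀ q, ‖v q‖ ≤ B) (x s : Fin m → ℝ) : ‖corr v v x s‖ ≤ B ^ 2 := by
  rw [corr, norm_mul, RCLike.norm_conj, sq]
  exact mul_le_mul (hB _) (hB _) (norm_nonneg _) ((norm_nonneg _).trans (hB 0))

/-- The square of the transform of f is the transform of f ⋆ f, so an L⁴ norm becomes an L² norm by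
Parseval. -/
theorem integral_norm_oscFT_pow_four (hc : Continuous v) (hB : ∀ q, ‖v q‖ ≤ B) (hi : Integrable v)
    (x : Fin m → ℝ) (hf : Integrable (oscFT (corr v v x))) :
    ∫ p, ‖oscFT (corr v v x) p‖ ^ 4 =
      Real.pi ^ m * ∫ s, ‖(corr v v x ⋆ᵪ corr v v x) s‖ ^ 2 := by
  have hci := integrable_corr_of_bounded hc hB hi x
  set f := corr v v x with hfdef
  have hfc : Continuous f := continuous_corr hc hc x
  have hGc : Continuous (f ⋆ᵪ f) := BddAbove.continuous_convolution_right_of_integrable _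
    ⟨B ^ 2, by rintro _ ⟨s, rfl⟩; exact norm_corr_le hB x s⟩ hci hfc
  have hGi : Integrable (f ⋆ᵪ f) := hci.integrable_convolution _ hci
  have hbd : ∀ p, ‖oscFT f p‖ ≤ ∫ s, ‖f s‖ := by
    intro p
    refine (norm_integral_le_integral_norm _).trans_eq ?_
    simp only [norm_mul, norm_osc, one_mul]
  have hGf : Integrable (oscFT (f ⋆ᵪ f)) := by
    have h1 : oscFT (f ⋆ᵪ f) = fun p => oscFT f p * oscFT f p :=
      funext fun p => by rw [oscFT_convolution hci, sq]
    rw [h1]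
    exact hf.bdd_mul hf.aestronglyMeasurable (Filter.Eventually.of_forall hbd)
  have h := integral_conj_oscFT_mul_oscFT hGi hGc hGi hGf
  have e1 : ∀ p, starRingEnd ℂ (oscFT (f ⋆ᵪ f) p) * oscFT (f ⋆ᵪ f) p =
      ((‖oscFT f p‖ ^ 4 : ℝ) : ℂ) := by
    intro p
    rw [Complex.conj_mul', oscFT_convolution hci, norm_pow]
    push_cast
    ring
  have e2 : ∀ s, starRingEnd ℂ ((f ⋆ᵪ f) s) * (f ⋆ᵪ f) s =
      ((‖(f ⋆ᵪ f) s‖ ^ 2 : ℝ) : ℂ) := by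
    intro s
    rw [Complex.conj_mul']
    push_cast
    rfl
  simp only [e1, e2] at h
  rw [integral_complex_ofReal, integral_complex_ofReal, ← Complex.ofReal_mul] at h
  exact Complex.ofReal_injective h

theorem integrable_norm_sq_of_bounded (hc : Continuous v) (hB : ∀ q, ‖v q‖ ≤ B)
    (hi : Integrable v) : Integrable fun q => ‖v q‖ ^ 2 := by
  simp only [sq]
  exact hi.norm.bdd_mul (c := B) hc.norm.aestronglyMeasurable
    (Filter.Eventually.of_forall fun q => by simpa using hB q)

/-- The integrand is a product of four values of v. Those at x + t and x + s - t have arguments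
summing to 2x + s, those at x - t and x - s + t to 2x - s. Cauchy–Schwarz between these two pairs
yields two autoconvolutions of |v|². -/
theorem norm_convolution_corr_sq_le (hc : Continuous v) (hB : ∀ q, ‖v q‖ ≤ B) (hi : Integrable v)
    (x s : Fin m → ℝ) :
    ‖(corr v v x ⋆ᵪ corr v v x) s‖ ^ 2 ≤
      ((fun q => ‖v q‖ ^ 2) ⋆ᵣ fun q => ‖v q‖ ^ 2) ((2 : ℝ) • x + s) *
        ((fun q => ‖v q‖ ^ 2) ⋆ᵣ fun q => ‖v q‖ ^ 2) ((2 : ℝ) • x - s) := by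
  have hk := integrable_norm_sq_of_bounded hc hB hi
  have hkc : Continuous fun q => ‖v q‖ ^ 2 := hc.norm.pow 2
  have hkB : ∀ q, ‖‖v q‖ ^ 2‖ ≤ B ^ 2 := fun q => by
    rw [norm_pow, norm_norm]
    exact pow_le_pow_left₀ (norm_nonneg _) (hB q) 2
  set α : (Fin m → ℝ) → ℝ := fun t => ‖v (x + t)‖ * ‖v (x + s - t)‖ with hα
  set β : (Fin m → ℝ) → ℝ := fun t => ‖v (x - t)‖ * ‖v (x - s + t)‖ with hβ
  have iα : Integrable fun t => α t ^ 2 := by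
    simp only [hα, mul_pow]
    exact (hk.comp_sub_left (x + s)).bdd_mul (hkc.comp (by fun_prop)).aestronglyMeasurable
      (Filter.Eventually.of_forall fun t => hkB _)
  have iβ : Integrable fun t => β t ^ 2 := by
    simp only [hβ, mul_pow]
    exact (hk.comp_add_left (x - s)).bdd_mul (hkc.comp (by fun_prop)).aestronglyMeasurable
      (Filter.Eventually.of_forall fun t => hkB _)
  have hcα : Continuous α := by
    have := hc.norm
    exact (this.comp (by fun_prop)).mul (this.comp (by fun_prop))
  have hcβ : Continuous β := by
    have := hc.norm
    exact (this.comp (by fun_prop)).mul (this.comp (by fun_prop))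
  have iαβ : Integrable fun t => α t * β t := by
    refine (iα.add iβ).mono (hcα.mul hcβ).aestronglyMeasurable
      (Filter.Eventually.of_forall fun t => ?_)
    have h1 : 0 ≤ α t := mul_nonneg (norm_nonneg _) (norm_nonneg _)
    have h2 : 0 ≤ β t := mul_nonneg (norm_nonneg _) (norm_nonneg _)
    simp only [Pi.add_apply, Real.norm_eq_abs]
    rw [abs_of_nonneg (mul_nonneg h1 h2), abs_of_nonneg (by positivity)]
    nlinarith [sq_nonneg (α t - β t)]
  have hα2 : ∫ t, α t ^ 2 = ((fun q => ‖v q‖ ^ 2) ⋆ᵣ fun q => ‖v q‖ ^ 2) ((2 : ℝ) • x + s) := by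
    rw [convolution_def]
    refine Eq.trans (integral_congr_ae (Filter.Eventually.of_forall fun t => ?_))
      (integral_add_left_eq_self _ x)
    simp only [hα, mul_pow, ContinuousLinearMap.mul_apply']
    rw [show (2 : ℝ) • x + s - (x + t) = x + s - t by module]
  have hβ2 : ∫ t, β t ^ 2 = ((fun q => ‖v q‖ ^ 2) ⋆ᵣ fun q => ‖v q‖ ^ 2) ((2 : ℝ) • x - s) := by
    rw [convolution_def]
    refine Eq.trans (integral_congr_ae (Filter.Eventually.of_forall fun t => ?_))
      (integral_sub_left_eq_self _ volume x)
    simp only [hβ, mul_pow, ContinuousLinearMap.mul_apply']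
    rw [show (2 : ℝ) • x - s - (x - t) = x - s + t by module]
  have hle : ‖(corr v v x ⋆ᵪ corr v v x) s‖ ≤ ∫ t, α t * β t := by
    rw [convolution_def]
    refine (norm_integral_le_integral_norm _).trans_eq
      (integral_congr_ae (Filter.Eventually.of_forall fun t => ?_))
    simp only [ContinuousLinearMap.mul_apply', corr, norm_mul, RCLike.norm_conj, hα, hβ]
    rw [show x + (s - t) = x + s - t by abel, show x - (s - t) = x - s + t by abel]
    ring
  rw [← hα2, ← hβ2]
  exact (pow_le_pow_left₀ (norm_nonneg _) hle 2).trans (sq_integral_mul_le iα iβ iαβ)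

/-- The sharp `L⁴` bound for Wigner functions of pure states. -/
theorem integral_norm_oscFT_corr_pow_four_le (hc : Continuous v) (hB : ∀ q, ‖v q‖ ≤ B)
    (hi : Integrable v) (hf : ∀ x, Integrable (oscFT (corr v v x)))
    (hint : Integrable fun z : PhaseSpace m => ‖oscFT (corr v v z.1) z.2‖ ^ 4) :
    ∫ z : PhaseSpace m, ‖oscFT (corr v v z.1) z.2‖ ^ 4 ≤
      (Real.pi / 4) ^ m * (∫ q, ‖v q‖ ^ 2) ^ 4 := by
  have hk := integrable_norm_sq_of_bounded hc hB hi
  have hkc : Continuous fun q => ‖v q‖ ^ 2 := hc.norm.pow 2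
  have hkB : ∀ q, ‖‖v q‖ ^ 2‖ ≤ B ^ 2 := fun q => by
    rw [norm_pow, norm_norm]
    exact pow_le_pow_left₀ (norm_nonneg _) (hB q) 2
  set k : (Fin m → ℝ) → ℝ := fun q => ‖v q‖ ^ 2 with hkdef
  have hKc : Continuous (k ⋆ᵣ k) := BddAbove.continuous_convolution_right_of_integrable _
    ⟨B ^ 2, by rintro _ ⟨s, rfl⟩; exact hkB s⟩ hk hkc
  have hKi : Integrable (k ⋆ᵣ k) := hk.integrable_convolution _ hk
  have hKB : ∀ q, ‖(k ⋆ᵣ k) q‖ ≤ ∫ t, B ^ 2 * ‖k t‖ := by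
    intro q
    rw [convolution_def]
    refine norm_integral_le_of_norm_le (hk.norm.const_mul _)
      (Filter.Eventually.of_forall fun t => ?_)
    rw [ContinuousLinearMap.mul_apply', norm_mul, mul_comm]
    exact mul_le_mul_of_nonneg_right (hkB _) (norm_nonneg _)
  have hin : ∀ x, Integrable fun s => (k ⋆ᵣ k) (x + s) * (k ⋆ᵣ k) (x - s) := fun x =>
    (hKi.comp_sub_left x).bdd_mul (hKc.comp (by fun_prop)).aestronglyMeasurable
      (Filter.Eventually.of_forall fun t => hKB _)
  have hprod := integrable_mul_comp_add_sub hKi hKi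
  have hH : Integrable fun x => ∫ s, (k ⋆ᵣ k) (x + s) * (k ⋆ᵣ k) (x - s) :=
    hprod.integral_prod_left
  have hHint : ∫ x, ∫ s, (k ⋆ᵣ k) (x + s) * (k ⋆ᵣ k) (x - s) =
      ((2 : ℝ) ^ m)⁻¹ * (∫ q, k q) ^ 4 := by
    have h1 := integral_mul_comp_add_sub hKi hKi
    rw [Measure.volume_eq_prod, integral_prod _ hprod, integral_convolution _ hk hk,
      ContinuousLinearMap.mul_apply', smul_eq_mul] at h1
    rw [h1]
    ring
  rw [Measure.volume_eq_prod, integral_prod _ hint]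
  -- After the pointwise bound the integral factorizes: 2^{-m} from the scaling 2x, another 2^{-m}
  -- from the variables x ± s, and the total mass of |v|² to the fourth power.
  have hle : ∫ x, ∫ p, ‖oscFT (corr v v x) p‖ ^ 4 ≤
      ∫ x, Real.pi ^ m * ∫ s, (k ⋆ᵣ k) ((2 : ℝ) • x + s) * (k ⋆ᵣ k) ((2 : ℝ) • x - s) := by
    refine integral_mono_of_nonneg
      (Filter.Eventually.of_forall fun x => integral_nonneg fun p => by positivity)
      ((hH.comp_smul two_ne_zero).const_mul _) (Filter.Eventually.of_forall fun x => ?_)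
    simp only
    rw [integral_norm_oscFT_pow_four hc hB hi x (hf x)]
    refine mul_le_mul_of_nonneg_left ?_ (by positivity)
    exact integral_mono_of_nonneg (Filter.Eventually.of_forall fun s => by positivity) (hin _)
      (Filter.Eventually.of_forall fun s => norm_convolution_corr_sq_le hc hB hi x s)
  refine hle.trans_eq ?_
  rw [integral_const_mul,
    integral_comp_two_smul fun x => ∫ s, (k ⋆ᵣ k) (x + s) * (k ⋆ᵣ k) (x - s), hHint, smul_eq_mul,
    ← mul_assoc, ← mul_assoc, mul_assoc (Real.pi ^ m), ← mul_inv, ← mul_pow, div_pow,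
    div_eq_mul_inv]
  norm_num

end FourthMoment

end

section

/-! ### Finite superpositions of number states -/

variable {m : ℕ}

theorem exists_polynomial_mul_exp_le (P : Polynomial ℝ) :
    ∃ C : ℝ, ∀ x : ℝ, |P.eval x * Real.exp (-(1 / 2 * x ^ 2))| ≤ C := by
  induction P using Polynomial.induction_on' with
  | add P Q hP hQ =>
    obtain ⟨C, hC⟩ := hP
    obtain ⟨D, hD⟩ := hQ
    refine ⟨C + D, fun x => ?_⟩
    rw [Polynomial.eval_add, add_mul]
    exact (abs_add_le _ _).trans (add_le_add (hC x) (hD x))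
  | monomial k a =>
    refine ⟨|a| * (k.factorial * Real.exp (1 / 2)), fun x => ?_⟩
    rw [Polynomial.eval_monomial, mul_assoc, abs_mul]
    refine mul_le_mul_of_nonneg_left ?_ (abs_nonneg a)
    rw [abs_mul, abs_pow, Real.abs_exp]
    have h1 : |x| ^ k ≤ k.factorial * Real.exp |x| := by
      have := Real.pow_div_factorial_le_exp |x| (abs_nonneg x) k
      rwa [div_le_iff₀ (by positivity), mul_comm] at this
    have h2 : Real.exp |x| * Real.exp (-(1 / 2 * x ^ 2)) ≤ Real.exp (1 / 2) := by
      rw [← Real.exp_add]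
      refine Real.exp_le_exp.2 ?_
      nlinarith [sq_nonneg (|x| - 1), sq_abs x]
    calc _ ≤ k.factorial * Real.exp |x| * Real.exp (-(1 / 2 * x ^ 2)) :=
          mul_le_mul_of_nonneg_right h1 (Real.exp_pos _).le
      _ ≤ _ := by
          rw [mul_assoc]
          exact mul_le_mul_of_nonneg_left h2 (Nat.cast_nonneg _)

theorem hermiteFun_eq_polynomial (n : ℕ) : ∃ P : Polynomial ℝ, ∀ x,
    hermiteFun n x = P.eval x * Real.exp (-(1 / 2 * x ^ 2)) := by
  refine ⟨Polynomial.C ((Real.pi ^ (1 / 4 : ℝ))⁻¹ * (Real.sqrt (n.factorial : ℝ))⁻¹) *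
    (realHermite n).comp (Polynomial.C (Real.sqrt 2) * Polynomial.X), fun x => ?_⟩
  rw [hermiteFun_eq]
  simp

theorem exists_norm_fockFun_le (n : Fin m → ℕ) : ∃ C : ℝ, ∀ q, ‖fockFun n q‖ ≤ C := by
  have h : ∀ j, ∃ C : ℝ, ∀ x, |hermiteFun (n j) x| ≤ C := by
    intro j
    obtain ⟨P, hP⟩ := hermiteFun_eq_polynomial (n j)
    obtain ⟨C, hC⟩ := exists_polynomial_mul_exp_le P
    exact ⟨C, fun x => by rw [hP]; exact hC x⟩
  choose C hC using h
  refine ⟨∏ j, C j, fun q => ?_⟩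
  rw [fockFun, norm_prod]
  refine Finset.prod_le_prod (fun _ _ => norm_nonneg _) fun j _ => ?_
  simpa using hC j (q j)

theorem integrable_fockFun (n : Fin m → ℕ) : Integrable (fockFun n) := by
  refine Integrable.fintype_prod (𝕜 := ℂ) (E := ℝ) (μ := fun _ : Fin m => volume)
    (f := fun j x => (hermiteFun (n j) x : ℂ)) fun j => ?_
  obtain ⟨P, hP⟩ := hermiteFun_eq_polynomial (n j)
  have := (integrable_polynomial_mul_exp_neg_mul_sq P (b := 1 / 2) (by norm_num)).ofReal (𝕜 := ℂ)
  simp only [hP]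
  exact this

/-- The superposition `∑ c_n |n⟩` of the number states in `F`. -/
def fockSum (F : Finset (Fin m → ℕ)) (c : (Fin m → ℕ) → ℂ) : ModeSpace m := ∑ n ∈ F, c n • fock n

/-- The wave function of `fockSum F c`. -/
def fockSumFun (F : Finset (Fin m → ℕ)) (c : (Fin m → ℕ) → ℂ) (q : Fin m → ℝ) : ℂ :=
  ∑ n ∈ F, c n * fockFun n q

variable (F : Finset (Fin m → ℕ)) (c : (Fin m → ℕ) → ℂ)

theorem fockSum_coeFn : fockSum F c =ᵐ[volume] fockSumFun F c := by
  classical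
  unfold fockSum fockSumFun
  induction F using Finset.induction_on with
  | empty =>
    simp only [Finset.sum_empty]
    exact Lp.coeFn_zero _ _ _
  | insert a F ha ih =>
    simp only [Finset.sum_insert ha]
    filter_upwards [ih, Lp.coeFn_add (c a • fock a) (∑ n ∈ F, c n • fock n),
      Lp.coeFn_smul (c a) (fock a), fock_coeFn a] with q h1 h2 h3 h4
    rw [h2, Pi.add_apply, h1, h3, Pi.smul_apply, h4, smul_eq_mul]

theorem continuous_fockSumFun : Continuous (fockSumFun F c) :=
  continuous_finsetSum _ fun n _ => (continuous_fockFun n).const_mul _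

theorem integrable_fockSumFun : Integrable (fockSumFun F c) :=
  integrable_finsetSum _ fun n _ => (integrable_fockFun n).const_mul _

theorem exists_norm_fockSumFun_le : ∃ B : ℝ, ∀ q, ‖fockSumFun F c q‖ ≤ B := by
  choose C hC using exists_norm_fockFun_le (m := m)
  refine ⟨∑ n ∈ F, ‖c n‖ * C n, fun q => norm_sum_le_of_le _ fun n _ => ?_⟩
  rw [norm_mul]
  exact mul_le_mul_of_nonneg_left (hC n q) (norm_nonneg _)

theorem inner_fockSum_dparity (z : PhaseSpace m) :
    ⟪fockSum F c, dparity z (fockSum F c)⟫_ℂ =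
      ∑ j ∈ F, ∑ k ∈ F, starRingEnd ℂ (c j) * c k * ⟪fock j, dparity z (fock k)⟫_ℂ := by
  simp only [fockSum, map_sum, sum_inner, inner_sum, map_smul, inner_smul_left, inner_smul_right,
    Finset.mul_sum]
  rw [Finset.sum_comm]
  refine Finset.sum_congr rfl fun j _ => Finset.sum_congr rfl fun k _ => ?_
  ring

/-- Finite superpositions are used because the Wigner function of a general vector need not be
integrable. -/
theorem integrable_inner_fockSum_dparity :
    Integrable fun z : PhaseSpace m => ⟪fockSum F c, dparity z (fockSum F c)⟫_ℂ := by
  simp only [inner_fockSum_dparity]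
  exact integrable_finsetSum _ fun j _ => integrable_finsetSum _ fun k _ =>
    (integrable_inner_fock_dparity j k).const_mul _

theorem inner_fockSum_dparity_eq (z : PhaseSpace m) :
    ⟪fockSum F c, dparity z (fockSum F c)⟫_ℂ =
      oscFT (corr (fockSumFun F c) (fockSumFun F c) z.1) z.2 := by
  rw [inner_dparity, oscFT_congr (corr_congr (fockSum_coeFn F c) (fockSum_coeFn F c) z.1)]

theorem integrable_norm_inner_fockSum_dparity_pow_four :
    Integrable fun z : PhaseSpace m => ‖⟪fockSum F c, dparity z (fockSum F c)⟫_ℂ‖ ^ 4 := by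
  have h := (integrable_inner_fockSum_dparity F c).norm
  have h3 := h.bdd_mul (c := (‖fockSum F c‖ * ‖fockSum F c‖) ^ 3)
    (f := fun z : PhaseSpace m => ‖⟪fockSum F c, dparity z (fockSum F c)⟫_ℂ‖ ^ 3)
    ((h.aestronglyMeasurable).pow 3) (Filter.Eventually.of_forall fun z => by
      rw [norm_pow, norm_norm]
      exact pow_le_pow_left₀ (norm_nonneg _) (norm_inner_dparity_le _ _ _) 3)
  refine h3.congr (Filter.Eventually.of_forall fun z => ?_)
  ring

theorem integral_norm_fockSumFun_sq : ∫ q, ‖fockSumFun F c q‖ ^ 2 = ‖fockSum F c‖ ^ 2 := by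
  have h1 : ⟪fockSum F c, fockSum F c⟫_ℂ = ∫ q, ((‖fockSumFun F c q‖ ^ 2 : ℝ) : ℂ) := by
    rw [L2.inner_def]
    refine integral_congr_ae ?_
    filter_upwards [fockSum_coeFn F c] with q h
    rw [h, inner_self_eq_norm_sq_to_K]
    norm_cast
  rw [inner_self_eq_norm_sq_to_K, integral_complex_ofReal] at h1
  refine Complex.ofReal_injective ?_
  rw [← h1]
  push_cast
  rfl

theorem integral_norm_inner_fockSum_dparity_pow_four_le (h : ‖fockSum F c‖ = 1) :
    ∫ z : PhaseSpace m, ‖⟪fockSum F c, dparity z (fockSum F c)⟫_ℂ‖ ^ 4 ≤ (Real.pi / 4) ^ m := by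
  obtain ⟨B, hB⟩ := exists_norm_fockSumFun_le F c
  have hf : ∀ x, Integrable (oscFT (corr (fockSumFun F c) (fockSumFun F c) x)) := by
    intro x
    have h1 : ∀ p, oscFT (corr (fockSumFun F c) (fockSumFun F c) x) p =
        ∑ j ∈ F, ∑ k ∈ F, starRingEnd ℂ (c j) * c k * ⟪fock j, dparity (x, p) (fock k)⟫_ℂ :=
      fun p => (inner_fockSum_dparity_eq F c (x, p)).symm.trans (inner_fockSum_dparity F c (x, p))
    rw [funext h1]
    exact integrable_finsetSum _ fun j _ => integrable_finsetSum _ fun k _ =>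
      (integrable_inner_fock_dparity_right j k x).const_mul _
  have hint := integrable_norm_inner_fockSum_dparity_pow_four F c
  simp only [inner_fockSum_dparity_eq] at hint ⊢
  refine (integral_norm_oscFT_corr_pow_four_le (continuous_fockSumFun F c) hB
    (integrable_fockSumFun F c) hf hint).trans_eq ?_
  rw [integral_norm_fockSumFun_sq, h]
  norm_num

end

section

/-! ### Weyl quantization of bounded integrable symbols -/

open ContinuousLinearMap InnerProductSpace

variable {m : ℕ}

theorem integrable_mul_inner_dparity {g : PhaseSpace m → ℝ} (hg : Integrable g)
    (u w : ModeSpace m) : Integrable fun z => (g z : ℂ) * ⟪u, dparity z w⟫_ℂ := by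
  simp only [mul_comm ((g _ : ℝ) : ℂ)]
  exact hg.ofReal.bdd_mul (stronglyMeasurable_inner_dparity u w).aestronglyMeasurable
    (Filter.Eventually.of_forall fun z => norm_inner_dparity_le u w z)

/-- The sesquilinear form `π^{-m} ∫ g(z) ⟨u|A_z|w⟩ dz`. -/
def weylForm (g : PhaseSpace m → ℝ) (u w : ModeSpace m) : ℂ :=
  ((Real.pi ^ m)⁻¹ : ℝ) * ∫ z, (g z : ℂ) * ⟪u, dparity z w⟫_ℂ

theorem norm_weylForm_le {g : PhaseSpace m → ℝ} (hg : Integrable g) (u w : ModeSpace m) :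
    ‖weylForm g u w‖ ≤ (Real.pi ^ m)⁻¹ * (∫ z, |g z|) * ‖u‖ * ‖w‖ := by
  rw [weylForm, norm_mul, Complex.norm_real, Real.norm_of_nonneg (by positivity), mul_assoc,
    mul_assoc]
  refine mul_le_mul_of_nonneg_left ?_ (by positivity)
  rw [← integral_mul_const]
  refine norm_integral_le_of_norm_le (hg.abs.mul_const _) (Filter.Eventually.of_forall fun z => ?_)
  rw [norm_mul, Complex.norm_real, Real.norm_eq_abs]
  exact mul_le_mul_of_nonneg_left (norm_inner_dparity_le u w z) (abs_nonneg _)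

theorem conj_weylForm (g : PhaseSpace m → ℝ) (u w : ModeSpace m) :
    starRingEnd ℂ (weylForm g u w) = weylForm g w u := by
  rw [weylForm, weylForm, map_mul, Complex.conj_ofReal, ← integral_conj]
  simp only [map_mul, Complex.conj_ofReal, conj_inner_dparity]

/-- The quantization is a superposition of self-adjoint contractions A_z with real density g / π^m.
Its sesquilinear form is therefore Hermitian and bounded by the L¹ norm, and a bounded form is
represented by an operator. -/
theorem exists_weyl {g : PhaseSpace m → ℝ} (hg : Integrable g) :
    ∃ Z : Op m, IsSelfAdjoint Z ∧ ‖Z‖ ≤ (Real.pi ^ m)⁻¹ * ∫ z, |g z| ∧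
      ∀ u w, ⟪u, Z w⟫_ℂ = weylForm g u w := by
  have hi := integrable_mul_inner_dparity hg
  let B₀ : ModeSpace m →ₗ⋆[ℂ] ModeSpace m →ₗ[ℂ] ℂ :=
    LinearMap.mk₂'ₛₗ (starRingEnd ℂ) (RingHom.id ℂ) (weylForm g)
      (fun u u' w => by
        simp only [weylForm, inner_add_left, mul_add]
        rw [integral_add (hi u w) (hi u' w), mul_add])
      (fun a u w => by
        simp only [weylForm, inner_smul_left, smul_eq_mul, mul_left_comm _ (starRingEnd ℂ a)]
        rw [integral_const_mul, mul_left_comm])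
      (fun u w w' => by
        simp only [weylForm, map_add, inner_add_right, mul_add]
        rw [integral_add (hi u w) (hi u w'), mul_add])
      (fun a u w => by
        simp only [weylForm, map_smul, inner_smul_right, smul_eq_mul, mul_left_comm _ a]
        rw [integral_const_mul, mul_left_comm]
        rfl)
  set Z : Op m := continuousLinearMapOfBilin (B₀.mkContinuous₂ _ (norm_weylForm_le hg)) with hZ
  have h1 : ∀ u w, ⟪Z u, w⟫_ℂ = weylForm g u w := fun u w => by
    rw [hZ, continuousLinearMapOfBilin_apply]
    rfl
  have h2 : ∀ u w, ⟪u, Z w⟫_ℂ = weylForm g u w := fun u w => by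
    rw [← inner_conj_symm, h1, conj_weylForm]
  refine ⟨Z, ?_, ?_, h2⟩
  · exact ((eq_adjoint_iff Z Z).2 fun u w => (h1 u w).trans (h2 u w).symm).symm
  · have hC : 0 ≤ (Real.pi ^ m)⁻¹ * ∫ z, |g z| :=
      mul_nonneg (by positivity) (integral_nonneg fun z => abs_nonneg _)
    refine opNorm_le_bound _ hC fun u => ?_
    rcases (norm_nonneg (Z u)).eq_or_lt with h0 | h0
    · rw [← h0]
      positivity
    · have h3 : ‖Z u‖ * ‖Z u‖ ≤ (Real.pi ^ m)⁻¹ * (∫ z, |g z|) * ‖u‖ * ‖Z u‖ := by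
        have h4 := norm_weylForm_le hg u (Z u)
        rw [← h1, inner_self_eq_norm_sq_to_K, norm_pow] at h4
        simpa [sq] using h4
      exact le_of_mul_le_mul_right h3 h0

/-! ### Operators with a Weyl symbol -/

/-- `g` is the Weyl symbol of `M`, that is `(2π)^m` times the Wigner function of `M`. -/
def HasSymbol (M : Op m) (g : PhaseSpace m → ℝ) : Prop :=
  ∀ j k : Fin m → ℕ, Integrable (fun z => (g z : ℂ) * ⟪fock j, dparity z (fock k)⟫_ℂ) ∧
    ⟪fock j, M (fock k)⟫_ℂ = weylForm g (fock j) (fock k)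

theorem HasSymbol.add {M N : Op m} {f g : PhaseSpace m → ℝ} (hM : HasSymbol M f)
    (hN : HasSymbol N g) : HasSymbol (M + N) (fun z => f z + g z) := by
  intro j k
  have h1 := (hM j k).1
  have h2 := (hN j k).1
  refine ⟨?_, ?_⟩
  · simp only [Complex.ofReal_add, add_mul]
    exact h1.add h2
  · rw [add_apply, inner_add_right, (hM j k).2, (hN j k).2]
    simp only [weylForm, Complex.ofReal_add, add_mul]
    rw [integral_add h1 h2, mul_add]

theorem HasSymbol.smul {M : Op m} {f : PhaseSpace m → ℝ} (hM : HasSymbol M f) (a : ℝ) :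
    HasSymbol ((a : ℂ) • M) (fun z => a * f z) := by
  intro j k
  refine ⟨?_, ?_⟩
  · simp only [Complex.ofReal_mul, mul_assoc]
    exact (hM j k).1.const_mul _
  · rw [smul_apply, inner_smul_right, (hM j k).2]
    simp only [weylForm, Complex.ofReal_mul, mul_assoc]
    rw [integral_const_mul, mul_left_comm]

theorem hasSymbol_one : HasSymbol (1 : Op m) (fun _ => 1) := by
  intro j k
  refine ⟨by simpa using integrable_inner_fock_dparity j k, ?_⟩
  simp only [weylForm, Complex.ofReal_one, one_mul]
  change ⟪fock j, fock k⟫_ℂ = _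
  rw [integral_inner_fock_dparity, inner_fock_fock, ← mul_assoc, ← Complex.ofReal_mul,
    inv_mul_cancel₀ (by positivity), Complex.ofReal_one, one_mul]

/-- Moyal's identity with u = w = v; the factors π^{-m}, 2^m and (π/2)^m cancel. -/
theorem hasSymbol_rankOne (v : ModeSpace m) :
    HasSymbol (rankOne ℂ v v) (fun z => 2 ^ m * (⟪v, dparity z v⟫_ℂ).re) := by
  have hre : ∀ z, (((⟪v, dparity z v⟫_ℂ).re : ℝ) : ℂ) = starRingEnd ℂ ⟪v, dparity z v⟫_ℂ := by
    intro z
    rw [conj_inner_dparity]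
    exact Complex.conj_eq_iff_re.1 (conj_inner_dparity v v z)
  intro j k
  have hi := integrable_mul_inner_fock_dparity (C := ‖v‖ * ‖v‖)
    (Complex.continuous_conj.comp_stronglyMeasurable
      (stronglyMeasurable_inner_dparity v v)).aestronglyMeasurable
    (fun z => by rw [RCLike.norm_conj]; exact norm_inner_dparity_le v v z) j k
  refine ⟨?_, ?_⟩
  · simp only [Complex.ofReal_mul, hre, mul_assoc]
    exact hi.const_mul _
  · simp only [weylForm, Complex.ofReal_mul, hre, mul_assoc]
    rw [integral_const_mul, integral_conj_inner_dparity_mul, rankOne_apply, inner_smul_right]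
    have hpi : (Real.pi : ℂ) ≠ 0 := by exact_mod_cast Real.pi_ne_zero
    push_cast
    rw [div_pow]
    field_simp

theorem HasSymbol.isWignerFunction {M : Op m} {g : PhaseSpace m → ℝ} (hM : HasSymbol M g) :
    IsWignerFunction M (fun z => ((2 * Real.pi) ^ m)⁻¹ * g z) := by
  intro j k
  have e : ∀ z, ((((2 * Real.pi) ^ m)⁻¹ * g z : ℝ) : ℂ) *
      wigner (rankOne ℂ (fock k) (fock j)) z =
      (((2 * Real.pi) ^ m)⁻¹ * (Real.pi ^ m)⁻¹ : ℝ) *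
        ((g z : ℂ) * ⟪fock j, dparity z (fock k)⟫_ℂ) := by
    intro z
    rw [wigner_rankOne]
    push_cast
    ring
  simp only [e]
  refine ⟨(hM j k).1.const_mul _, ?_⟩
  rw [integral_const_mul, trace]
  have h1 : ∀ n : Fin m → ℕ, ⟪fock n, (M ∘L rankOne ℂ (fock k) (fock j)) (fock n)⟫_ℂ =
      if n = j then ⟪fock j, M (fock k)⟫_ℂ else 0 := by
    intro n
    rw [comp_apply, rankOne_apply, inner_fock_fock]
    by_cases h : n = j
    · simp [h]
    · rw [if_neg h, if_neg (Ne.symm h), zero_smul, map_zero, inner_zero_right]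
  rw [tsum_congr h1, tsum_ite_eq, (hM j k).2, weylForm, ← mul_assoc, ← Complex.ofReal_mul,
    ← mul_assoc, mul_inv_cancel₀ (by positivity), one_mul]

end

section

/-! ### Truncated projections as W+ measurements -/

open ContinuousLinearMap InnerProductSpace

variable {m : ℕ} {ρ ρ₀ ρ₁ : Op m}

theorem HasSymbol.one_add_smul {X : Op m} {g : PhaseSpace m → ℝ} (hX : HasSymbol X g) (a : ℝ) :
    HasSymbol (((1 / 2 : ℝ) : ℂ) • (1 + (a : ℂ) • X)) (fun z => 1 / 2 * (1 + a * g z)) :=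
  (hasSymbol_one.add (hX.smul a)).smul (1 / 2)

theorem isPositive_half_one_add {X : Op m} (hX : IsSelfAdjoint X) {a : ℝ} (ha : |a| * ‖X‖ ≤ 1) :
    (((1 / 2 : ℝ) : ℂ) • (1 + (a : ℂ) • X)).IsPositive := by
  rw [isPositive_def']
  constructor
  · refine IsSelfAdjoint.smul (by simp [IsSelfAdjoint]) (IsSelfAdjoint.add (IsSelfAdjoint.one _)
      (IsSelfAdjoint.smul (by simp [IsSelfAdjoint]) hX))
  · intro x
    rw [reApplyInnerSelf_apply, smul_apply, inner_smul_left, Complex.conj_ofReal, add_apply,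
      smul_apply, inner_add_left, inner_smul_left, Complex.conj_ofReal]
    have h1 : ⟪(1 : Op m) x, x⟫_ℂ = ((‖x‖ ^ 2 : ℝ) : ℂ) := by
      change ⟪x, x⟫_ℂ = _
      rw [inner_self_eq_norm_sq_to_K]
      norm_cast
    have h2 : |a * (⟪X x, x⟫_ℂ).re| ≤ ‖x‖ ^ 2 := by
      rw [abs_mul]
      have h3 : |(⟪X x, x⟫_ℂ).re| ≤ ‖X‖ * ‖x‖ ^ 2 := by
        refine (Complex.abs_re_le_norm _).trans ((norm_inner_le_norm _ _).trans ?_)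
        rw [sq, ← mul_assoc]
        exact mul_le_mul_of_nonneg_right (X.le_opNorm x) (norm_nonneg _)
      calc _ ≤ |a| * (‖X‖ * ‖x‖ ^ 2) := mul_le_mul_of_nonneg_left h3 (abs_nonneg a)
        _ = |a| * ‖X‖ * ‖x‖ ^ 2 := by ring
        _ ≤ 1 * ‖x‖ ^ 2 := mul_le_mul_of_nonneg_right ha (by positivity)
        _ = _ := one_mul _
    rw [h1]
    change 0 ≤ (((1 / 2 : ℝ) : ℂ) * (((‖x‖ ^ 2 : ℝ) : ℂ) + (a : ℂ) * ⟪X x, x⟫_ℂ)).re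
    rw [Complex.re_ofReal_mul, Complex.add_re, Complex.ofReal_re, Complex.re_ofReal_mul]
    linarith [neg_abs_le (a * (⟪X x, x⟫_ℂ).re)]

theorem one_sub_half_one_add (X : Op m) (a : ℝ) :
    1 - ((1 / 2 : ℝ) : ℂ) • (1 + (a : ℂ) • X) =
      ((1 / 2 : ℝ) : ℂ) • (1 + ((-a : ℝ) : ℂ) • X) := by
  push_cast
  module

/-- The complementary outcome is the same operator with -a for a, so bounds on |a| ‖X‖ and |a| |g|
serve both outcomes. -/
theorem isWPlusPOVM_half_one_add {X : Op m} {g : PhaseSpace m → ℝ} (hX : IsSelfAdjoint X)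
    (hs : HasSymbol X g) {a : ℝ} (ha : |a| * ‖X‖ ≤ 1) (hg : ∀ z, |a| * |g z| ≤ 1) :
    IsWPlusPOVM (((1 / 2 : ℝ) : ℂ) • (1 + (a : ℂ) • X)) := by
  have h1 : ∀ (a : ℝ), (∀ z, |a| * |g z| ≤ 1) → ∀ z,
      0 ≤ ((2 * Real.pi) ^ m)⁻¹ * (1 / 2 * (1 + a * g z)) := by
    intro a hg z
    have := hg z
    rw [← abs_mul] at this
    have := neg_abs_le (a * g z)
    refine mul_nonneg (by positivity) ?_
    linarith
  refine ⟨isPositive_half_one_add hX ha, ?_, ⟨_, (hs.one_add_smul a).isWignerFunction, h1 a hg⟩, ?_⟩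
  · rw [one_sub_half_one_add]
    exact isPositive_half_one_add hX (by rwa [abs_neg])
  · rw [one_sub_half_one_add]
    exact ⟨_, (hs.one_add_smul (-a)).isWignerFunction, h1 (-a) fun z => by
      rw [abs_neg]
      exact hg z⟩

theorem IsState.re_ev_nonneg_of_isPositive (h : IsState ρ) {B : Op m} (hB : B.IsPositive) :
    0 ≤ (ev ρ B).re := by
  obtain ⟨R, hR, hR2, hs⟩ := h.exists_sqrt
  rw [ev_eq_expect hR hR2 hs, expect, Complex.re_tsum (summable_expect hs.summable B)]
  exact tsum_nonneg fun n => hB.re_inner_nonneg_right _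

theorem errorProb_eq (ρ₀ ρ₁ M : Op m) :
    errorProb ρ₀ ρ₁ M = 1 / 2 * (ev ρ₀ (1 - M)).re + 1 / 2 * (ev ρ₁ M).re := rfl

theorem le_wPlusDist (h₀ : IsState ρ₀) (h₁ : IsState ρ₁) {M : Op m} (hM : IsWPlusPOVM M) :
    2 * (1 - 2 * errorProb ρ₀ ρ₁ M) ≤ wPlusDist ρ₀ ρ₁ := by
  -- Without a lower bound the real `sInf` would take its default value 0.
  have hb : BddBelow {e : ℝ | ∃ M : Op m, IsWPlusPOVM M ∧ e = errorProb ρ₀ ρ₁ M} := by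
    refine ⟨0, ?_⟩
    rintro _ ⟨M, hM, rfl⟩
    rw [errorProb_eq]
    have := h₀.re_ev_nonneg_of_isPositive hM.2.1
    have := h₁.re_ev_nonneg_of_isPositive hM.1
    positivity
  have := csInf_le hb ⟨M, hM, rfl⟩
  rw [wPlusDist]
  linarith

/-- The measurement (1 + aX)/2 with |a| = 1/T has 2(1 - 2 P_e) = a tr (ρ₀ - ρ₁)X; the two signs of a
give the absolute value. -/
theorem abs_mul_le_wPlusDist (h₀ : IsState ρ₀) (h₁ : IsState ρ₁) {X : Op m}
    {g : PhaseSpace m → ℝ} (hX : IsSelfAdjoint X) (hs : HasSymbol X g) {T : ℝ} (hT : 0 < T)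
    (hXT : ‖X‖ ≤ T) (hg : ∀ z, |g z| ≤ T) :
    |(ev ρ₀ X - ev ρ₁ X).re| ≤ T * wPlusDist ρ₀ ρ₁ := by
  have key : ∀ a : ℝ, |a| = T⁻¹ → a * (ev ρ₀ X - ev ρ₁ X).re ≤ wPlusDist ρ₀ ρ₁ := by
    intro a ha
    have h := le_wPlusDist h₀ h₁ (isWPlusPOVM_half_one_add hX hs (a := a)
      (by rw [ha, inv_mul_le_iff₀ hT]; linarith)
      (fun z => by rw [ha, inv_mul_le_iff₀ hT]; linarith [hg z]))
    rw [errorProb_eq, one_sub_half_one_add, h₀.ev_smul, h₁.ev_smul, h₀.ev_add, h₁.ev_add,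
      h₀.ev_smul, h₁.ev_smul, h₀.ev_one, h₁.ev_one, Complex.re_ofReal_mul, Complex.re_ofReal_mul,
      Complex.add_re, Complex.add_re, Complex.re_ofReal_mul, Complex.re_ofReal_mul,
      Complex.one_re] at h
    rw [Complex.sub_re]
    linarith
  have h1 := key T⁻¹ (abs_of_pos (inv_pos.2 hT))
  have h2 := key (-T⁻¹) (by rw [abs_neg, abs_of_pos (inv_pos.2 hT)])
  rw [← inv_mul_le_iff₀ hT, ← abs_of_pos (inv_pos.2 hT), ← abs_mul, abs_le]
  constructor <;> linarith

/-! ### Truncation of the symbol of a pure state -/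

section Truncation

variable (F : Finset (Fin m → ℕ)) (c : (Fin m → ℕ) → ℂ)

/-- The Weyl symbol of the projection onto a superposition of number states. -/
def pureSymbol (z : PhaseSpace m) : ℝ :=
  2 ^ m * (⟪fockSum F c, dparity z (fockSum F c)⟫_ℂ).re

theorem measurable_pureSymbol : Measurable (pureSymbol F c) :=
  (Complex.measurable_re.comp
    (stronglyMeasurable_inner_dparity (fockSum F c) (fockSum F c)).measurable).const_mul _

theorem integrable_pureSymbol : Integrable (pureSymbol F c) :=
  (integrable_inner_fockSum_dparity F c).re.const_mul _

variable {F c}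

theorem abs_pureSymbol_le (z : PhaseSpace m) :
    |pureSymbol F c z| ≤ 2 ^ m * ‖⟪fockSum F c, dparity z (fockSum F c)⟫_ℂ‖ := by
  rw [pureSymbol, abs_mul, abs_of_pos (by positivity)]
  exact mul_le_mul_of_nonneg_left (Complex.abs_re_le_norm _) (by positivity)

theorem abs_pureSymbol_le_two_pow (hv : ‖fockSum F c‖ = 1) (z : PhaseSpace m) :
    |pureSymbol F c z| ≤ 2 ^ m := by
  refine (abs_pureSymbol_le z).trans (mul_le_of_le_one_right (by positivity) ?_)
  have := norm_inner_dparity_le (fockSum F c) (fockSum F c) z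
  rwa [hv, one_mul] at this

variable (F c) in
/-- The part of the symbol that exceeds the threshold `T`. -/
def symbolTail (T : ℝ) : PhaseSpace m → ℝ := {z | T < |pureSymbol F c z|}.indicator (pureSymbol F c)

theorem measurableSet_symbolTail (T : ℝ) : MeasurableSet {z | T < |pureSymbol F c z|} :=
  measurableSet_lt measurable_const (measurable_pureSymbol F c).abs

theorem integrable_symbolTail (T : ℝ) : Integrable (symbolTail F c T) :=
  (integrable_pureSymbol F c).indicator (measurableSet_symbolTail T)

theorem abs_pureSymbol_sub_tail_le {T : ℝ} (hT : 0 ≤ T) (z : PhaseSpace m) :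
    |pureSymbol F c z - symbolTail F c T z| ≤ T := by
  unfold symbolTail
  by_cases h : z ∈ {z | T < |pureSymbol F c z|}
  · rw [Set.indicator_of_mem h]
    simpa using hT
  · rw [Set.indicator_of_notMem h, sub_zero]
    exact not_lt.1 h

/-- Where the symbol g exceeds T one has |g| ≤ |g|⁴ / T³. The factor 2^{4m} in g⁴ and the L⁴ bound
(π/4)^m combine to 4^m after division by π^m. -/
theorem integral_abs_symbolTail_le (hv : ‖fockSum F c‖ = 1) {T : ℝ} (hT : 0 < T) :
    (Real.pi ^ m)⁻¹ * ∫ z, |symbolTail F c T z| ≤ 4 ^ m / T ^ 3 := by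
  have h4 := integrable_norm_inner_fockSum_dparity_pow_four F c
  have h1 : ∫ z, |symbolTail F c T z| ≤
      ∫ z : PhaseSpace m, (2 ^ m) ^ 4 / T ^ 3 *
        ‖⟪fockSum F c, dparity z (fockSum F c)⟫_ℂ‖ ^ 4 := by
    refine integral_mono (integrable_symbolTail T).abs (h4.const_mul _) fun z => ?_
    rw [div_mul_eq_mul_div, le_div_iff₀ (by positivity), ← mul_pow]
    unfold symbolTail
    by_cases h : z ∈ {z | T < |pureSymbol F c z|}
    · rw [Set.indicator_of_mem h]
      have h2 := pow_le_pow_left₀ (abs_nonneg _) (abs_pureSymbol_le (F := F) (c := c) z) 4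
      have h3 := pow_le_pow_left₀ hT.le (le_of_lt h) 3
      calc _ ≤ |pureSymbol F c z| * |pureSymbol F c z| ^ 3 :=
            mul_le_mul_of_nonneg_left h3 (abs_nonneg _)
        _ = |pureSymbol F c z| ^ 4 := by ring
        _ ≤ _ := h2
    · rw [Set.indicator_of_notMem h, abs_zero, zero_mul]
      positivity
  have h2 := integral_norm_inner_fockSum_dparity_pow_four_le F c hv
  rw [integral_const_mul] at h1
  calc _ ≤ (Real.pi ^ m)⁻¹ * ((2 ^ m) ^ 4 / T ^ 3 * (Real.pi / 4) ^ m) := by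
        refine mul_le_mul_of_nonneg_left (h1.trans ?_) (by positivity)
        exact mul_le_mul_of_nonneg_left h2 (by positivity)
    _ = 4 ^ m / T ^ 3 := by
        rw [div_pow, ← pow_mul, mul_comm m 4, pow_mul]
        have h16 : ((2 : ℝ) ^ 4) ^ m = 4 ^ m * 4 ^ m := by
          rw [← mul_pow]
          norm_num
        rw [h16]
        field_simp

theorem symbolTail_eq_zero (hv : ‖fockSum F c‖ = 1) (z : PhaseSpace m) :
    symbolTail F c (2 ^ m) z = 0 := by
  have h : z ∉ {z | 2 ^ m < |pureSymbol F c z|} := (abs_pureSymbol_le_two_pow hv z).not_gt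
  exact Set.indicator_of_notMem h _

/-- Subtract from |v⟩⟨v| the quantization Z of the tail. The difference has symbol at most T by
truncation and norm at most 1 + ζ ≤ T, so it is bounded through a W+ measurement. Z itself
contributes at most ζ for each state. -/
theorem abs_inner_sub_le (h₀ : IsState ρ₀) (h₁ : IsState ρ₁) (hv : ‖fockSum F c‖ = 1) {T ζ : ℝ}
    (hT : 0 < T) (hζ : (Real.pi ^ m)⁻¹ * ∫ z, |symbolTail F c T z| ≤ ζ) (hζT : 1 + ζ ≤ T) :
    ‖⟪fockSum F c, (ρ₀ - ρ₁) (fockSum F c)⟫_ℂ‖ ≤ T * wPlusDist ρ₀ ρ₁ + 2 * ζ := by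
  obtain ⟨Z, hZ1, hZ2, hZ3⟩ := exists_weyl (integrable_symbolTail (F := F) (c := c) T)
  set v := fockSum F c with hvdef
  have hZ : HasSymbol Z (symbolTail F c T) := fun j k =>
    ⟨integrable_mul_inner_dparity (integrable_symbolTail T) _ _, hZ3 _ _⟩
  have hP : HasSymbol (rankOne ℂ v v) (pureSymbol F c) := hasSymbol_rankOne v
  have hX : HasSymbol (rankOne ℂ v v - Z) (fun z => pureSymbol F c z - symbolTail F c T z) := by
    have := hP.add (hZ.smul (-1))
    simpa [sub_eq_add_neg] using this
  have hsa : IsSelfAdjoint (rankOne ℂ v v - Z) :=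
    IsSelfAdjoint.sub (IsPositive.isSelfAdjoint (isPositive_rankOne_self v)) hZ1
  have hnorm : ‖rankOne ℂ v v - Z‖ ≤ T := by
    refine (norm_sub_le _ _).trans ?_
    rw [norm_rankOne, hv]
    linarith
  have h := abs_mul_le_wPlusDist h₀ h₁ hsa hX hT hnorm (abs_pureSymbol_sub_tail_le hT.le)
  rw [h₀.ev_sub, h₁.ev_sub, h₀.ev_rankOne, h₁.ev_rankOne] at h
  have hreal : ⟪v, (ρ₀ - ρ₁) v⟫_ℂ = (((⟪v, ρ₀ v⟫_ℂ - ⟪v, ρ₁ v⟫_ℂ).re : ℝ) : ℂ) := by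
    rw [sub_apply, inner_sub_right]
    refine Complex.ext rfl ?_
    have h2 := (Complex.nonneg_iff.1 (h₀.1.inner_nonneg_right v)).2
    have h3 := (Complex.nonneg_iff.1 (h₁.1.inner_nonneg_right v)).2
    rw [Complex.sub_im, ← h2, ← h3]
    simp
  rw [hreal, Complex.norm_real, Real.norm_eq_abs]
  have h2 : |(ev ρ₀ Z - ev ρ₁ Z).re| ≤ 2 * ζ := by
    refine (Complex.abs_re_le_norm _).trans ((norm_sub_le _ _).trans ?_)
    linarith [h₀.norm_ev_le Z, h₁.norm_ev_le Z]
  have h3 : (⟪v, ρ₀ v⟫_ℂ - ⟪v, ρ₁ v⟫_ℂ).re =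
      (⟪v, ρ₀ v⟫_ℂ - ev ρ₀ Z - (⟪v, ρ₁ v⟫_ℂ - ev ρ₁ Z)).re + (ev ρ₀ Z - ev ρ₁ Z).re := by
    simp only [Complex.sub_re]
    ring
  rw [h3]
  exact (abs_add_le _ _).trans (add_le_add h h2)

/-- At the level T = 2^m nothing is cut off, so ζ = 0. -/
theorem norm_inner_sub_le_two_pow (h₀ : IsState ρ₀) (h₁ : IsState ρ₁) (hv : ‖fockSum F c‖ = 1) :
    ‖⟪fockSum F c, (ρ₀ - ρ₁) (fockSum F c)⟫_ℂ‖ ≤ 2 ^ m * wPlusDist ρ₀ ρ₁ := by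
  have := abs_inner_sub_le h₀ h₁ hv (T := 2 ^ m) (ζ := 0) (by positivity)
    (by simp [symbolTail_eq_zero hv]) (by rw [add_zero]; exact one_le_pow₀ (by norm_num))
  simpa using this

theorem IsState.re_inner_mem (h : IsState ρ) {v : ModeSpace m} (hv : ‖v‖ = 1) :
    0 ≤ (⟪v, ρ v⟫_ℂ).re ∧ (⟪v, ρ v⟫_ℂ).re ≤ 1 := by
  refine ⟨h.1.re_inner_nonneg_right v, ?_⟩
  rw [← h.ev_rankOne]
  refine (Complex.re_le_norm _).trans ((h.norm_ev_le _).trans ?_)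
  rw [norm_rankOne, hv, one_mul]

/-- The level T is tuned so that the tail costs half of the quantity μ to be bounded. What remains
is μ/2 ≤ T w with T³ proportional to 4^m / μ, and cubing it gives the fourth power of μ. -/
theorem norm_inner_sub_pow_four_le (h₀ : IsState ρ₀) (h₁ : IsState ρ₁) (hv : ‖fockSum F c‖ = 1) :
    ‖⟪fockSum F c, (ρ₀ - ρ₁) (fockSum F c)⟫_ℂ‖ ^ 4 ≤ 32 * 4 ^ m * wPlusDist ρ₀ ρ₁ ^ 3 := by
  have hA := norm_inner_sub_le_two_pow h₀ h₁ hv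
  have hw : 0 ≤ wPlusDist ρ₀ ρ₁ := nonneg_of_mul_nonneg_right ((norm_nonneg _).trans hA)
    (by positivity)
  set μ := ‖⟪fockSum F c, (ρ₀ - ρ₁) (fockSum F c)⟫_ℂ‖ with hμ
  rcases (norm_nonneg ⟪fockSum F c, (ρ₀ - ρ₁) (fockSum F c)⟫_ℂ).eq_or_lt with h0 | h0
  · rw [hμ, ← h0, zero_pow four_ne_zero]
    positivity
  rw [← hμ] at h0
  have hμ1 : μ ≤ 1 := by
    have e : ⟪fockSum F c, (ρ₀ - ρ₁) (fockSum F c)⟫_ℂ =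
        (((⟪fockSum F c, ρ₀ (fockSum F c)⟫_ℂ).re - (⟪fockSum F c, ρ₁ (fockSum F c)⟫_ℂ).re : ℝ) : ℂ) := by
      rw [sub_apply, inner_sub_right]
      refine Complex.ext (by simp) ?_
      have h2 := (Complex.nonneg_iff.1 (h₀.1.inner_nonneg_right (fockSum F c))).2
      have h3 := (Complex.nonneg_iff.1 (h₁.1.inner_nonneg_right (fockSum F c))).2
      rw [Complex.sub_im, ← h2, ← h3]
      simp
    rw [hμ, e, Complex.norm_real, Real.norm_eq_abs, abs_le]
    have := h₀.re_inner_mem hv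
    have := h₁.re_inner_mem hv
    constructor <;> linarith
  -- This choice makes the tail bound ζ = 4^m / T³ equal to μ/4.
  obtain ⟨T, hT0, hT⟩ : ∃ T : ℝ, 0 < T ∧ T ^ 3 = 4 * 4 ^ m / μ :=
    ⟨(4 * 4 ^ m / μ) ^ ((1 : ℝ) / 3), Real.rpow_pos_of_pos (by positivity) _, by
      rw [← Real.rpow_natCast, ← Real.rpow_mul (by positivity)]
      norm_num⟩
  have hζ : (4 : ℝ) ^ m / T ^ 3 = μ / 4 := by
    rw [hT]
    field_simp
  have h4 : (4 : ℝ) ≤ T ^ 3 := by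
    rw [hT, le_div_iff₀ h0]
    have : (1 : ℝ) ≤ 4 ^ m := one_le_pow₀ (by norm_num)
    nlinarith
  -- Since μ ≤ 1, the requirement 1 + ζ ≤ T follows from 5/4 ≤ T, and T³ ≥ 4 exceeds (5/4)³.
  have hT1 : 5 / 4 ≤ T := by
    by_contra hlt
    have := pow_lt_pow_left₀ (not_le.1 hlt) hT0.le (n := 3) (by norm_num)
    norm_num at this
    linarith
  have h := abs_inner_sub_le h₀ h₁ hv hT0 (integral_abs_symbolTail_le hv hT0)
    (by rw [hζ]; linarith)
  rw [hζ, ← hμ] at h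
  have h5 : μ / 2 ≤ T * wPlusDist ρ₀ ρ₁ := by linarith
  have h6 := pow_le_pow_left₀ (by positivity) h5 3
  rw [mul_pow, hT, div_mul_eq_mul_div, le_div_iff₀ h0] at h6
  nlinarith

end Truncation

/-! ### Operator norm bounds -/

/-- The norm of a self-adjoint operator is the supremum of its Rayleigh quotients in absolute value,
and by completeness of the number states it is enough to test finite superpositions. -/
theorem norm_le_of_fockSum {X : Op m} (hX : IsSelfAdjoint X) {κ : ℝ} (hκ : 0 ≤ κ)
    (h : ∀ F c, ‖fockSum (m := m) F c‖ = 1 → ‖⟪fockSum F c, X (fockSum F c)⟫_ℂ‖ ≤ κ) :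
    ‖X‖ ≤ κ := by
  have h1 : ∀ v ∈ Submodule.span ℂ (Set.range (fock : (Fin m → ℕ) → ModeSpace m)),
      ‖⟪v, X v⟫_ℂ‖ ≤ κ * ‖v‖ ^ 2 := by
    intro v hv
    obtain ⟨l, rfl⟩ := (Finsupp.mem_span_range_iff_exists_finsupp).1 hv
    have e : (l.sum fun i a => a • fock i) = fockSum l.support l := rfl
    rw [e]
    rcases (norm_nonneg (fockSum l.support l)).eq_or_lt with h0 | h0
    · rw [norm_eq_zero.1 h0.symm]
      simp
    · set r := ‖fockSum l.support l‖ with hr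
      have e2 : fockSum l.support (fun n => ((r⁻¹ : ℝ) : ℂ) * l n) =
          ((r⁻¹ : ℝ) : ℂ) • fockSum l.support l := by
        simp only [fockSum, Finset.smul_sum, smul_smul]
      have h2 := h l.support (fun n => ((r⁻¹ : ℝ) : ℂ) * l n) (by
        rw [e2, norm_smul, Complex.norm_real, Real.norm_of_nonneg (by positivity), ← hr,
          inv_mul_cancel₀ h0.ne'])
      rw [e2, map_smul, inner_smul_left, inner_smul_right, Complex.conj_ofReal, norm_mul, norm_mul,
        Complex.norm_real, Real.norm_of_nonneg (by positivity), ← mul_assoc, ← mul_inv,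
        inv_mul_le_iff₀ (by positivity)] at h2
      linarith
  have hd : Dense ((Submodule.span ℂ (Set.range (fock : (Fin m → ℕ) → ModeSpace m)) :
      Submodule ℂ (ModeSpace m)) : Set (ModeSpace m)) := by
    have := (fockBasis m).dense_span
    rw [show (⇑(fockBasis m) : (Fin m → ℕ) → ModeSpace m) = fock from funext fockBasis_apply]
      at this
    exact Submodule.dense_iff_topologicalClosure_eq_top.2 this
  have h2 : ∀ v, ‖⟪v, X v⟫_ℂ‖ ≤ κ * ‖v‖ ^ 2 := by
    have hcl : IsClosed {v : ModeSpace m | ‖⟪v, X v⟫_ℂ‖ ≤ κ * ‖v‖ ^ 2} :=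
      isClosed_le (by fun_prop) (by fun_prop)
    intro v
    exact hcl.closure_subset_iff.2 h1 (hd v)
  rw [norm_eq_iSup_rayleighQuotient X hX.isSymmetric]
  refine ciSup_le fun v => ?_
  rw [rayleighQuotient, reApplyInnerSelf_apply, abs_div, abs_of_nonneg (sq_nonneg ‖v‖)]
  refine div_le_of_le_mul₀ (by positivity) hκ ?_
  refine (Complex.abs_re_le_norm _).trans ?_
  rw [norm_inner_symm]
  exact h2 v

theorem wPlusDist_nonneg (h₀ : IsState ρ₀) (h₁ : IsState ρ₁) : 0 ≤ wPlusDist ρ₀ ρ₁ := by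
  have h : fockSum ({0} : Finset (Fin m → ℕ)) (fun _ => 1) = fock 0 := by simp [fockSum]
  have := norm_inner_sub_le_two_pow h₀ h₁ (F := {0}) (c := fun _ => 1)
    (by rw [h, (orthonormal_fock m).1])
  exact nonneg_of_mul_nonneg_right ((norm_nonneg _).trans this) (by positivity)

theorem norm_sub_le_two_pow_mul (h₀ : IsState ρ₀) (h₁ : IsState ρ₁) :
    ‖ρ₀ - ρ₁‖ ≤ 2 ^ m * wPlusDist ρ₀ ρ₁ :=
  norm_le_of_fockSum
    (IsSelfAdjoint.sub (IsPositive.isSelfAdjoint h₀.1) (IsPositive.isSelfAdjoint h₁.1))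
    (mul_nonneg (by positivity) (wPlusDist_nonneg h₀ h₁))
    fun _ _ hv => norm_inner_sub_le_two_pow h₀ h₁ hv

theorem norm_sub_pow_four_le (h₀ : IsState ρ₀) (h₁ : IsState ρ₁) :
    ‖ρ₀ - ρ₁‖ ^ 4 ≤ 32 * 4 ^ m * wPlusDist ρ₀ ρ₁ ^ 3 := by
  have hK : 0 ≤ 32 * 4 ^ m * wPlusDist ρ₀ ρ₁ ^ 3 :=
    mul_nonneg (by positivity) (pow_nonneg (wPlusDist_nonneg h₀ h₁) 3)
  set K := 32 * 4 ^ m * wPlusDist ρ₀ ρ₁ ^ 3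
  have h : ‖ρ₀ - ρ₁‖ ≤ Real.sqrt (Real.sqrt K) := by
    refine norm_le_of_fockSum
      (IsSelfAdjoint.sub (IsPositive.isSelfAdjoint h₀.1) (IsPositive.isSelfAdjoint h₁.1))
      (Real.sqrt_nonneg _) fun F c hv => ?_
    refine Real.le_sqrt_of_sq_le (Real.le_sqrt_of_sq_le ?_)
    rw [← pow_mul]
    exact norm_inner_sub_pow_four_le h₀ h₁ hv
  calc _ ≤ Real.sqrt (Real.sqrt K) ^ 4 := pow_le_pow_left₀ (norm_nonneg _) h 4
    _ = (Real.sqrt (Real.sqrt K) ^ 2) ^ 2 := by ring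
    _ = K := by rw [Real.sq_sqrt (Real.sqrt_nonneg _), Real.sq_sqrt hK]

end

section

/-! ### Counting number states of bounded energy -/

variable {m : ℕ}

/-- The number states with at most `N` photons in total. -/
def lowStates (m N : ℕ) : Finset (Fin m → ℕ) :=
  (Fintype.piFinset fun _ => Finset.range (N + 1)).filter fun n => ∑ j, n j ≤ N

theorem mem_lowStates {N : ℕ} {n : Fin m → ℕ} : n ∈ lowStates m N ↔ ∑ j, n j ≤ N := by
  rw [lowStates, Finset.mem_filter, Fintype.mem_piFinset]
  refine ⟨And.right, fun h => ⟨fun j => ?_, h⟩⟩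
  rw [Finset.mem_range, Nat.lt_succ_iff]
  exact (Finset.single_le_sum (fun _ _ => Nat.zero_le _) (Finset.mem_univ j)).trans h

theorem lowStates_zero : lowStates m 0 = {0} := by
  ext n
  rw [mem_lowStates, Finset.mem_singleton, Nat.le_zero, Finset.sum_eq_zero_iff, funext_iff]
  simp

/-- Each counted n satisfies q^N ≤ q^{|n|}, and the sum of q^{|n|} over all n is the m-th power of a
geometric series. -/
theorem card_lowStates_mul_pow_le (N : ℕ) {q : ℝ} (hq : 0 < q) (hq1 : q < 1) :
    ((lowStates m N).card : ℝ) * q ^ N ≤ ((1 - q)⁻¹) ^ m := by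
  have hgeom : ∑ k ∈ Finset.range (N + 1), q ^ k ≤ (1 - q)⁻¹ := by
    rw [← tsum_geometric_of_lt_one hq.le hq1]
    exact (summable_geometric_of_lt_one hq.le hq1).sum_le_tsum _ fun _ _ => by positivity
  calc ((lowStates m N).card : ℝ) * q ^ N = ∑ n ∈ lowStates m N, q ^ N := by
        rw [Finset.sum_const, nsmul_eq_mul]
    _ ≤ ∑ n ∈ lowStates m N, ∏ j, q ^ n j := by
        refine Finset.sum_le_sum fun n hn => ?_
        rw [Finset.prod_pow_eq_pow_sum]
        exact pow_le_pow_of_le_one hq.le hq1.le (mem_lowStates.1 hn)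
    _ ≤ ∑ n ∈ Fintype.piFinset fun _ : Fin m => Finset.range (N + 1), ∏ j, q ^ n j :=
        Finset.sum_le_sum_of_subset_of_nonneg (Finset.filter_subset _ _) fun _ _ _ =>
          Finset.prod_nonneg fun _ _ => by positivity
    _ = ∏ _j : Fin m, ∑ k ∈ Finset.range (N + 1), q ^ k :=
        (Finset.prod_univ_sum (fun _ : Fin m => Finset.range (N + 1)) fun _ k => q ^ k).symm
    _ = (∑ k ∈ Finset.range (N + 1), q ^ k) ^ m := by simp
    _ ≤ _ := pow_le_pow_left₀ (Finset.sum_nonneg fun _ _ => by positivity) hgeom m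

theorem card_lowStates_le {b : ℝ} (hb : 1 < b) {y : ℝ} (hy : 0 ≤ y * m) :
    ((lowStates m ⌊y * m⌋₊).card : ℝ) ≤ (b ^ y * (1 - b⁻¹)⁻¹) ^ m := by
  have hb0 : 0 < b := by linarith
  have h := card_lowStates_mul_pow_le (m := m) ⌊y * m⌋₊ (inv_pos.2 hb0) (inv_lt_one_of_one_lt₀ hb)
  rw [inv_pow, ← div_eq_mul_inv, div_le_iff₀ (by positivity)] at h
  refine h.trans ?_
  rw [mul_pow, mul_comm]
  have h1 : 0 < 1 - b⁻¹ := sub_pos.2 (inv_lt_one_of_one_lt₀ hb)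
  refine mul_le_mul_of_nonneg_right ?_ (by positivity)
  rw [← Real.rpow_natCast, ← Real.rpow_natCast, ← Real.rpow_mul hb0.le]
  exact Real.rpow_le_rpow_of_exponent_le hb.le (Nat.floor_le hy)

/-- An exponential is convex in its exponent, so it stays below an affine function as soon as it
does so at both ends of an interval. -/
theorem rpow_le_of_endpoints {b : ℝ} (hb : 0 < b) {y₀ y₁ y A C : ℝ} (h0 : y₀ ≤ y) (h1 : y ≤ y₁)
    (h : y₀ < y₁) (e0 : b ^ y₀ ≤ A + C * y₀) (e1 : b ^ y₁ ≤ A + C * y₁) : b ^ y ≤ A + C * y := by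
  have hd : 0 < y₁ - y₀ := sub_pos.2 h
  have hc := (convexOn_rpow_left hb).2 (Set.mem_univ y₀) (Set.mem_univ y₁)
    (show 0 ≤ (y₁ - y) / (y₁ - y₀) from div_nonneg (by linarith) hd.le)
    (show 0 ≤ (y - y₀) / (y₁ - y₀) from div_nonneg (by linarith) hd.le)
    (by field_simp; ring)
  simp only [smul_eq_mul] at hc
  have ey : (y₁ - y) / (y₁ - y₀) * y₀ + (y - y₀) / (y₁ - y₀) * y₁ = y := by
    field_simp
    ring
  rw [ey] at hc
  refine hc.trans ?_
  calc _ ≤ (y₁ - y) / (y₁ - y₀) * (A + C * y₀) + (y - y₀) / (y₁ - y₀) * (A + C * y₁) :=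
        add_le_add (mul_le_mul_of_nonneg_left e0 (div_nonneg (by linarith) hd.le))
          (mul_le_mul_of_nonneg_left e1 (div_nonneg (by linarith) hd.le))
    _ = A + C * y := by
        field_simp
        ring

theorem rpow_one_div_le {b a : ℝ} (hb : 0 ≤ b) (ha : 0 ≤ a) {n : ℕ} (hn : n ≠ 0) {k : ℕ}
    (h : b ^ k ≤ a ^ n) : b ^ ((k : ℝ) / n) ≤ a := by
  have hn' : (n : ℝ) ≠ 0 := Nat.cast_ne_zero.2 hn
  refine le_of_pow_le_pow_left₀ hn ha ?_
  rw [← Real.rpow_natCast (b ^ _), ← Real.rpow_mul hb, div_mul_cancel₀ _ hn', Real.rpow_natCast]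
  exact h

/-- A base `b` for which `card_lowStates_le` gives the bound `1 + 4 y`. -/
theorem exists_base {y : ℝ} (hy : 1 / 10 ≤ y) :
    ∃ b : ℝ, 1 < b ∧ b ^ y * (1 - b⁻¹)⁻¹ ≤ 1 + 4 * y := by
  rcases le_total y (1 / 5) with h1 | h1
  -- For a fixed base b the claim is b^y ≤ (1 - 1/b)(1 + 4y), affine on the right and checked at the
  -- endpoints: 0.9 + 3.6y for b = 10, 3/4 + 3y for b = 4, 1/2 + 2y for b = 2.
  · refine ⟨10, by norm_num, ?_⟩
    have e0 : (10 : ℝ) ^ ((1 : ℝ) / 10) ≤ 1.26 := by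
      have := rpow_one_div_le (b := 10) (a := 1.26) (n := 10) (k := 1) (by norm_num) (by norm_num)
        (by norm_num) (by norm_num)
      simpa using this
    have e1 : (10 : ℝ) ^ ((1 : ℝ) / 5) ≤ 1.62 := by
      have := rpow_one_div_le (b := 10) (a := 1.62) (n := 5) (k := 1) (by norm_num) (by norm_num)
        (by norm_num) (by norm_num)
      simpa using this
    have := rpow_le_of_endpoints (b := 10) (A := 0.9) (C := 3.6) (by norm_num) hy h1 (by norm_num)
      (e0.trans (by norm_num)) (e1.trans (by norm_num))
    norm_num at this ⊢
    linarith
  rcases le_total y (1 / 2) with h2 | h2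
  · refine ⟨4, by norm_num, ?_⟩
    have e0 : (4 : ℝ) ^ ((1 : ℝ) / 5) ≤ 1.35 := by
      have := rpow_one_div_le (b := 4) (a := 1.35) (n := 5) (k := 1) (by norm_num) (by norm_num)
        (by norm_num) (by norm_num)
      simpa using this
    have e1 : (4 : ℝ) ^ ((1 : ℝ) / 2) ≤ 2 := by
      have := rpow_one_div_le (b := 4) (a := 2) (n := 2) (k := 1) (by norm_num) (by norm_num)
        (by norm_num) (by norm_num)
      simpa using this
    have := rpow_le_of_endpoints (b := 4) (A := 3 / 4) (C := 3) (by norm_num) h1 h2 (by norm_num)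
      (e0.trans (by norm_num)) (e1.trans (by norm_num))
    norm_num at this ⊢
    linarith
  rcases le_total y 2 with h3 | h3
  · refine ⟨2, by norm_num, ?_⟩
    have e0 : (2 : ℝ) ^ ((1 : ℝ) / 2) ≤ 1.5 := by
      have := rpow_one_div_le (b := 2) (a := 1.5) (n := 2) (k := 1) (by norm_num) (by norm_num)
        (by norm_num) (by norm_num)
      simpa using this
    have := rpow_le_of_endpoints (b := 2) (A := 1 / 2) (C := 2) (by norm_num) h2 h3 (by norm_num)
      (e0.trans (by norm_num)) (by norm_num)
    norm_num at this ⊢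
    linarith
  · have hy0 : 0 < y := by linarith
    -- This is the base that minimizes the bound; it gives at most e(1 + y), which is below 1 + 4y
    -- for y ≥ 2.
    refine ⟨1 + 1 / y, by linarith [one_div_pos.2 hy0], ?_⟩
    have e1 : (1 - (1 + 1 / y)⁻¹)⁻¹ = 1 + y := by
      field_simp
      ring
    have e2 : (1 + 1 / y) ^ y ≤ Real.exp 1 := by
      have h4 : (1 + 1 / y) ≤ Real.exp (1 / y) := by
        linarith [Real.add_one_le_exp (1 / y)]
      calc (1 + 1 / y) ^ y ≤ Real.exp (1 / y) ^ y :=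
            Real.rpow_le_rpow (by positivity) h4 hy0.le
        _ = Real.exp 1 := by
            rw [← Real.exp_mul, one_div_mul_cancel hy0.ne']
    rw [e1]
    have h5 := Real.exp_one_lt_d9
    calc _ ≤ Real.exp 1 * (1 + y) := mul_le_mul_of_nonneg_right e2 (by linarith)
      _ ≤ 2.72 * (1 + y) := mul_le_mul_of_nonneg_right (by linarith) (by linarith)
      _ ≤ _ := by linarith

/-- The exponents 4 and 3 are those of d and D in the regime of few photons per mode. Taking cube
roots leaves an exponential with base 10^{4/3} to be compared with 1 + 4y at 0 and 1/10. -/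
theorem ten_rpow_le {y : ℝ} (h0 : 0 ≤ y) (h1 : y ≤ 1 / 10) :
    ((10 : ℝ) ^ y) ^ 4 ≤ (1 + 4 * y) ^ 3 := by
  set b : ℝ := 10 ^ ((4 : ℝ) / 3) with hb
  have hb0 : 0 < b := by positivity
  have e1 : b ^ ((1 : ℝ) / 10) ≤ 1.4 := by
    have := rpow_one_div_le (b := 10) (a := 1.4) (n := 30) (k := 4) (by norm_num) (by norm_num)
      (by norm_num) (by norm_num)
    rw [hb, ← Real.rpow_mul (by norm_num)]
    norm_num at this ⊢
    exact this
  have h := rpow_le_of_endpoints hb0 (A := 1) (C := 4) h0 h1 (by norm_num) (by simp)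
    (e1.trans (by norm_num))
  calc ((10 : ℝ) ^ y) ^ 4 = (b ^ y) ^ 3 := by
        rw [hb, ← Real.rpow_natCast, ← Real.rpow_natCast, ← Real.rpow_mul (by positivity),
          ← Real.rpow_mul (by positivity), ← Real.rpow_mul (by positivity)]
        congr 1
        push_cast
        ring
    _ ≤ _ := pow_le_pow_left₀ (by positivity) h 3

/-! ### The lower bound -/

variable {ρ₀ ρ₁ : Op m} {E c r : ℝ}

/-- `x = 2 y / c` is the ratio of `E` to `c ^ 2` when `y = E / (2 c)`. -/
theorem mul_le_one_add_pow (hr : 0 ≤ r) (hc : 0 < c) (htr : 4 * c + r ≤ 2) {y : ℝ} (hy : 0 < y) :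
    (1 + 4 * y) ^ m * (1 + (2 * r + r ^ 2) * (y * m) / (1 + 4 * y)) ≤ (1 + 2 * y / c) ^ m := by
  -- From c ≤ (2 - r)/4 and (2 - r)(4 + 2r + r²) = 8 - r³ ≤ 8. The surplus (2r + r²)y over 4y is
  -- then extracted by Bernoulli's inequality.
  have h1 : (4 + 2 * r + r ^ 2) * y ≤ 2 * y / c := by
    rw [le_div_iff₀ hc]
    have h2 : (4 + 2 * r + r ^ 2) * c ≤ 2 := by
      have h3 : c ≤ (2 - r) / 4 := by linarith
      have h4 : (4 + 2 * r + r ^ 2) * c ≤ (4 + 2 * r + r ^ 2) * ((2 - r) / 4) :=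
        mul_le_mul_of_nonneg_left h3 (by positivity)
      nlinarith [pow_nonneg hr 3]
    nlinarith
  have h2 : 0 ≤ (2 * r + r ^ 2) * y / (1 + 4 * y) := by positivity
  have h3 := one_add_mul_le_pow (a := (2 * r + r ^ 2) * y / (1 + 4 * y)) (by linarith) m
  calc _ = (1 + 4 * y) ^ m * (1 + m * ((2 * r + r ^ 2) * y / (1 + 4 * y))) := by ring
    _ ≤ (1 + 4 * y) ^ m * (1 + (2 * r + r ^ 2) * y / (1 + 4 * y)) ^ m :=
        mul_le_mul_of_nonneg_left h3 (by positivity)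
    _ = (1 + 4 * y + (2 * r + r ^ 2) * y) ^ m := by
        rw [← mul_pow]
        congr 1
        field_simp
    _ ≤ _ := pow_le_pow_left₀ (by positivity) (by linarith) m

/-- A discarded number state has at least N + 1 photons, and N + 1 ≥ Em/(2c), so Markov's inequality
leaves weight at most 2c outside for each state. Together these cancel the 4c. -/
theorem le_two_mul_card_mul_norm (h₀ : IsState ρ₀) (h₁ : IsState ρ₁) (hE : 0 ≤ E)
    (hE₀ : meanPhotonNumber ρ₀ ≤ ENNReal.ofReal (m * E))
    (hE₁ : meanPhotonNumber ρ₁ ≤ ENNReal.ofReal (m * E)) (hc : 0 < c)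
    (ht : 4 * c + r ≤ traceNorm (ρ₀ - ρ₁)) :
    r ≤ 2 * ((lowStates m ⌊E / (2 * c) * m⌋₊).card * ‖ρ₀ - ρ₁‖) := by
  set N := ⌊E / (2 * c) * m⌋₊ with hN
  have hF : ∀ n ∉ lowStates m N, (N + 1 : ℝ) ≤ ((∑ j, n j : ℕ) : ℝ) := by
    intro n hn
    rw [mem_lowStates, not_le] at hn
    exact_mod_cast hn
  have hN1 : (0 : ℝ) < N + 1 := by positivity
  have h := h₀.traceNorm_sub_le_card h₁ (lowStates m N)
  have h2 := h₀.re_ev_fockCompl_le (by positivity) hE₀ hN1 hF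
  have h3 := h₁.re_ev_fockCompl_le (by positivity) hE₁ hN1 hF
  have h4 : m * E / (N + 1) ≤ 2 * c := by
    rw [div_le_iff₀ hN1]
    have h5 : E / (2 * c) * m ≤ N + 1 := (Nat.lt_floor_add_one (E / (2 * c) * m)).le
    rw [div_mul_eq_mul_div, div_le_iff₀ (by positivity)] at h5
    linarith
  linarith

/-- Three regimes of y = E/(2c): only the vacuum is kept (y m < 1), y ≥ 1/10, and y < 1/10 with many
modes. The linear bound on the operator norm settles the first two, the fourth power bound the last.
-/
theorem sq_mul_inv_le_wPlusDist (h₀ : IsState ρ₀) (h₁ : IsState ρ₁) (hE : 0 ≤ E)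
    (hE₀ : meanPhotonNumber ρ₀ ≤ ENNReal.ofReal (m * E))
    (hE₁ : meanPhotonNumber ρ₁ ≤ ENNReal.ofReal (m * E)) (hc : 0 < c) (hr : 0 ≤ r)
    (ht : 4 * c + r ≤ traceNorm (ρ₀ - ρ₁)) :
    r ^ 2 ≤ 2 * 2 ^ m * (1 + E / c ^ 2) ^ m * wPlusDist ρ₀ ρ₁ := by
  have hw := wPlusDist_nonneg h₀ h₁
  have htr : 4 * c + r ≤ 2 := ht.trans (h₀.traceNorm_sub_le_two h₁)
  have hA := norm_sub_le_two_pow_mul h₀ h₁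
  have hB := norm_sub_pow_four_le h₀ h₁
  have hlow := le_two_mul_card_mul_norm h₀ h₁ hE hE₀ hE₁ hc ht
  have hvac : m * E ≤ c ^ 2 → traceNorm (ρ₀ - ρ₁) ≤ 4 * c + 3 * (m * E) := by
    intro he
    have hF : ∀ n ∉ ({0} : Finset (Fin m → ℕ)), (1 : ℝ) ≤ ((∑ j, n j : ℕ) : ℝ) := by
      intro n hn
      rw [← lowStates_zero, mem_lowStates, not_le] at hn
      exact_mod_cast hn
    have h2 := h₀.re_ev_fockCompl_le (by positivity) hE₀ one_pos hF
    have h3 := h₁.re_ev_fockCompl_le (by positivity) hE₁ one_pos hF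
    rw [div_one] at h2 h3
    exact h₀.traceNorm_sub_le_of_vacuum h₁ hc he h2 h3
  set w := wPlusDist ρ₀ ρ₁
  set lam := ‖ρ₀ - ρ₁‖ with hlam
  have hlam0 : 0 ≤ lam := norm_nonneg _
  have hx : 0 ≤ E / c ^ 2 := by positivity
  have hD1 : 1 ≤ (1 + E / c ^ 2) ^ m := one_le_pow₀ (by linarith)
  set D := (1 + E / c ^ 2) ^ m with hD
  set y := E / (2 * c) with hy
  have hxy : E / c ^ 2 = 2 * y / c := by
    rw [hy]
    field_simp
  -- Whenever the linear bound on the operator norm is used, only r d ≤ D remains to be shown.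
  have of_card : ∀ d : ℝ, 0 ≤ d → r ≤ 2 * (d * lam) → r * d ≤ D → r ^ 2 ≤ 2 * 2 ^ m * D * w := by
    intro d hd0 hd1 hd2
    calc r ^ 2 = r * r := sq r
      _ ≤ r * (2 * (d * lam)) := mul_le_mul_of_nonneg_left hd1 hr
      _ = 2 * (r * d) * lam := by ring
      _ ≤ 2 * D * lam := by gcongr
      _ ≤ 2 * D * (2 ^ m * w) := by gcongr
      _ = _ := by ring
  rcases lt_or_ge (y * m) 1 with h1 | h1
  · rw [Nat.floor_eq_zero.2 h1, lowStates_zero, Finset.card_singleton, Nat.cast_one] at hlow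
    refine of_card 1 zero_le_one hlow ?_
    rw [mul_one]
    rcases le_or_gt r 1 with h2 | h2
    · linarith
    -- Here r > 1 forces c < 1/4. If m E ≤ c², the vacuum estimate gives r ≤ 3c² < 1, a
    -- contradiction. Otherwise Bernoulli's inequality gives D ≥ 2 ≥ r.
    rcases le_or_gt (m * E) (c ^ 2) with h3 | h3
    · have h4 := ht.trans (hvac h3)
      nlinarith
    · have h4 := one_add_mul_le_pow (a := E / c ^ 2) (by linarith) m
      rw [← hD] at h4
      have h5 : 1 ≤ m * (E / c ^ 2) := by
        rw [mul_div_assoc', le_div_iff₀ (by positivity)]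
        linarith
      linarith
  · have hm0 : 0 < m := by
      rcases Nat.eq_zero_or_pos m with h | h
      · rw [h] at h1
        norm_num at h1
      · exact h
    have hm1 : (1 : ℝ) ≤ m := by exact_mod_cast hm0
    have hy0 : 0 < y := by
      by_contra hneg
      nlinarith
    have hgrow := mul_le_one_add_pow (m := m) hr hc htr hy0
    rw [← hxy, ← hD] at hgrow
    rcases le_or_gt (1 / 10) y with h2 | h2
    · obtain ⟨b, hb, hby⟩ := exists_base h2
      refine of_card _ (Nat.cast_nonneg _) hlow ?_
      have hb1 : 0 < 1 - b⁻¹ := sub_pos.2 (inv_lt_one_of_one_lt₀ hb)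
      have hd : ((lowStates m ⌊y * m⌋₊).card : ℝ) ≤ (1 + 4 * y) ^ m :=
        (card_lowStates_le hb (by linarith)).trans
          (pow_le_pow_left₀ (mul_nonneg (by positivity) (by positivity)) hby m)
      -- Both 1 and y are at most y m. With the ratio 1/5 the surplus in D absorbs r, since r²/5 -
      -- 3r/5 + 1 has negative discriminant.
      have h3 : (1 / 5 : ℝ) ≤ y * m / (1 + 4 * y) := by
        rw [le_div_iff₀ (by positivity)]
        nlinarith
      have h4 : r ≤ 1 + (2 * r + r ^ 2) * (y * m) / (1 + 4 * y) := by
        rw [mul_div_assoc]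
        have : (2 * r + r ^ 2) * (1 / 5) ≤ (2 * r + r ^ 2) * (y * m / (1 + 4 * y)) :=
          mul_le_mul_of_nonneg_left h3 (by positivity)
        nlinarith [sq_nonneg (r - 3 / 2)]
      calc _ ≤ (1 + (2 * r + r ^ 2) * (y * m) / (1 + 4 * y)) * (1 + 4 * y) ^ m :=
            mul_le_mul h4 hd (Nat.cast_nonneg _) (hr.trans h4)
        _ ≤ D := by rwa [mul_comm]
    -- y m ≥ 1 with y < 1/10 forces more than ten modes.
    · have hm11 : 11 ≤ m := by
        have : (10 : ℝ) < m := by nlinarith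
        exact_mod_cast this
      set d : ℝ := ((lowStates m ⌊y * m⌋₊).card : ℝ) with hd
      have hd0 : 0 ≤ d := Nat.cast_nonneg _
      have hd1 : d ≤ ((10 : ℝ) ^ y * (1 - 10⁻¹)⁻¹) ^ m :=
        card_lowStates_le (by norm_num) (by linarith)
      -- The counting bound with base 10 costs (10/9)^4 per mode in d⁴, and 1.3122 = 2 · (9/10)^4 is
      -- what the spare factor 2 per mode leaves over.
      have hd4 : 1.3122 ^ m * d ^ 4 ≤ 2 ^ m * ((1 + 4 * y) ^ m) ^ 3 := by
        have h3 : d ^ 4 ≤ ((((10 : ℝ) ^ y) ^ 4) * (10 / 9) ^ 4) ^ m := by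
          refine (pow_le_pow_left₀ hd0 hd1 4).trans_eq ?_
          rw [← pow_mul, mul_comm m 4, pow_mul, mul_pow]
          norm_num
        calc _ ≤ 1.3122 ^ m * ((1 + 4 * y) ^ 3 * (10 / 9) ^ 4) ^ m := by
              refine mul_le_mul_of_nonneg_left (h3.trans ?_) (by positivity)
              have := ten_rpow_le hy0.le h2.le
              gcongr
          _ = _ := by
              rw [← mul_pow, ← pow_mul, mul_comm m 3, pow_mul, ← mul_pow]
              congr 1
              ring
      -- The surplus reaches 16 at the eleventh power, but not at the tenth.
      have h16 : (16 : ℝ) ≤ 1.3122 ^ m :=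
        calc (16 : ℝ) ≤ 1.3122 ^ 11 := by norm_num
          _ ≤ _ := pow_le_pow_right₀ (by norm_num) hm11
      -- y m ≥ 1 while 1 + 4y ≤ 7/5.
      have h3 : (5 / 7 : ℝ) ≤ y * m / (1 + 4 * y) := by
        rw [le_div_iff₀ (by positivity)]
        linarith
      have h4 : 1 + 10 / 7 * r ≤ 1 + (2 * r + r ^ 2) * (y * m) / (1 + 4 * y) := by
        rw [mul_div_assoc]
        have : (2 * r + r ^ 2) * (5 / 7) ≤ (2 * r + r ^ 2) * (y * m / (1 + 4 * y)) :=
          mul_le_mul_of_nonneg_left h3 (by positivity)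
        nlinarith
      have hD3 : ((1 + 4 * y) ^ m) ^ 3 * (1 + 10 / 7 * r) ^ 3 ≤ D ^ 3 := by
        rw [← mul_pow]
        refine pow_le_pow_left₀ (by positivity) (le_trans ?_ hgrow) 3
        exact mul_le_mul_of_nonneg_left h4 (by positivity)
      have hr3 : 64 * r ^ 2 ≤ 16 * (1 + 10 / 7 * r) ^ 3 := by
        nlinarith [pow_nonneg hr 3, pow_nonneg hr 2]
      -- This is exactly what the cube of the goal needs: r⁴ ≤ 16 d⁴ lam⁴ and lam⁴ ≤ 32 · 4^m w³
      -- give r⁶ ≤ 64 r² d⁴ · 8 · 4^m w³, to be compared with (2 · 2^m D w)³.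
      have hmain : 64 * r ^ 2 * d ^ 4 ≤ 2 ^ m * D ^ 3 :=
        calc 64 * r ^ 2 * d ^ 4 ≤ 16 * (1 + 10 / 7 * r) ^ 3 * d ^ 4 := by gcongr
          _ ≤ 1.3122 ^ m * (1 + 10 / 7 * r) ^ 3 * d ^ 4 := by gcongr
          _ = 1.3122 ^ m * d ^ 4 * (1 + 10 / 7 * r) ^ 3 := by ring
          _ ≤ 2 ^ m * ((1 + 4 * y) ^ m) ^ 3 * (1 + 10 / 7 * r) ^ 3 := by gcongr
          _ = 2 ^ m * (((1 + 4 * y) ^ m) ^ 3 * (1 + 10 / 7 * r) ^ 3) := by ring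
          _ ≤ _ := by gcongr
      rcases hr.eq_or_lt with hr0 | hr0
      · rw [← hr0, zero_pow two_ne_zero]
        positivity
      have h5 := pow_le_pow_left₀ hr hlow 4
      have h6 : r ^ 4 ≤ 16 * d ^ 4 * (32 * 4 ^ m * w ^ 3) :=
        calc r ^ 4 ≤ (2 * (d * lam)) ^ 4 := h5
          _ = 16 * d ^ 4 * lam ^ 4 := by ring
          _ ≤ _ := by gcongr
      have h7 : (r ^ 2) ^ 3 ≤ (2 * 2 ^ m * D * w) ^ 3 :=
        calc (r ^ 2) ^ 3 = r ^ 2 * r ^ 4 := by ring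
          _ ≤ r ^ 2 * (16 * d ^ 4 * (32 * 4 ^ m * w ^ 3)) := by gcongr
          _ = 64 * r ^ 2 * d ^ 4 * (8 * 4 ^ m * w ^ 3) := by ring
          _ ≤ 2 ^ m * D ^ 3 * (8 * 4 ^ m * w ^ 3) := by gcongr
          _ = _ := by
              have h4m : (4 : ℝ) ^ m = 2 ^ m * 2 ^ m := by
                rw [← mul_pow]
                norm_num
              rw [h4m]
              clear_value D
              ring
      exact le_of_pow_le_pow_left₀ three_ne_zero (by positivity) h7

end

end Bosonic

end

theorem corollary3 (m : ℕ) (ρ₀ ρ₁ : Bosonic.Op m)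
    (h₀ : Bosonic.IsState ρ₀) (h₁ : Bosonic.IsState ρ₁)
    (E t c r : ℝ) (hE : 0 ≤ E)
    (hE₀ : Bosonic.meanPhotonNumber ρ₀ ≤ ENNReal.ofReal ((m : ℝ) * E))
    (hE₁ : Bosonic.meanPhotonNumber ρ₁ ≤ ENNReal.ofReal ((m : ℝ) * E))
    (hc : 0 < c) (hr : 0 ≤ r) (htcr : t = 4 * c + r)
    (ht : t ≤ Bosonic.traceNorm (ρ₀ - ρ₁)) :
    r ^ 2 * ((2 : ℝ) ^ (m + 1))⁻¹ * ((1 + E / c ^ 2) ^ m)⁻¹ ≤ Bosonic.wPlusDist ρ₀ ρ₁ ∧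
    ∀ δ : ℝ, 0 < δ → 0 < r → Bosonic.wPlusDist ρ₀ ρ₁ ≤ δ →
      Real.log (r ^ 2 / (2 * δ)) ≤ (m : ℝ) * Real.log (2 * (1 + E / c ^ 2)) := by
  have h := Bosonic.sq_mul_inv_le_wPlusDist h₀ h₁ hE hE₀ hE₁ hc hr (htcr ▸ ht)
  have hx : 0 < 1 + E / c ^ 2 := by positivity
  refine ⟨?_, fun δ hδ hr0 hw => ?_⟩
  · rw [mul_assoc, ← mul_inv, ← div_eq_mul_inv, div_le_iff₀ (by positivity)]
    refine h.trans_eq ?_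
    ring
  · rw [← Real.log_pow]
    refine Real.log_le_log (by positivity) ?_
    rw [div_le_iff₀ (by positivity), mul_pow]
    calc r ^ 2 ≤ 2 * 2 ^ m * (1 + E / c ^ 2) ^ m * Bosonic.wPlusDist ρ₀ ρ₁ := h
      _ ≤ 2 * 2 ^ m * (1 + E / c ^ 2) ^ m * δ := mul_le_mul_of_nonneg_left hw (by positivity)
      _ = _ := by ring
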